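/- **Setting (FE-IDUU).** There are $n$ preemptable jobs of unit volume and unit weight with release times $0\le r_1\le\dots\le r_n$, and a single processor with speeds $0=s_0<s_1<\dots<s_k$, $k\ge1$, and power consumptions $0=P_0<P_1<\dots<P_k$. No speed is superfluous: for $1\le a<i<b\le k$ and $\lambda\in(0,1)$ with $\frac1{s_i}=\frac{\lambda}{s_a}+\frac{1-\lambda}{s_b}$ one has $\frac{P_i}{s_i}<\lambda\frac{P_a}{s_a}+(1-\lambda)\frac{P_b}{s_b}$. A schedule $\sigma=(J,S)$ assigns to each time $t\ge0$ a job $J(t)$ (or none) and a speed index $S(t)\in\{0,\dots,k\}$. Let $X_j(\sigma)=\{t: J(t)=j,\ S(t)>0\}$. The schedule is feasible if, for every job $j$, $J(t)\ne j$ for $t<r_j$, $\int_{X_j(\sigma)}s_{S(t)}\,dt=1$, and $X_j(\sigma)$ is bounded. Let $x_j(\sigma)=|X_j(\sigma)|$ be the processing time, $1/x_j(\sigma)$ the (average) speed and $C_j(\sigma)=\sup X_j(\sigma)$ the completion time of $j$. A feasible schedule is optimal if it minimizes flow plus energy, $\sum_j(C_j(\sigma)-r_j)+\int_0^\infty P_{S(t)}\,dt$,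 among all feasible schedules. The relation "$j$ affects $j'$" in $\sigma$ is the transitive closure of "$C_j(\sigma)\le C_{j'}(\sigma)$ and $C_j(\sigma)>r_{j'}$"; the affection $\kappa_j(\sigma)$ is the number of jobs affected by $j$. Let $\Delta_i=\frac{P_{i+1}s_i-P_is_{i+1}}{s_{i+1}-s_i}$ for $1\le i<k$ and $\Delta_k=\infty$; the shrinking energy $\Delta_j(\sigma)$ is $\Delta_i$ if the speed of $j$ lies in $[s_i,s_{i+1})$, and $\Delta_k$ if it equals $s_k$. For speeds $u_1,\dots,u_n\in[s_1,s_k]$, let $\sigma(u)$ be the schedule that processes the jobs in the order $1,\dots,n$, each as early as possible, job $j$ at average speed $u_j$ using only the given speeds next to $u_j$ (only $u_j$ itself if it is a given speed). **The $(\kappa-\Delta)$-algorithm.** Start with $u_j=s_1$ for all $j$. While there is a job $j$ with $\kappa_j-\Delta_j>0$ in $\sigma(u)$, choose a job $j^*$ that maximizes $\kappa_j-\Delta_j$ (ties are broken arbitrarily) and increase $u_{j^*}$ until, for the first time, $\kappa_{j^*}-\Delta_{j^*}\le0$ or $\kappa_{j^*}-\Delta_{j^*}\ne\max_j(\kappa_j-\Delta_j)$.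 In the variant with weak inequalities, "$>0$" and "$\le0$" are replaced by "$\ge0$" and "$<0$". **Theorem.** For both variants the following holds. For any number $k$ of speeds, every run of the algorithm is well defined (an iteration can be carried out as long as the loop condition holds), ends after at most $n^2k$ iterations, and ends with speeds $u$ for which $\sigma(u)$ is an optimal schedule. Moreover, the algorithm runs in polynomial time: there is a single program for a random access machine with arithmetic operations $+,-,\times,/$ and comparisons of numbers which, given $n$, $k$, the $r_j$, $s_i$ and $P_i$, outputs the final speeds of a run of the algorithm; the number of its steps is at most polynomial in $n+k$, for all real inputs, and, for rational inputs, its cost with every operation charged by the binary length of the numbers involved is at most polynomial in the binary length of the input. -/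

import Mathlib

open MeasureTheory

noncomputable section

namespace SpeedScaling

/-- An instance with `n` unit-size, unit-weight jobs, indexed in order of release, and with the
discrete speeds `0 = s 0 < s 1 < ⋯ < s k`, whose power consumptions are `0 = P 0 < ⋯ < P k`. -/
structure Inst where
  n : ℕ
  k : ℕ
  r : Fin n → ℝ
  s : Fin (k + 1) → ℝ
  P : Fin (k + 1) → ℝ
  k_pos : 0 < k
  r_nonneg : ∀ j, 0 ≤ r j
  r_mono : Monotone r
  s_zero : s 0 = 0
  s_strictMono : StrictMono s
  P_zero : P 0 = 0
  P_strictMono : StrictMono P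
  /-- No speed is superfluous: if processing one unit of volume at `s i` takes as long as
  processing it partly at `s a` and partly at `s b`, then it needs less energy. -/
  not_superfluous : ∀ a i b : Fin (k + 1), 0 < a → a < i → i < b →
    ∀ l : ℝ, 0 < l → l < 1 → 1 / s i = l * (1 / s a) + (1 - l) * (1 / s b) →
      P i / s i < l * (P a / s a) + (1 - l) * (P b / s b)

/-- A schedule: the job processed (`none` for idling) and the index of the speed, at every time
`t ≥ 0`. Values at negative times are irrelevant. -/
structure Schedule (I : Inst) where
  J : ℝ → Option (Fin I.n)
  S : ℝ → Fin (I.k + 1)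

namespace Schedule

variable {I : Inst} (σ : Schedule I)

/-- The times at which job `j` is processed. -/
def X (j : Fin I.n) : Set ℝ := {t | 0 ≤ t ∧ σ.J t = some j ∧ 0 < σ.S t}

/-- Feasibility: every job is processed only after its release, is processed completely, and is
completed at some finite time. -/
structure Feasible : Prop where
  measurable : ∀ (o : Option (Fin I.n)) (i : Fin (I.k + 1)),
    MeasurableSet {t | 0 ≤ t ∧ σ.J t = o ∧ σ.S t = i}
  released : ∀ (j : Fin I.n) (t : ℝ), 0 ≤ t → σ.J t = some j → I.r j ≤ t
  processed : ∀ j : Fin I.n, ∫ t in σ.X j, I.s (σ.S t) = 1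
  completed : ∀ j : Fin I.n, BddAbove (σ.X j)

/-- Processing time of `j`. -/
def x (j : Fin I.n) : ℝ := (volume (σ.X j)).toReal

/-- Average speed of `j` (which has volume one). -/
def speed (j : Fin I.n) : ℝ := 1 / σ.x j

/-- Completion time of `j`. -/
def C (j : Fin I.n) : ℝ := sSup (σ.X j)

/-- Total flow time. -/
def flow : ℝ := ∑ j, (σ.C j - I.r j)

/-- Total energy consumption. -/
def energy : ENNReal := ∫⁻ t in Set.Ici (0 : ℝ), ENNReal.ofReal (I.P (σ.S t))

/-- Flow plus energy. -/
def objective : EReal := (σ.flow : EReal) + (σ.energy : EReal)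

/-- `σ` is an optimal schedule, among all (possibly preemptive) feasible schedules. -/
def Optimal : Prop :=
  σ.Feasible ∧ ∀ σ' : Schedule I, σ'.Feasible → σ.objective ≤ σ'.objective

/-- `j` affects `j'`: the transitive closure of `C j ≤ C j'` and `r j' < C j`. -/
def Affects : Fin I.n → Fin I.n → Prop :=
  Relation.TransGen fun j j' => σ.C j ≤ σ.C j' ∧ I.r j' < σ.C j

/-- The affection `κ_j(σ)`; all weights are one. -/
def kappa (j : Fin I.n) : ℕ := Set.ncard {j' | σ.Affects j j'}

end Schedule

namespace Inst

variable (I : Inst)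

/-- `Δ_i`, with `Δ_0 = -∞` and `Δ_k = ∞`. -/
def Delta (i : Fin (I.k + 1)) : EReal :=
  if i = 0 then ⊥
  else if h : i.val < I.k then
    (((I.P ⟨i + 1, by omega⟩ * I.s i - I.P i * I.s ⟨i + 1, by omega⟩) /
      (I.s ⟨i + 1, by omega⟩ - I.s i) : ℝ) : EReal)
  else ⊤

/-- The largest `i` with `s i ≤ u`. -/
def floorLevel (u : ℝ) : Fin (I.k + 1) :=
  (Finset.univ.filter fun i => I.s i ≤ u).sup id

/-- The smallest `i` with `u ≤ s i`. -/
def ceilLevel (u : ℝ) : Fin (I.k + 1) :=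
  (Finset.univ.filter fun i => u ≤ I.s i).inf id

/-- The time for which a job of average speed `u` runs at the slower one of the two given speeds
next to `u`; it is `0` if `u` itself is a given speed. -/
def slowTime (u : ℝ) : ℝ :=
  (I.s (I.ceilLevel u) - u) / (u * (I.s (I.ceilLevel u) - I.s (I.floorLevel u)))

/-- The time at which the first `m` jobs are completed, if they are processed in order of release
without unnecessary idling, job `j` at average speed `v j`. -/
def done (v : Fin I.n → ℝ) : ℕ → ℝ
  | 0 => 0
  | m + 1 => if h : m < I.n then max (I.r ⟨m, h⟩) (done v m) + 1 / v ⟨m, h⟩ else done v m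

/-- The time at which job `j` is started. -/
def start (v : Fin I.n → ℝ) (j : Fin I.n) : ℝ := max (I.r j) (I.done v j)

open Classical in
/-- The job processed at time `t` under the speeds `v`. -/
def fifoJob (v : Fin I.n → ℝ) (t : ℝ) : Option (Fin I.n) :=
  if h : ∃ j : Fin I.n, I.start v j ≤ t ∧ t < I.done v (j + 1) then some h.choose else none

/-- The schedule that processes the jobs in order of release, without unnecessary idling, and
job `j` at average speed `v j`, using only the given speeds next to `v j`. -/
def fifo (v : Fin I.n → ℝ) : Schedule I where
  J := I.fifoJob v
  S t := match I.fifoJob v t with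
    | none => 0
    | some j => if t < I.start v j + I.slowTime (v j) then I.floorLevel (v j)
        else I.ceilLevel (v j)

end Inst

/-- The shrinking energy `Δ_j(σ)`, that is `Δ_i` if `s i ≤ speed j < s (i+1)`, and `∞` at the
highest speed. -/
def Schedule.shrinkingEnergy {I : Inst} (σ : Schedule I) (j : Fin I.n) : EReal :=
  I.Delta (I.floorLevel (σ.speed j))

/-- `κ_j(σ) - Δ_j(σ)`. -/
def Schedule.gain {I : Inst} (σ : Schedule I) (j : Fin I.n) : EReal :=
  ((σ.kappa j : ℝ) : EReal) - σ.shrinkingEnergy j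

/-! ### The algorithm -/

/-- Whether jobs are sped up only while `κ - Δ > 0`, or while `κ - Δ ≥ 0`. -/
inductive Rule
  | positive
  | nonneg

/-- The gains at which the algorithm goes on. -/
def Rule.Active : Rule → EReal → Prop
  | .positive, g => 0 < g
  | .nonneg, g => 0 ≤ g

namespace Inst

variable (I : Inst) (ρ : Rule)

/-- All jobs at the lowest positive speed. -/
def lowest : Fin I.n → ℝ := fun _ => I.s ⟨1, Nat.succ_lt_succ I.k_pos⟩

/-- Job `j` may be sped up: its gain is active and maximum among all jobs. -/
def CanSpeedUp (v : Fin I.n → ℝ) (j : Fin I.n) : Prop :=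
  ρ.Active ((I.fifo v).gain j) ∧ ∀ j', (I.fifo v).gain j' ≤ (I.fifo v).gain j

/-- One iteration of the loop: a job `j` of maximum, active gain is sped up until, for the first
time, its gain fails to be active or to be maximum. Ties are broken arbitrarily. -/
def Iteration (v v' : Fin I.n → ℝ) : Prop :=
  ∃ (j : Fin I.n) (u : ℝ), v j < u ∧ v' = Function.update v j u ∧
    (∀ w, v j ≤ w → w < u → I.CanSpeedUp ρ (Function.update v j w) j) ∧
    ¬ I.CanSpeedUp ρ (Function.update v j u) j

/-- The loop ends: no job has an active gain. -/
def Halted (v : Fin I.n → ℝ) : Prop := ∀ j, ¬ ρ.Active ((I.fifo v).gain j)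

/-- `Run m v`: the algorithm can have reached the speeds `v` after `m` iterations. -/
inductive Run : ℕ → (Fin I.n → ℝ) → Prop
  | init : Run 0 I.lowest
  | step {m : ℕ} {v v' : Fin I.n → ℝ} : Run m v → I.Iteration ρ v v' → Run (m + 1) v'

end Inst

/-! ### The machine model

A random access machine with counters `idx x` and arrays of numbers `num a`, programmed in a
structured language. Counters serve as addresses; a counter can only be set to zero, copied, or
changed by one, so that no counter exceeds the largest initial one plus the number of steps. -/

structure Store where
  idx : ℕ → ℕ
  num : ℕ → ℕ → ℝ

/-- The entry of the array `a` at the address held by the counter `x`. -/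
def Store.get (m : Store) (a x : ℕ) : ℝ := m.num a (m.idx x)

def Store.setIdx (m : Store) (x i : ℕ) : Store := { m with idx := Function.update m.idx x i }

def Store.set (m : Store) (a x : ℕ) (z : ℝ) : Store :=
  { m with num := Function.update m.num a (Function.update (m.num a) (m.idx x) z) }

inductive Arith
  | add
  | sub
  | mul
  | div

/-- The operations; division by zero gives zero. -/
def Arith.eval : Arith → ℝ → ℝ → ℝ
  | .add, y, z => y + z
  | .sub, y, z => y - z
  | .mul, y, z => y * z
  | .div, y, z => y / z

inductive Test
  | idxLt (x y : ℕ)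
  | numLt (a x b y : ℕ)

def Test.Holds : Test → Store → Prop
  | .idxLt x y, m => m.idx x < m.idx y
  | .numLt a x b y, m => m.get a x < m.get b y

inductive Cmd
  | skip
  | zero (x : ℕ)
  | copy (x y : ℕ)
  | inc (x : ℕ)
  | dec (x : ℕ)
  | const (a x c : ℕ)
  | arith (o : Arith) (a x b y c z : ℕ)
  | seq (p q : Cmd)
  | cond (t : Test) (p q : Cmd)
  | loop (t : Test) (p : Cmd)

/-- The cost of a test, where handling a number `z` costs `ω z` on top of the unit cost. -/
def Test.cost (ω : ℝ → ℕ) : Test → Store → ℕ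
  | .idxLt _ _, _ => 1
  | .numLt a x b y, m => 1 + ω (m.get a x) + ω (m.get b y)

/-- `Exec ω p m m' t`: the program `p`, started on `m`, halts with the store `m'` after a total
cost of `t`. -/
inductive Exec (ω : ℝ → ℕ) : Cmd → Store → Store → ℕ → Prop
  | skip (m : Store) : Exec ω .skip m m 1
  | zero (m : Store) (x : ℕ) : Exec ω (.zero x) m (m.setIdx x 0) 1
  | copy (m : Store) (x y : ℕ) : Exec ω (.copy x y) m (m.setIdx x (m.idx y)) 1
  | inc (m : Store) (x : ℕ) : Exec ω (.inc x) m (m.setIdx x (m.idx x + 1)) 1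
  | dec (m : Store) (x : ℕ) : Exec ω (.dec x) m (m.setIdx x (m.idx x - 1)) 1
  | const (m : Store) (a x c : ℕ) : Exec ω (.const a x c) m (m.set a x c) (1 + ω c)
  | arith (m : Store) (o : Arith) (a x b y c z : ℕ) :
      Exec ω (.arith o a x b y c z) m (m.set a x (o.eval (m.get b y) (m.get c z)))
        (1 + ω (m.get b y) + ω (m.get c z) + ω (o.eval (m.get b y) (m.get c z)))
  | seq {p q : Cmd} {m m' m'' : Store} {t t' : ℕ} :
      Exec ω p m m' t → Exec ω q m' m'' t' → Exec ω (.seq p q) m m'' (t + t')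
  | cond_true {b : Test} {p q : Cmd} {m m' : Store} {t : ℕ} :
      b.Holds m → Exec ω p m m' t → Exec ω (.cond b p q) m m' (b.cost ω m + t)
  | cond_false {b : Test} {p q : Cmd} {m m' : Store} {t : ℕ} :
      ¬ b.Holds m → Exec ω q m m' t → Exec ω (.cond b p q) m m' (b.cost ω m + t)
  | loop_true {b : Test} {p : Cmd} {m m' m'' : Store} {t t' : ℕ} :
      b.Holds m → Exec ω p m m' t → Exec ω (.loop b p) m' m'' t' →
        Exec ω (.loop b p) m m'' (b.cost ω m + t + t')
  | loop_false {b : Test} {p : Cmd} {m : Store} :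
      ¬ b.Holds m → Exec ω (.loop b p) m m (b.cost ω m)

/-- Unit costs: the number of executed instructions and tests. -/
def unitCost : ℝ → ℕ := fun _ => 0

open Classical in
/-- The length of the binary representation of a rational number (as a reduced fraction).
It is used for rational inputs only, on which all numbers that occur are rational. -/
def bitSize (z : ℝ) : ℕ :=
  if h : ∃ q : ℚ, (q : ℝ) = z then 1 + Nat.size h.choose.num.natAbs + Nat.size h.choose.den else 0

namespace Inst

variable (I : Inst)

/-- The store that holds the instance: `n` and `k` in the first two counters, and the release
times, speeds and power consumptions in the first three arrays. -/
def input : Store where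
  idx x := if x = 0 then I.n else if x = 1 then I.k else 0
  num a i :=
    if a = 0 then (if h : i < I.n then I.r ⟨i, h⟩ else 0)
    else if a = 1 then (if h : i < I.k + 1 then I.s ⟨i, h⟩ else 0)
    else if a = 2 then (if h : i < I.k + 1 then I.P ⟨i, h⟩ else 0)
    else 0

/-- All numbers of the instance are rational. -/
def IsRational : Prop :=
  (∀ j, ∃ q : ℚ, (q : ℝ) = I.r j) ∧ (∀ i, ∃ q : ℚ, (q : ℝ) = I.s i) ∧
    ∀ i, ∃ q : ℚ, (q : ℝ) = I.P i

/-- The length of the binary encoding of a rational instance. -/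
def size : ℕ :=
  I.n + I.k + ∑ j, bitSize (I.r j) + ∑ i, bitSize (I.s i) + ∑ i, bitSize (I.P i)

end Inst

end SpeedScaling

end

/-! Optimality is a duality argument in which job `j` pays a price `c j` per unit of its processing
time. Minus `Δ_i` is the intercept at speed 0 of the chord of the power function between the levels
`i` and `i + 1`, so convexity makes the `Δ_i` increase (`del_succ`). At time price `c`, a level is
cheapest for a unit of volume if `c` lies between the `Δ` below it and its own (`price_fl_le`). The
prices must also fit the completion times: `c j = 1 + c (j + 1)` if job `j + 1` is released before
job `j` is completed, `c j = 1` if it is released later or does not exist, and `1 ≤ c j ≤ 1 + c (j +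
1)` if the two times coincide. `Certifies` collects these conditions. An arbitrary preemptive
schedule is compared with jobs in order by cutting its total volume into unit pieces
(`exists_fifo`), and a telescoping inequality (`Certifies.sum_le`) shows that it is not cheaper.

The algorithm produces such prices. In a chain of linked jobs with common end `e`, the affection of
`j` is `e - j`, so comparing gains means comparing `Δ + j`. Just before a raised job reached its
final speed, its gain was nonnegative and maximum. Hence `Δ` just below its speed, plus its index,
is at most `Δ` plus index of every tied job, and at most the end of its weak chain. This is the
invariant `Balanced`, preserved by `Balanced.update`. On halting all gains are at most 0, and the
smallest of these upper bounds, minus the index, is a valid price (`Balanced.exists_certifies`).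

Gains change only when a job reaches a level or a link is lost. Such events are never undone; there
are at most `n k + n` of them, and `n` are present at the start. So there are at most `n k`
iterations.

The program moves from event to event, several of which may belong to one iteration (`Midway`). Each
new processing time is an integer combination of release times and inverse given speeds. These have
a common denominator for rational inputs, and all times are bounded, so their length does not depend
on the number of iterations. `Tri` gives one result store for all cost functions, so that one
correctness proof serves both unit and bit costs. -/

noncomputable section

namespace SpeedScaling

namespace Inst

variable (I : Inst)

/-! ### Levels -/

/-- The `i`-th speed, with a dummy value beyond the last one. -/
def sp (i : ℕ) : ℝ := if h : i < I.k + 1 then I.s ⟨i, h⟩ else 0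

/-- The `i`-th power consumption, with a dummy value beyond the last one. -/
def pw (i : ℕ) : ℝ := if h : i < I.k + 1 then I.P ⟨i, h⟩ else 0

/-- The `i`-th release time, with a dummy value beyond the last one. -/
def rel (i : ℕ) : ℝ := if h : i < I.n then I.r ⟨i, h⟩ else 0

/-- `Δ_i` as a real number; at the highest speed, a number that exceeds every affection. -/
def del (i : ℕ) : ℝ :=
  if i < I.k then (I.pw (i + 1) * I.sp i - I.pw i * I.sp (i + 1)) / (I.sp (i + 1) - I.sp i)
  else I.n + 1

variable {I}

lemma sp_val (i : Fin (I.k + 1)) : I.sp i = I.s i := by simp [sp, i.isLt, -Fin.is_lt, -Order.lt_add_one_iff]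

lemma pw_val (i : Fin (I.k + 1)) : I.pw i = I.P i := by simp [pw, i.isLt, -Fin.is_lt, -Order.lt_add_one_iff]

lemma rel_val (i : Fin I.n) : I.rel i = I.r i := by simp [rel]

lemma sp_zero : I.sp 0 = 0 := by
  have := I.s_zero
  simpa [sp] using this

lemma sp_lt {i j : ℕ} (h : i < j) (hj : j ≤ I.k) : I.sp i < I.sp j := by
  have hi : i < I.k + 1 := by omega
  have hj' : j < I.k + 1 := by omega
  simp only [sp, hi, hj', dif_pos]
  exact I.s_strictMono h

lemma sp_le {i j : ℕ} (h : i ≤ j) (hj : j ≤ I.k) : I.sp i ≤ I.sp j := by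
  rcases h.eq_or_lt with rfl | h
  · exact le_rfl
  · exact (sp_lt h hj).le

lemma sp_pos {i : ℕ} (h : 0 < i) (hi : i ≤ I.k) : 0 < I.sp i := by
  have := sp_lt h hi
  rwa [sp_zero] at this

lemma pw_nonneg (i : Fin (I.k + 1)) : 0 ≤ I.P i := by
  rw [← I.P_zero]
  exact I.P_strictMono.monotone (Fin.zero_le i)

lemma rel_nonneg (i : ℕ) : 0 ≤ I.rel i := by
  unfold rel
  split_ifs
  · exact I.r_nonneg _
  · exact le_rfl

lemma rel_mono {i j : ℕ} (h : i ≤ j) (hj : j < I.n) : I.rel i ≤ I.rel j := by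
  have hi : i < I.n := by omega
  simp only [rel, hi, hj, dif_pos]
  exact I.r_mono h

lemma del_top {i : ℕ} (h : I.k ≤ i) : I.del i = I.n + 1 := by simp [del, not_lt.2 h]

lemma Delta_eq {i : Fin (I.k + 1)} (h0 : 0 < i) (h : i.val < I.k) :
    I.Delta i = ((I.del i : ℝ) : EReal) := by
  have h1 : i.val + 1 < I.k + 1 := by omega
  simp [Delta, del, h, h.le, h0.ne', sp, pw]

lemma Delta_top {i : Fin (I.k + 1)} (h : i.val = I.k) : I.Delta i = ⊤ := by
  have : i ≠ 0 := by
    rintro rfl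
    have := I.k_pos
    simp at h
    omega
  simp [Delta, this, h]

/-- `del i` is minus the value at speed 0 of the line through the points (speed, power) of the
levels `i` and `i + 1`. That no speed is superfluous puts these points in convex position, so the
intercepts fall. The range stops below `k` because the substitute value `n + 1` at `k` need not
exceed the others. -/
lemma del_succ {i : ℕ} (h0 : 0 < i) (h : i + 1 < I.k) : I.del i ≤ I.del (i + 1) := by
  have hs1 : 0 < I.sp i := sp_pos h0 (by omega)
  have hs12 : I.sp i < I.sp (i + 1) := sp_lt (by omega) (by omega)
  have hs23 : I.sp (i + 1) < I.sp (i + 1 + 1) := sp_lt (by omega) (by omega)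
  have key := I.not_superfluous ⟨i, by omega⟩ ⟨i + 1, by omega⟩ ⟨i + 1 + 1, by omega⟩
    (Fin.mk_lt_mk.2 h0) (Fin.mk_lt_mk.2 (by omega)) (Fin.mk_lt_mk.2 (by omega))
  rw [← sp_val, ← sp_val, ← sp_val, ← pw_val, ← pw_val, ← pw_val] at key
  simp only at key
  have hi : i < I.k := by omega
  simp only [del, hi, h, if_true]
  generalize I.sp i = a at *
  generalize I.sp (i + 1) = b at *
  generalize I.sp (i + 1 + 1) = c at *
  generalize I.pw i = p at *
  generalize I.pw (i + 1) = q at *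
  generalize I.pw (i + 1 + 1) = t at *
  have hb : 0 < b := hs1.trans hs12
  have hc : 0 < c := hb.trans hs23
  have hca : 0 < c - a := by linarith
  -- This weight solves `1 / b = l / a + (1 - l) / c`: it is the share of the volume to be processed
  -- at the slower speed.
  have hl : a * (c - b) / (b * (c - a)) < 1 := by
    rw [div_lt_one (by positivity)]
    nlinarith
  have hl0 : 0 < a * (c - b) / (b * (c - a)) := by
    have : 0 < c - b := by linarith
    positivity
  have e1 : 1 - a * (c - b) / (b * (c - a)) = c * (b - a) / (b * (c - a)) := by
    field_simp
    ring
  have := key _ hl0 hl (by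
    rw [e1]
    field_simp
    ring)
  rw [e1] at this
  have h3 : q * (c - a) < (c - b) * p + (b - a) * t := by
    have h4 := mul_lt_mul_of_pos_right this (show 0 < b * (c - a) by positivity)
    have h5 : q / b * (b * (c - a)) = q * (c - a) := by field_simp
    have h6 : (a * (c - b) / (b * (c - a)) * (p / a) + c * (b - a) / (b * (c - a)) * (t / c)) *
        (b * (c - a)) = (c - b) * p + (b - a) * t := by field_simp
    rwa [h5, h6] at h4
  rw [div_le_div_iff₀ (by linarith) (by linarith)]
  nlinarith

lemma del_mono {i j : ℕ} (h0 : 0 < i) (h : i ≤ j) (hj : j < I.k) : I.del i ≤ I.del j := by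
  induction j, h using Nat.le_induction with
  | base => exact le_rfl
  | succ j hij ih => exact (ih (by omega)).trans (del_succ (by omega) hj)

/-- The largest level below `u`. -/
def lowLevel (I : Inst) (u : ℝ) : Fin (I.k + 1) :=
  (Finset.univ.filter fun i => I.s i < u).sup id

lemma le_floorLevel_iff {u : ℝ} (hu : 0 ≤ u) (i : Fin (I.k + 1)) :
    i ≤ I.floorLevel u ↔ I.s i ≤ u := by
  constructor
  · intro h
    obtain ⟨a, ha, e⟩ := Finset.exists_mem_eq_sup (Finset.univ.filter fun i => I.s i ≤ u)
      ⟨0, by simp [I.s_zero, hu]⟩ id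
    rw [floorLevel, e] at h
    exact (I.s_strictMono.monotone h).trans (Finset.mem_filter.1 ha).2
  · intro h
    exact Finset.le_sup (f := id) (Finset.mem_filter.2 ⟨Finset.mem_univ _, h⟩)

lemma le_lowLevel_iff {u : ℝ} (hu : 0 < u) (i : Fin (I.k + 1)) :
    i ≤ I.lowLevel u ↔ I.s i < u := by
  constructor
  · intro h
    obtain ⟨a, ha, e⟩ := Finset.exists_mem_eq_sup (Finset.univ.filter fun i => I.s i < u)
      ⟨0, by simp [I.s_zero, hu]⟩ id
    rw [lowLevel, e] at h
    exact (I.s_strictMono.monotone h).trans_lt (Finset.mem_filter.1 ha).2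
  · intro h
    exact Finset.le_sup (f := id) (Finset.mem_filter.2 ⟨Finset.mem_univ _, h⟩)

lemma ceilLevel_le_iff {u : ℝ} (hu : u ≤ I.sp I.k) (i : Fin (I.k + 1)) :
    I.ceilLevel u ≤ i ↔ u ≤ I.s i := by
  constructor
  · intro h
    obtain ⟨a, ha, e⟩ := Finset.exists_mem_eq_inf (Finset.univ.filter fun i => u ≤ I.s i)
      ⟨Fin.last I.k, by simpa [← sp_val] using hu⟩ id
    rw [ceilLevel, e] at h
    exact (Finset.mem_filter.1 ha).2.trans (I.s_strictMono.monotone h)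
  · intro h
    exact Finset.inf_le (f := id) (Finset.mem_filter.2 ⟨Finset.mem_univ _, h⟩)

/-- The index of the largest given speed that is at most `u`. -/
def fl (I : Inst) (u : ℝ) : ℕ := (I.floorLevel u).val

/-- The index of the largest given speed below `u`. -/
def low (I : Inst) (u : ℝ) : ℕ := (I.lowLevel u).val

lemma fl_le (u : ℝ) : I.fl u ≤ I.k := by
  have := (I.floorLevel u).isLt
  unfold fl
  omega

lemma low_le (u : ℝ) : I.low u ≤ I.k := by
  have := (I.lowLevel u).isLt
  unfold low
  omega

lemma le_fl_iff {u : ℝ} (hu : 0 ≤ u) {i : ℕ} (hi : i ≤ I.k) : i ≤ I.fl u ↔ I.sp i ≤ u := by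
  have := le_floorLevel_iff hu (⟨i, by omega⟩ : Fin (I.k + 1))
  rw [← sp_val] at this
  exact this

lemma le_low_iff {u : ℝ} (hu : 0 < u) {i : ℕ} (hi : i ≤ I.k) : i ≤ I.low u ↔ I.sp i < u := by
  have := le_lowLevel_iff hu (⟨i, by omega⟩ : Fin (I.k + 1))
  rw [← sp_val] at this
  exact this

lemma fl_eq {u : ℝ} {i : ℕ} (hi : i < I.k) (h : I.sp i ≤ u) (h' : u < I.sp (i + 1)) :
    I.fl u = i := by
  have hu : 0 ≤ u := le_trans (by simpa [sp_zero] using sp_le (I := I) (Nat.zero_le i) hi.le) h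
  have h1 := (le_fl_iff hu hi.le).2 h
  have h2 : ¬ i + 1 ≤ I.fl u := fun hc => absurd ((le_fl_iff hu (by omega)).1 hc) (not_le.2 h')
  omega

lemma sp_fl_le {u : ℝ} (hu : 0 ≤ u) : I.sp (I.fl u) ≤ u := (le_fl_iff hu (fl_le u)).1 le_rfl

lemma sp_low_lt {u : ℝ} (hu : 0 < u) : I.sp (I.low u) < u := (le_low_iff hu (low_le u)).1 le_rfl

lemma lt_sp_fl_succ {u : ℝ} (hu : 0 ≤ u) (h : I.fl u < I.k) : u < I.sp (I.fl u + 1) := by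
  by_contra hc
  have := (le_fl_iff hu h).2 (not_lt.1 hc)
  omega

lemma fl_mono {u w : ℝ} (hu : 0 ≤ u) (h : u ≤ w) : I.fl u ≤ I.fl w :=
  (le_fl_iff (hu.trans h) (fl_le u)).2 ((sp_fl_le hu).trans h)

lemma low_le_fl {u : ℝ} (hu : 0 < u) : I.low u ≤ I.fl u :=
  (le_fl_iff hu.le (low_le u)).2 (sp_low_lt hu).le

lemma fl_le_low {u w : ℝ} (hu : 0 ≤ u) (h : u < w) : I.fl u ≤ I.low w :=
  (le_low_iff (hu.trans_lt h) (fl_le u)).2 ((sp_fl_le hu).trans_lt h)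

lemma low_lt {u : ℝ} (hu : 0 < u) (h : u ≤ I.sp I.k) : I.low u < I.k := by
  refine lt_of_le_of_ne (low_le u) fun hc => ?_
  have := sp_low_lt (I := I) hu
  rw [hc] at this
  linarith

lemma fl_eq_top_iff {u : ℝ} (hu : 0 ≤ u) : I.fl u = I.k ↔ I.sp I.k ≤ u := by
  rw [← le_fl_iff hu le_rfl]
  have := fl_le (I := I) u
  omega

lemma fl_pos {u : ℝ} (h : I.sp 1 ≤ u) : 0 < I.fl u :=
  (le_fl_iff ((sp_pos one_pos I.k_pos).le.trans h) I.k_pos).2 h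

lemma low_pos {u : ℝ} (h : I.sp 1 < u) : 0 < I.low u :=
  (le_low_iff ((sp_pos one_pos I.k_pos).trans h) I.k_pos).2 h

/-- While a speed approaches `u` from below, its level is the one strictly below `u`, also if `u` is
a given speed. So `low u` governs the gains just before a raise to `u` ends. -/
lemma eventually_fl_eq_low {u : ℝ} (hu : 0 < u) : ∀ᶠ w in nhdsWithin u (Set.Iio u),
    I.fl w = I.low u := by
  have h1 : ∀ᶠ w in nhdsWithin u (Set.Iio u), I.sp (I.low u) < w :=
    Filter.Eventually.filter_mono nhdsWithin_le_nhds (lt_mem_nhds (sp_low_lt hu))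
  have h2 : ∀ᶠ w in nhdsWithin u (Set.Iio u), 0 < w :=
    Filter.Eventually.filter_mono nhdsWithin_le_nhds (lt_mem_nhds hu)
  filter_upwards [h1, h2, self_mem_nhdsWithin] with w hw hw0 hwu
  exact le_antisymm (fl_le_low hw0.le hwu) ((le_fl_iff hw0.le (low_le u)).2 hw.le)

lemma eventually_fl_eq {u : ℝ} (hu : 0 ≤ u) : ∀ᶠ w in nhdsWithin u (Set.Ici u),
    I.fl w = I.fl u := by
  by_cases h : I.fl u < I.k
  · have h1 : ∀ᶠ w in nhdsWithin u (Set.Ici u), w < I.sp (I.fl u + 1) :=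
      Filter.Eventually.filter_mono nhdsWithin_le_nhds (gt_mem_nhds (lt_sp_fl_succ hu h))
    filter_upwards [h1, self_mem_nhdsWithin] with w hw hwu
    exact fl_eq h ((sp_fl_le hu).trans hwu) hw
  · filter_upwards [self_mem_nhdsWithin] with w hwu
    have h1 := fl_mono (I := I) hu (Set.mem_Ici.1 hwu)
    have h2 := fl_le (I := I) w
    omega

/-- The price per unit of volume at the level `i`, if time costs `c`. -/
lemma price_succ_le {c : ℝ} {i : ℕ} (h0 : 0 < i) (h : i < I.k) (hc : I.del i ≤ c) :
    (I.pw (i + 1) + c) / I.sp (i + 1) ≤ (I.pw i + c) / I.sp i := by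
  have h1 := sp_pos h0 h.le
  have h2 : I.sp i < I.sp (i + 1) := sp_lt (by omega) h
  simp only [del, h, if_true] at hc
  rw [div_le_iff₀ (by linarith)] at hc
  rw [div_le_div_iff₀ (h1.trans h2) h1]
  nlinarith

lemma price_le_succ {c : ℝ} {i : ℕ} (h0 : 0 < i) (h : i < I.k) (hc : c ≤ I.del i) :
    (I.pw i + c) / I.sp i ≤ (I.pw (i + 1) + c) / I.sp (i + 1) := by
  have h1 := sp_pos h0 h.le
  have h2 : I.sp i < I.sp (i + 1) := sp_lt (by omega) h
  simp only [del, h, if_true] at hc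
  rw [le_div_iff₀ (by linarith)] at hc
  rw [div_le_div_iff₀ h1 (h1.trans h2)]
  nlinarith

/-- If `c` lies between the shrinking energies to the left and to the right of `u`, then the level
below `u` has the lowest price. -/
lemma price_fl_le {u c : ℝ} (hu1 : I.sp 1 ≤ u) (huk : u ≤ I.sp I.k)
    (hlow : I.sp 1 < u → I.del (I.low u) ≤ c) (hfl : I.fl u < I.k → c ≤ I.del (I.fl u))
    {i : ℕ} (h0 : 0 < i) (hi : i ≤ I.k) :
    (I.pw (I.fl u) + c) / I.sp (I.fl u) ≤ (I.pw i + c) / I.sp i := by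
  have hs1 := sp_pos (I := I) one_pos I.k_pos
  have hu0 : 0 < u := hs1.trans_le hu1
  -- By monotonicity of `del`, the price rises with the level above `fl u` and falls up to it.
  rcases le_total (I.fl u) i with h | h
  · induction i, h using Nat.le_induction with
    | base => exact le_rfl
    | succ i hij ih =>
      have hp := fl_pos hu1
      exact (ih (by omega) (by omega)).trans (price_le_succ (by omega) (by omega)
        ((hfl (by omega)).trans (del_mono hp hij (by omega))))
  · have key : ∀ m, i ≤ m → m ≤ I.fl u →
        (I.pw m + c) / I.sp m ≤ (I.pw i + c) / I.sp i := by
      intro m hm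
      induction m, hm using Nat.le_induction with
      | base => exact fun _ => le_rfl
      | succ m him ih =>
        intro hm
        have hk := fl_le (I := I) u
        have h1 : I.sp 1 < u :=
          (sp_lt (by omega) (by omega : m + 1 ≤ I.k)).trans_le ((le_fl_iff hu0.le (by omega)).1 hm)
        have h2 : m ≤ I.low u := (le_low_iff hu0 (by omega)).2
          ((sp_lt (Nat.lt_succ_self m) (by omega)).trans_le ((le_fl_iff hu0.le (by omega)).1 hm))
        have h3 : I.low u < I.k := low_lt hu0 huk
        exact (price_succ_le (by omega) (by omega)
          ((del_mono (by omega) h2 h3).trans (hlow h1))).trans (ih (by omega))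
    exact key _ h le_rfl

end Inst

end SpeedScaling

end

/-! ### Chains of consecutive indices, links, and completion times under a change of one speed -/

noncomputable section

namespace SpeedScaling

/-- The first index after `j` at which `p` fails. -/
def next (p : ℕ → Prop) (j : ℕ) : ℕ := sInf {e | j < e ∧ ¬ p e}

section next

variable {p : ℕ → Prop} {j N : ℕ}

lemma next_mem (hN : j < N) (h : ¬ p N) : j < next p j ∧ ¬ p (next p j) :=
  Nat.sInf_mem (s := {e | j < e ∧ ¬ p e}) ⟨N, hN, h⟩

lemma next_le (hN : j < N) (h : ¬ p N) : next p j ≤ N :=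
  Nat.sInf_le (s := {e | j < e ∧ ¬ p e}) ⟨hN, h⟩

lemma of_lt_next {i : ℕ} (hj : j < i) (hi : i < next p j) : p i := by
  by_contra h
  exact absurd (next_le hj h) (not_le.2 hi)

/-- No failure lies between `j` and `j'`, so both searches run over the same set. This is why tied
jobs share the end of their chain. -/
lemma next_congr {j' : ℕ} (hj : j ≤ j') (h : ∀ i, j < i → i ≤ j' → p i) :
    next p j = next p j' := by
  unfold next
  congr 1
  ext e
  constructor
  · rintro ⟨h1, h2⟩
    exact ⟨not_le.1 fun hc => h2 (h e h1 hc), h2⟩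
  · rintro ⟨h1, h2⟩
    exact ⟨by omega, h2⟩

end next

namespace Inst

variable {I : Inst} {v : Fin I.n → ℝ} {j : Fin I.n} {u : ℝ}

/-! ### Completion times as functions of the speeds -/

lemma done_succ (v : Fin I.n → ℝ) (j : Fin I.n) :
    I.done v (j + 1) = max (I.r j) (I.done v j) + 1 / v j := by
  simp [done, j.isLt]

lemma done_update_of_le {m : ℕ} (hm : m ≤ j) :
    I.done (Function.update v j u) m = I.done v m := by
  induction m with
  | zero => rfl
  | succ m ih =>
    have h : m < I.n := by have := j.isLt; omega
    have hne : (⟨m, h⟩ : Fin I.n) ≠ j := by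
      rintro rfl
      simp at hm
    have h1 := done_succ (Function.update v j u) ⟨m, h⟩
    have h2 := done_succ v ⟨m, h⟩
    simp only at h1 h2
    rw [h1, h2, ih (by omega), Function.update_of_ne hne]

lemma done_anti {v v' : Fin I.n → ℝ} (h0 : ∀ i, 0 < v i) (h : ∀ i, v i ≤ v' i) (m : ℕ) :
    I.done v' m ≤ I.done v m := by
  induction m with
  | zero => exact le_rfl
  | succ m ih =>
    unfold done
    split_ifs with hm
    · exact add_le_add (max_le_max le_rfl ih) (one_div_le_one_div_of_le (h0 _) (h _))
    · exact ih

lemma update_le_of {v : Fin I.n → ℝ} (hu : v j ≤ u) (i : Fin I.n) :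
    v i ≤ Function.update v j u i := by
  by_cases h : i = j
  · subst h
    simpa using hu
  · simp [h]

lemma done_update_le (h0 : ∀ i, 0 < v i) (hu : v j ≤ u) (m : ℕ) :
    I.done (Function.update v j u) m ≤ I.done v m :=
  done_anti h0 (update_le_of hu) m

lemma continuousAt_done_update (v : Fin I.n → ℝ) (j : Fin I.n) (hu : u ≠ 0) (m : ℕ) :
    ContinuousAt (fun w => I.done (Function.update v j w) m) u := by
  induction m with
  | zero => exact continuousAt_const
  | succ m ih =>
    simp only [done]
    split_ifs with hm
    · refine (continuousAt_const.max ih).add ?_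
      by_cases h : (⟨m, hm⟩ : Fin I.n) = j
      · subst h
        simp only [Function.update_self]
        exact continuousAt_const.div continuousAt_id hu
      · simp only [Function.update_of_ne h]
        exact continuousAt_const
    · exact ih

/-- Job `i` is released before the preceding jobs are completed. -/
def Link (I : Inst) (v : Fin I.n → ℝ) (i : ℕ) : Prop := i < I.n ∧ I.rel i < I.done v i

/-- Job `i` is released not later than the preceding jobs are completed. -/
def WLink (I : Inst) (v : Fin I.n → ℝ) (i : ℕ) : Prop := i < I.n ∧ I.rel i ≤ I.done v i

lemma Link.wlink {i : ℕ} (h : I.Link v i) : I.WLink v i := ⟨h.1, h.2.le⟩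

lemma not_link_n : ¬ I.Link v I.n := fun h => lt_irrefl _ h.1

lemma not_wlink_n : ¬ I.WLink v I.n := fun h => lt_irrefl _ h.1

/-- An unlinked job starts exactly at its release, before and after the raise. It shields all later
jobs from the change. -/
lemma done_update_of_not_link (h0 : ∀ i, 0 < v i) (hu : v j ≤ u) {i m : ℕ} (hji : j < i)
    (hi : i < I.n) (hl : ¬ I.Link v i) (hm : i < m) :
    I.done (Function.update v j u) m = I.done v m := by
  have hd : I.done v i ≤ I.rel i := not_lt.1 fun hc => hl ⟨hi, hc⟩
  have hd' := (done_update_le h0 hu i).trans hd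
  induction m, hm using Nat.le_induction with
  | base =>
    have h1 := done_succ (Function.update v j u) ⟨i, hi⟩
    have h2 := done_succ v ⟨i, hi⟩
    have hne : (⟨i, hi⟩ : Fin I.n) ≠ j := by
      rintro rfl
      simp at hji
    rw [← rel_val] at h1 h2
    simp only at h1 h2
    rw [Nat.succ_eq_add_one, h1, h2, max_eq_left hd, max_eq_left hd', Function.update_of_ne hne]
  | succ m hm ih =>
    by_cases hmn : m < I.n
    · have h1 := done_succ (Function.update v j u) ⟨m, hmn⟩
      have h2 := done_succ v ⟨m, hmn⟩
      have hne : (⟨m, hmn⟩ : Fin I.n) ≠ j := by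
        rintro rfl
        simp at hji
        omega
      simp only at h1 h2
      rw [h1, h2, ih, Function.update_of_ne hne]
    · simpa [done, hmn] using ih

/-- Weak links after the raise imply weak links before it, so in both cases processing is contiguous
behind `j` and the saved time is passed on in full. -/
lemma done_update_of_wlink (h0 : ∀ i, 0 < v i) (hu : v j ≤ u) {m : ℕ} (hm : j < m)
    (hmn : m ≤ I.n) (hl : ∀ i, j.val < i → i < m → I.WLink (Function.update v j u) i) :
    I.done (Function.update v j u) m = I.done v m - (1 / v j - 1 / u) := by
  induction m, hm using Nat.le_induction with
  | base =>
    rw [Nat.succ_eq_add_one, done_succ, done_succ, done_update_of_le le_rfl,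
      Function.update_self]
    ring
  | succ m hm ih =>
    have hmn' : m < I.n := hmn
    have h1 := done_succ (Function.update v j u) ⟨m, hmn⟩
    have h2 := done_succ v ⟨m, hmn⟩
    have hne : (⟨m, hmn⟩ : Fin I.n) ≠ j := by
      rintro rfl
      simp at hm
    rw [← rel_val] at h1 h2
    simp only at h1 h2
    have hw := (hl m hm (Nat.lt_succ_self m)).2
    have hw' := hw.trans (done_update_le h0 hu m)
    rw [h1, h2, max_eq_right hw, max_eq_right hw', Function.update_of_ne hne,
      ih hmn'.le fun i hi hi' => hl i hi (by omega)]
    ring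

lemma Link.of_update (h0 : ∀ i, 0 < v i) (hu : v j ≤ u) {i : ℕ}
    (h : I.Link (Function.update v j u) i) : I.Link v i :=
  ⟨h.1, h.2.trans_le (done_update_le h0 hu i)⟩

lemma WLink.of_update (h0 : ∀ i, 0 < v i) (hu : v j ≤ u) {i : ℕ}
    (h : I.WLink (Function.update v j u) i) : I.WLink v i :=
  ⟨h.1, h.2.trans (done_update_le h0 hu i)⟩

/-- If speeding up `j` makes a difference for the completion of the first `e` jobs, then `j` is
linked to all of them that follow it. -/
lemma link_of_done_lt (h0 : ∀ i, 0 < v i) (hu : v j ≤ u) {e : ℕ} (he : e ≤ I.n)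
    (h : I.done (Function.update v j u) e < I.done v e) :
    j < e ∧ ∀ i, j.val < i → i < e → I.Link v i := by
  refine ⟨not_le.1 fun hc => ?_, fun i hi hie => ?_⟩
  · rw [done_update_of_le hc] at h
    exact lt_irrefl _ h
  · by_contra hl
    rw [done_update_of_not_link h0 hu hi (by omega) hl hie] at h
    exact lt_irrefl _ h

/-- A job that is weakly linked to `j` was strictly linked to it before `j` was sped up. -/
lemma WLink.link_of_update (h0 : ∀ i, 0 < v i) (hu : v j < u) {m : ℕ} (hjm : j < m)
    (hl : ∀ i, j.val < i → i ≤ m → I.WLink (Function.update v j u) i) : I.Link v m := by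
  have h := hl m hjm le_rfl
  refine ⟨h.1, h.2.trans_lt ?_⟩
  rw [done_update_of_wlink h0 hu.le hjm h.1.le fun i hi hi' => hl i hi hi'.le]
  have := one_div_lt_one_div_of_lt (h0 j) hu
  linarith

/-- The end of the jobs that are affected by `j`. -/
def chainEnd (I : Inst) (v : Fin I.n → ℝ) (j : ℕ) : ℕ := next (I.Link v) j

/-- The end of the jobs that are weakly affected by `j`. -/
def wchainEnd (I : Inst) (v : Fin I.n → ℝ) (j : ℕ) : ℕ := next (I.WLink v) j

lemma chainEnd_le {j : ℕ} (hj : j < I.n) : I.chainEnd v j ≤ I.n := next_le hj not_link_n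

lemma lt_chainEnd {j : ℕ} (hj : j < I.n) : j < I.chainEnd v j := (next_mem hj not_link_n).1

lemma wchainEnd_le {j : ℕ} (hj : j < I.n) : I.wchainEnd v j ≤ I.n := next_le hj not_wlink_n

lemma lt_wchainEnd {j : ℕ} (hj : j < I.n) : j < I.wchainEnd v j := (next_mem hj not_wlink_n).1

/-- The real gain, in which the shrinking energy at the highest speed is a large number. -/
def rgain (I : Inst) (v : Fin I.n → ℝ) (j : Fin I.n) : ℝ :=
  (I.chainEnd v j : ℝ) - j - I.del (I.fl (v j))

/-- All speeds are between the lowest positive one and the highest one. -/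
def InRange (I : Inst) (v : Fin I.n → ℝ) : Prop := ∀ j, I.sp 1 ≤ v j ∧ v j ≤ I.sp I.k

lemma InRange.pos (h : I.InRange v) (j : Fin I.n) : 0 < v j :=
  (sp_pos one_pos I.k_pos).trans_le (h j).1

lemma InRange.update (h : I.InRange v) (hu : v j ≤ u) (hu' : u ≤ I.sp I.k) :
    I.InRange (Function.update v j u) := by
  intro i
  by_cases hi : i = j
  · subst hi
    simpa using ⟨(h i).1.trans hu, hu'⟩
  · simpa [hi] using h i

lemma inRange_lowest : I.InRange I.lowest := by
  intro j
  have : I.lowest j = I.sp 1 := by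
    have := I.k_pos
    simp [lowest, sp, this]
  rw [this]
  exact ⟨le_rfl, sp_le I.k_pos le_rfl⟩

/-- The gains at which the algorithm goes on, as real numbers. -/
def _root_.SpeedScaling.Rule.RActive : Rule → ℝ → Prop
  | .positive, g => 0 < g
  | .nonneg, g => 0 ≤ g

lemma _root_.SpeedScaling.Rule.RActive.nonneg {ρ : Rule} {g : ℝ} (h : ρ.RActive g) : 0 ≤ g := by
  cases ρ
  · exact le_of_lt h
  · exact h

lemma _root_.SpeedScaling.Rule.RActive.mono {ρ : Rule} {g g' : ℝ} (h : ρ.RActive g)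
    (hg : g ≤ g') : ρ.RActive g' := by
  cases ρ
  · exact lt_of_lt_of_le h hg
  · exact le_trans h hg

/-- Job `j` may be sped up, in terms of the real gains. -/
def CanRaise (I : Inst) (ρ : Rule) (v : Fin I.n → ℝ) (j : Fin I.n) : Prop :=
  ρ.RActive (I.rgain v j) ∧ ∀ j', I.rgain v j' ≤ I.rgain v j

/-- An affection is at most `n`, less than the value `n + 1` that replaces the infinite shrinking
energy. So a job at the highest speed has a negative real gain. -/
lemma fl_lt_of_rgain_nonneg (h : 0 ≤ I.rgain v j) : I.fl (v j) < I.k := by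
  by_contra hc
  have h1 : ((I.chainEnd v j : ℕ) : ℝ) ≤ I.n := by exact_mod_cast chainEnd_le j.isLt
  have h2 : (0 : ℝ) ≤ (j : ℕ) := by positivity
  rw [rgain, del_top (not_lt.1 hc)] at h
  linarith

end Inst

end SpeedScaling

end

noncomputable section

namespace SpeedScaling

namespace Inst

variable {I : Inst} {v : Fin I.n → ℝ}

/-! ### The first-in-first-out schedule -/

lemma done_nonneg (h0 : ∀ i, 0 < v i) (m : ℕ) : 0 ≤ I.done v m := by
  induction m with
  | zero => exact le_rfl
  | succ m ih =>
    unfold done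
    split_ifs with h
    · have := h0 ⟨m, h⟩
      have := le_max_of_le_right (a := (0 : ℝ)) (b := I.r ⟨m, h⟩) ih
      positivity
    · exact ih

lemma done_le_succ (h0 : ∀ i, 0 < v i) (m : ℕ) : I.done v m ≤ I.done v (m + 1) := by
  conv_rhs => unfold done
  split_ifs with h
  · have h1 := one_div_pos.2 (h0 ⟨m, h⟩)
    have h2 := le_max_right (I.r ⟨m, h⟩) (I.done v m)
    linarith
  · exact le_rfl

lemma done_mono (h0 : ∀ i, 0 < v i) : Monotone (I.done v) :=
  monotone_nat_of_le_succ (done_le_succ h0)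

lemma start_nonneg (h0 : ∀ i, 0 < v i) (j : Fin I.n) : 0 ≤ I.start v j :=
  le_max_of_le_right (done_nonneg h0 _)

lemma done_succ_eq_start (v : Fin I.n → ℝ) (j : Fin I.n) :
    I.done v (j + 1) = I.start v j + 1 / v j := done_succ v j

lemma start_lt_done (h0 : ∀ i, 0 < v i) (j : Fin I.n) : I.start v j < I.done v (j + 1) := by
  have := one_div_pos.2 (h0 j)
  rw [done_succ_eq_start]
  linarith

lemma done_succ_le_start (h0 : ∀ i, 0 < v i) {i j : Fin I.n} (h : i < j) :
    I.done v (i + 1) ≤ I.start v j :=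
  (done_mono h0 (Nat.succ_le_of_lt h)).trans (le_max_right _ _)

/-- The processing intervals of different jobs are disjoint, so the choice in `fifoJob` has at most
one candidate. -/
lemma fifoJob_eq_some_iff (h0 : ∀ i, 0 < v i) (t : ℝ) (j : Fin I.n) :
    I.fifoJob v t = some j ↔ t ∈ Set.Ico (I.start v j) (I.done v (j + 1)) := by
  have huniq : ∀ i j : Fin I.n, t ∈ Set.Ico (I.start v i) (I.done v (i + 1)) →
      t ∈ Set.Ico (I.start v j) (I.done v (j + 1)) → i ≤ j := by
    intro i j hi hj
    by_contra hc
    have := done_succ_le_start h0 (not_le.1 hc)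
    linarith [hi.1, hj.2]
  constructor
  · intro h
    unfold fifoJob at h
    split_ifs at h with hex
    have := hex.choose_spec
    rw [Option.some.injEq] at h
    rwa [h] at this
  · intro h
    have hex : ∃ j : Fin I.n, I.start v j ≤ t ∧ t < I.done v (j + 1) := ⟨j, h⟩
    have := hex.choose_spec
    unfold fifoJob
    rw [dif_pos hex, Option.some.injEq]
    exact le_antisymm (huniq _ _ this h) (huniq _ _ h this)

lemma fifo_S_of_job {t : ℝ} {j : Fin I.n} (h : I.fifoJob v t = some j) :
    (I.fifo v).S t = if t < I.start v j + I.slowTime (v j) then I.floorLevel (v j)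
      else I.ceilLevel (v j) := by
  simp [fifo, h]

lemma fifo_S_of_none {t : ℝ} (h : I.fifoJob v t = none) : (I.fifo v).S t = 0 := by
  simp [fifo, h]

lemma floorLevel_pos {u : ℝ} (h : I.sp 1 ≤ u) : 0 < I.floorLevel u := by
  have := fl_pos h
  exact Fin.lt_def.2 this

lemma floorLevel_le_ceilLevel {u : ℝ} (h1 : 0 ≤ u) (h : u ≤ I.sp I.k) :
    I.floorLevel u ≤ I.ceilLevel u := by
  have e1 := (le_floorLevel_iff h1 (I.floorLevel u)).1 le_rfl
  have e2 := (ceilLevel_le_iff h (I.ceilLevel u)).1 le_rfl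
  exact I.s_strictMono.le_iff_le.1 (e1.trans e2)

lemma ceilLevel_pos {u : ℝ} (h : I.sp 1 ≤ u) (h' : u ≤ I.sp I.k) : 0 < I.ceilLevel u :=
  (floorLevel_pos h).trans_le
    (floorLevel_le_ceilLevel ((sp_pos one_pos I.k_pos).le.trans h) h')

lemma fifo_X (hv : I.InRange v) (j : Fin I.n) :
    (I.fifo v).X j = Set.Ico (I.start v j) (I.done v (j + 1)) := by
  ext t
  constructor
  · rintro ⟨-, h, -⟩
    exact (fifoJob_eq_some_iff hv.pos t j).1 h
  · intro h
    have hj := (fifoJob_eq_some_iff hv.pos t j).2 h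
    refine ⟨(start_nonneg hv.pos j).trans h.1, hj, ?_⟩
    rw [fifo_S_of_job hj]
    split_ifs
    · exact floorLevel_pos (hv j).1
    · exact ceilLevel_pos (hv j).1 (hv j).2

lemma fifo_C (hv : I.InRange v) (j : Fin I.n) : (I.fifo v).C j = I.done v (j + 1) := by
  rw [Schedule.C, fifo_X hv, csSup_Ico (start_lt_done hv.pos j)]

lemma fifo_x (hv : I.InRange v) (j : Fin I.n) : (I.fifo v).x j = 1 / v j := by
  have := one_div_pos.2 (hv.pos j)
  rw [Schedule.x, fifo_X hv, Real.volume_Ico, done_succ_eq_start, add_sub_cancel_left,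
    ENNReal.toReal_ofReal this.le]

lemma fifo_speed (hv : I.InRange v) (j : Fin I.n) : (I.fifo v).speed j = v j := by
  rw [Schedule.speed, fifo_x hv, one_div_one_div]

lemma done_succ_strictMono (hv : I.InRange v) : StrictMono fun j : Fin I.n => I.done v (j + 1) :=
  fun _ j h => (done_succ_le_start hv.pos h).trans_lt (start_lt_done hv.pos j)

/-- No single step of the relation passes the end of the chain: the job there, and every later one,
is released no earlier than the completion of all members of the chain. Conversely, consecutive
links are steps of the transitive closure. -/
lemma fifo_affects_iff (hv : I.InRange v) (j j' : Fin I.n) :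
    (I.fifo v).Affects j j' ↔ j.val ≤ j'.val ∧ j'.val < I.chainEnd v j := by
  have hR : ∀ a b : Fin I.n, (I.fifo v).C a ≤ (I.fifo v).C b ∧ I.r b < (I.fifo v).C a ↔
      a ≤ b ∧ I.r b < I.done v (a + 1) := by
    intro a b
    rw [fifo_C hv, fifo_C hv, (done_succ_strictMono hv).le_iff_le]
  constructor
  · intro h
    have hstep : ∀ b c : Fin I.n, j ≤ b → b.val < I.chainEnd v j →
        ((I.fifo v).C b ≤ (I.fifo v).C c ∧ I.r c < (I.fifo v).C b) →
        j.val ≤ c.val ∧ c.val < I.chainEnd v j := by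
      intro b c hjb hb hbc
      rw [hR] at hbc
      refine ⟨hjb.trans hbc.1, not_le.1 fun hc => ?_⟩
      have hn := (next_mem j.isLt (not_link_n (v := v))).2
      refine hn ⟨lt_of_le_of_lt hc c.isLt, ?_⟩
      have h1 := rel_mono (I := I) hc c.isLt
      rw [rel_val] at h1
      exact (h1.trans_lt hbc.2).trans_le (done_mono hv.pos (Nat.succ_le_of_lt hb))
    induction h with
    | single h => exact hstep j _ le_rfl (lt_chainEnd j.isLt) h
    | tail _ h ih => exact hstep _ _ ih.1 ih.2 h
  · rintro ⟨h1, h2⟩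
    obtain ⟨b, hb⟩ := j'
    simp only at h1 h2
    induction b, h1 using Nat.le_induction with
    | base =>
      refine Relation.TransGen.single ((hR _ _).2 ⟨le_rfl, ?_⟩)
      exact (le_max_left _ _).trans_lt (start_lt_done hv.pos j)
    | succ b hjb ih =>
      refine (ih (by omega) (by omega)).tail ((hR _ _).2 ⟨Fin.mk_le_mk.2 (by omega), ?_⟩)
      have h3 : I.Link v (b + 1) := of_lt_next (by omega) h2
      rw [← rel_val]
      exact h3.2

lemma fifo_kappa (hv : I.InRange v) (j : Fin I.n) :
    (I.fifo v).kappa j = I.chainEnd v j - j := by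
  have : {j' | (I.fifo v).Affects j j'} = {j' : Fin I.n | j.val ≤ j'.val ∧ j'.val < I.chainEnd v j} := by
    ext j'
    exact fifo_affects_iff hv j j'
  rw [Schedule.kappa, this, ← Set.ncard_image_of_injective _ Fin.val_injective]
  have h2 : Fin.val '' {j' : Fin I.n | j.val ≤ j'.val ∧ j'.val < I.chainEnd v j} =
      (Finset.Ico j.val (I.chainEnd v j) : Set ℕ) := by
    ext m
    simp only [Set.mem_image, Set.mem_ofPred_eq, Finset.coe_Ico, Set.mem_Ico]
    constructor
    · rintro ⟨a, ha, rfl⟩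
      exact ha
    · intro hm
      exact ⟨⟨m, hm.2.trans_le (chainEnd_le j.isLt)⟩, hm, rfl⟩
  rw [h2, Set.ncard_coe_finset, Nat.card_Ico]

lemma slowTime_nonneg {u : ℝ} (h : I.sp 1 ≤ u) (h' : u ≤ I.sp I.k) : 0 ≤ I.slowTime u := by
  have hu : 0 < u := (sp_pos one_pos I.k_pos).trans_le h
  have h1 := (ceilLevel_le_iff h' (I.ceilLevel u)).1 le_rfl
  have h2 := (le_floorLevel_iff hu.le (I.floorLevel u)).1 le_rfl
  exact div_nonneg (by linarith) (mul_nonneg hu.le (by linarith))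

lemma slowTime_le {u : ℝ} (h : I.sp 1 ≤ u) (h' : u ≤ I.sp I.k) : I.slowTime u ≤ 1 / u := by
  have hu : 0 < u := (sp_pos one_pos I.k_pos).trans_le h
  have h1 := (ceilLevel_le_iff h' (I.ceilLevel u)).1 le_rfl
  have h2 := (le_floorLevel_iff hu.le (I.floorLevel u)).1 le_rfl
  unfold slowTime
  rcases (h2.trans h1).eq_or_lt with h3 | h3
  · rw [h3, sub_self, mul_zero, div_zero]
    positivity
  · have : 0 < I.s (I.ceilLevel u) - I.s (I.floorLevel u) := by linarith
    rw [div_le_div_iff₀ (by positivity) hu]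
    nlinarith

lemma slowTime_volume {u : ℝ} (h : I.sp 1 ≤ u) (h' : u ≤ I.sp I.k) :
    I.s (I.floorLevel u) * I.slowTime u + I.s (I.ceilLevel u) * (1 / u - I.slowTime u) = 1 := by
  have hu : 0 < u := (sp_pos one_pos I.k_pos).trans_le h
  have h1 := (ceilLevel_le_iff h' (I.ceilLevel u)).1 le_rfl
  have h2 := (le_floorLevel_iff hu.le (I.floorLevel u)).1 le_rfl
  unfold slowTime
  rcases (h2.trans h1).eq_or_lt with h3 | h3
  -- Here `u` is a given speed. The denominator in `slowTime` vanishes, so the slow phase has length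
  -- 0.
  · have : I.s (I.ceilLevel u) = u := le_antisymm (h3 ▸ h2) h1
    rw [h3, this]
    simp [hu.ne']
  · have : I.s (I.ceilLevel u) - I.s (I.floorLevel u) ≠ 0 := by linarith
    field_simp
    ring

/-- The interval of the job is split where the speed changes. With `I.s` for `f` this gives the
volume, with `I.P` the energy. -/
lemma fifo_setIntegral (hv : I.InRange v) (j : Fin I.n) (f : Fin (I.k + 1) → ℝ) :
    ∫ t in (I.fifo v).X j, f ((I.fifo v).S t) =
      f (I.floorLevel (v j)) * I.slowTime (v j) +
        f (I.ceilLevel (v j)) * (1 / v j - I.slowTime (v j)) := by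
  have h1 := slowTime_nonneg (hv j).1 (hv j).2
  have h2 := slowTime_le (hv j).1 (hv j).2
  set c := I.start v j + I.slowTime (v j) with hc
  have hac : I.start v j ≤ c := by linarith
  have hcb : c ≤ I.done v (j + 1) := by rw [done_succ_eq_start]; linarith
  have e1 : ∀ t ∈ Set.Ico (I.start v j) c, f ((I.fifo v).S t) = f (I.floorLevel (v j)) := by
    intro t ht
    rw [fifo_S_of_job ((fifoJob_eq_some_iff hv.pos t j).2 ⟨ht.1, ht.2.trans_le hcb⟩), if_pos ht.2]
  have e2 : ∀ t ∈ Set.Ico c (I.done v (j + 1)),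
      f ((I.fifo v).S t) = f (I.ceilLevel (v j)) := by
    intro t ht
    rw [fifo_S_of_job ((fifoJob_eq_some_iff hv.pos t j).2 ⟨hac.trans ht.1, ht.2⟩),
      if_neg (not_lt.2 ht.1)]
  have i1 : IntegrableOn (fun t => f ((I.fifo v).S t)) (Set.Ico (I.start v j) c) :=
    (integrableOn_const (by simp)).congr_fun (fun t ht => (e1 t ht).symm) measurableSet_Ico
  have i2 : IntegrableOn (fun t => f ((I.fifo v).S t)) (Set.Ico c (I.done v (j + 1))) :=
    (integrableOn_const (by simp)).congr_fun (fun t ht => (e2 t ht).symm) measurableSet_Ico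
  rw [fifo_X hv, ← Set.Ico_union_Ico_eq_Ico hac hcb, setIntegral_union
    (Set.disjoint_left.2 fun t ht ht' => absurd ht.2 (not_lt.2 ht'.1)) measurableSet_Ico i1 i2,
    setIntegral_congr_fun measurableSet_Ico e1, setIntegral_congr_fun measurableSet_Ico e2,
    setIntegral_const, setIntegral_const, Real.volume_real_Ico_of_le hac,
    Real.volume_real_Ico_of_le hcb, done_succ_eq_start, smul_eq_mul, smul_eq_mul, hc]
  ring

lemma fifo_measurable (hv : I.InRange v) (o : Option (Fin I.n)) (i : Fin (I.k + 1)) :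
    MeasurableSet {t | 0 ≤ t ∧ (I.fifo v).J t = o ∧ (I.fifo v).S t = i} := by
  cases o with
  | none =>
    have : {t | 0 ≤ t ∧ (I.fifo v).J t = none ∧ (I.fifo v).S t = i} =
        (Set.Ici 0 ∩ ⋂ j : Fin I.n, (Set.Ico (I.start v j) (I.done v (j + 1)))ᶜ) ∩
          {_t | (0 : Fin (I.k + 1)) = i} := by
      ext t
      have hJ : (I.fifo v).J t = none ↔
          ∀ j : Fin I.n, t ∉ Set.Ico (I.start v j) (I.done v (j + 1)) := by
        rw [Option.eq_none_iff_forall_ne_some]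
        exact forall_congr' fun j => not_congr (fifoJob_eq_some_iff hv.pos t j)
      constructor
      · rintro ⟨h1, h2, h3⟩
        rw [fifo_S_of_none h2] at h3
        exact ⟨⟨h1, Set.mem_iInter.2 (hJ.1 h2)⟩, h3⟩
      · rintro ⟨⟨h1, h2⟩, h3⟩
        have h2' := hJ.2 (Set.mem_iInter.1 h2)
        exact ⟨h1, h2', by rw [fifo_S_of_none h2']; exact h3⟩
    rw [this]
    exact (measurableSet_Ici.inter (MeasurableSet.iInter fun j => measurableSet_Ico.compl)).inter
      (MeasurableSet.const _)
  | some j =>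
    have : {t | 0 ≤ t ∧ (I.fifo v).J t = some j ∧ (I.fifo v).S t = i} =
        (Set.Ici 0 ∩ Set.Ico (I.start v j) (I.done v (j + 1))) ∩
          ((Set.Iio (I.start v j + I.slowTime (v j)) ∩ {_t | I.floorLevel (v j) = i}) ∪
            (Set.Ici (I.start v j + I.slowTime (v j)) ∩ {_t | I.ceilLevel (v j) = i})) := by
      ext t
      have hJ : (I.fifo v).J t = some j ↔ t ∈ Set.Ico (I.start v j) (I.done v (j + 1)) :=
        fifoJob_eq_some_iff hv.pos t j
      constructor
      · rintro ⟨h1, h2, h3⟩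
        refine ⟨⟨h1, hJ.1 h2⟩, ?_⟩
        rw [fifo_S_of_job h2] at h3
        split_ifs at h3 with h4
        · exact Or.inl ⟨h4, h3⟩
        · exact Or.inr ⟨not_lt.1 h4, h3⟩
      · rintro ⟨⟨h1, h2⟩, h3⟩
        refine ⟨h1, hJ.2 h2, ?_⟩
        rw [fifo_S_of_job (hJ.2 h2)]
        rcases h3 with ⟨h3, h4⟩ | ⟨h3, h4⟩
        · rw [if_pos (Set.mem_Iio.1 h3)]
          exact h4
        · rw [if_neg (not_lt.2 (Set.mem_Ici.1 h3))]
          exact h4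
    rw [this]
    exact (measurableSet_Ici.inter measurableSet_Ico).inter
      ((measurableSet_Iio.inter (MeasurableSet.const _)).union
        (measurableSet_Ici.inter (MeasurableSet.const _)))

lemma fifo_feasible (hv : I.InRange v) : (I.fifo v).Feasible where
  measurable := fifo_measurable hv
  released j t _ h := (le_max_left _ _).trans ((fifoJob_eq_some_iff hv.pos t j).1 h).1
  processed j := by
    rw [fifo_setIntegral hv j I.s]
    exact slowTime_volume (hv j).1 (hv j).2
  completed j := by
    rw [fifo_X hv]
    exact bddAbove_Ico

end Inst

/-! ### Measurability and integrability for arbitrary feasible schedules -/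

namespace Schedule

variable {I : Inst} {σ : Schedule I}

lemma Feasible.measurableSet_S (hσ : σ.Feasible) (i : Fin (I.k + 1)) :
    MeasurableSet {t | 0 ≤ t ∧ σ.S t = i} := by
  have : {t | 0 ≤ t ∧ σ.S t = i} =
      ⋃ o : Option (Fin I.n), {t | 0 ≤ t ∧ σ.J t = o ∧ σ.S t = i} := by
    ext t
    simp
  rw [this]
  exact MeasurableSet.iUnion fun o => hσ.measurable o i

lemma Feasible.measurableSet_X (hσ : σ.Feasible) (j : Fin I.n) : MeasurableSet (σ.X j) := by
  have : σ.X j = ⋃ i : {i : Fin (I.k + 1) // 0 < i},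
      {t | 0 ≤ t ∧ σ.J t = some j ∧ σ.S t = i} := by
    ext t
    simp only [X, Set.mem_ofPred_eq, Set.mem_iUnion]
    constructor
    · rintro ⟨h1, h2, h3⟩
      exact ⟨⟨_, h3⟩, h1, h2, rfl⟩
    · rintro ⟨⟨i, hi⟩, h1, h2, h3⟩
      exact ⟨h1, h2, h3 ▸ hi⟩
  rw [this]
  exact MeasurableSet.iUnion fun i => hσ.measurable _ _

/-- A function of the speed, cut off at time zero, is measurable. -/
lemma Feasible.measurable_comp (hσ : σ.Feasible) (f : Fin (I.k + 1) → ℝ) :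
    Measurable ((Set.Ici (0 : ℝ)).indicator fun t => f (σ.S t)) := by
  have : (Set.Ici (0 : ℝ)).indicator (fun t => f (σ.S t)) =
      fun t => ∑ i, ({t | 0 ≤ t ∧ σ.S t = i}).indicator (fun _ => f i) t := by
    funext t
    by_cases ht : 0 ≤ t
    · rw [Set.indicator_of_mem (Set.mem_Ici.2 ht), Finset.sum_eq_single (σ.S t)]
      · simp [ht]
      · intro i _ hi
        simp [hi.symm]
      · simp
    · rw [Set.indicator_of_notMem (by simpa using ht)]
      simp [ht]
  rw [this]
  exact Finset.measurable_sum _ fun i _ => measurable_const.indicator (hσ.measurableSet_S i)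

lemma X_subset_Ici (j : Fin I.n) : σ.X j ⊆ Set.Ici 0 := fun _ ht => ht.1

/-- A function of the speed is integrable over every bounded set of times. -/
lemma Feasible.integrableOn_comp (hσ : σ.Feasible) (f : Fin (I.k + 1) → ℝ) {A : Set ℝ}
    (hA : MeasurableSet A) (h0 : A ⊆ Set.Ici 0) (hfin : volume A ≠ ⊤) :
    IntegrableOn (fun t => f (σ.S t)) A := by
  have h1 : IntegrableOn ((Set.Ici (0 : ℝ)).indicator fun t => f (σ.S t)) A := by
    refine Measure.integrableOn_of_bounded (M := ∑ i, |f i|) hfin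
      (hσ.measurable_comp f).aestronglyMeasurable (Filter.Eventually.of_forall fun t => ?_)
    refine (norm_indicator_le_norm_self _ _).trans ?_
    exact Finset.single_le_sum (f := fun i => |f i|) (fun i _ => abs_nonneg _) (Finset.mem_univ _)
  exact h1.congr_fun (fun t ht => Set.indicator_of_mem (h0 ht) _) hA

end Schedule

end SpeedScaling

end

noncomputable section

namespace SpeedScaling

namespace Inst

variable {I : Inst} {ρ : Rule} {v : Fin I.n → ℝ} {j : Fin I.n} {u : ℝ}

/-! ### Iterations in terms of real gains -/

lemma active_coe (ρ : Rule) (g : ℝ) : ρ.Active (g : EReal) ↔ ρ.RActive g := by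
  cases ρ
  · exact EReal.coe_pos
  · exact EReal.coe_nonneg

lemma not_active_bot (ρ : Rule) : ¬ ρ.Active ⊥ := by
  cases ρ
  · exact not_lt_bot
  · exact not_le.2 (EReal.bot_lt_coe 0)

lemma fifo_gain (hv : I.InRange v) (j : Fin I.n) (h : I.fl (v j) < I.k) :
    (I.fifo v).gain j = ((I.rgain v j : ℝ) : EReal) := by
  have hk : (((I.fifo v).kappa j : ℕ) : ℝ) = (I.chainEnd v j : ℝ) - j := by
    rw [fifo_kappa hv, Nat.cast_sub (lt_chainEnd j.isLt).le]
  rw [Schedule.gain, Schedule.shrinkingEnergy, fifo_speed hv,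
    Delta_eq (floorLevel_pos (hv j).1) h, hk, rgain, ← EReal.coe_sub]
  rfl

lemma fifo_gain_top (hv : I.InRange v) (j : Fin I.n) (h : ¬ I.fl (v j) < I.k) :
    (I.fifo v).gain j = ⊥ := by
  have := fl_le (I := I) (v j)
  rw [Schedule.gain, Schedule.shrinkingEnergy, fifo_speed hv,
    Delta_top (show I.fl (v j) = I.k by omega)]
  exact EReal.sub_top _

lemma active_iff (hv : I.InRange v) (j : Fin I.n) :
    ρ.Active ((I.fifo v).gain j) ↔ ρ.RActive (I.rgain v j) := by
  by_cases h : I.fl (v j) < I.k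
  · rw [fifo_gain hv j h, active_coe]
  · rw [fifo_gain_top hv j h]
    exact iff_of_false (not_active_bot ρ) fun hc => h (fl_lt_of_rgain_nonneg hc.nonneg)

lemma halted_iff (hv : I.InRange v) : I.Halted ρ v ↔ ∀ j, ¬ ρ.RActive (I.rgain v j) :=
  forall_congr' fun j => not_congr (active_iff hv j)

/-- The two kinds of gain differ only for jobs at the highest speed, and there both lie below an
active gain. -/
lemma canSpeedUp_iff (hv : I.InRange v) (j : Fin I.n) : I.CanSpeedUp ρ v j ↔ I.CanRaise ρ v j := by
  unfold CanSpeedUp CanRaise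
  rw [active_iff hv]
  refine and_congr_right fun ha => forall_congr' fun j' => ?_
  have hj := fl_lt_of_rgain_nonneg ha.nonneg
  rw [fifo_gain hv j hj]
  by_cases h : I.fl (v j') < I.k
  · rw [fifo_gain hv j' h, EReal.coe_le_coe_iff]
  · rw [fifo_gain_top hv j' h]
    refine iff_of_true bot_le (not_lt.1 fun hc => h ?_)
    exact fl_lt_of_rgain_nonneg (ha.nonneg.trans hc.le)

/-- Increasing the speed of `j` to `u` is an iteration. -/
structure Raises (I : Inst) (ρ : Rule) (v : Fin I.n → ℝ) (j : Fin I.n) (u : ℝ) : Prop where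
  lt : v j < u
  le_top : u ≤ I.sp I.k
  canRaise : ∀ w, v j ≤ w → w < u → I.CanRaise ρ (Function.update v j w) j
  not_canRaise : ¬ I.CanRaise ρ (Function.update v j u) j

lemma not_canRaise_top (h : I.fl (v j) = I.k) : ¬ I.CanRaise ρ v j := fun hc =>
  (fl_lt_of_rgain_nonneg hc.1.nonneg).ne h

lemma iteration_iff (hv : I.InRange v) (v' : Fin I.n → ℝ) :
    I.Iteration ρ v v' ↔ ∃ j u, I.Raises ρ v j u ∧ v' = Function.update v j u := by
  constructor
  · rintro ⟨j, u, h1, h2, h3, h4⟩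
    -- `Iteration` sets no upper bound for `u`, but a raise beyond the highest speed would have to
    -- be permitted at that speed, where the gain is not active.
    have hu : u ≤ I.sp I.k := by
      by_contra hc
      have hr := hv.update (j := j) (hv j).2 le_rfl
      refine not_canRaise_top ?_ ((canSpeedUp_iff hr j).1 (h3 _ (hv j).2 (not_le.1 hc)))
      rw [fl_eq_top_iff (hr.pos j).le, Function.update_self]
    exact ⟨j, u, ⟨h1, hu, fun w hw hwu =>
      (canSpeedUp_iff (hv.update hw (hwu.le.trans hu)) j).1 (h3 w hw hwu),
      fun hc => h4 ((canSpeedUp_iff (hv.update h1.le hu) j).2 hc)⟩, h2⟩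
  · rintro ⟨j, u, h, rfl⟩
    exact ⟨j, u, h.lt, rfl, fun w hw hwu =>
      (canSpeedUp_iff (hv.update hw (hwu.le.trans h.le_top)) j).2 (h.canRaise w hw hwu),
      fun hc => h.not_canRaise ((canSpeedUp_iff (hv.update h.lt.le h.le_top) j).1 hc)⟩

/-- Gains depend only on links and levels. A higher speed creates no link, so it suffices that none
is lost. -/
lemma rgain_update_congr (h0 : ∀ i, 0 < v i) (hu : v j ≤ u) (hfl : I.fl u = I.fl (v j))
    (hl : ∀ i, I.Link v i → I.Link (Function.update v j u) i) (j' : Fin I.n) :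
    I.rgain (Function.update v j u) j' = I.rgain v j' := by
  have h1 : I.Link (Function.update v j u) = I.Link v :=
    funext fun i => propext ⟨fun h => h.of_update h0 hu, hl i⟩
  have h2 : I.fl (Function.update v j u j') = I.fl (v j') := by
    by_cases h : j' = j
    · subst h
      simpa using hfl
    · simp [h]
  rw [rgain, rgain, chainEnd, chainEnd, h1, h2]

/-- Links are strict inequalities in continuous functions of the speed, hence survive a small raise,
and levels are constant to the right. So gains are right-continuous step functions of the speed. -/
lemma eventually_rgain_eq (hv : I.InRange v) (j : Fin I.n) :
    ∀ᶠ w in nhdsWithin (v j) (Set.Ici (v j)), ∀ j', I.rgain (Function.update v j w) j' =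
      I.rgain v j' := by
  have h1 : ∀ᶠ w in nhdsWithin (v j) (Set.Ici (v j)), ∀ i ∈ Finset.range I.n, I.Link v i →
      I.Link (Function.update v j w) i := by
    rw [Filter.eventually_all_finset]
    intro i _
    by_cases h : I.Link v i
    · have hc := continuousAt_done_update v j (hv.pos j).ne' i
      have h2 : I.rel i < I.done (Function.update v j (v j)) i := by
        rw [Function.update_eq_self]
        exact h.2
      have := Filter.Eventually.filter_mono (nhdsWithin_le_nhds (s := Set.Ici (v j)))
        (hc.eventually (lt_mem_nhds h2))
      filter_upwards [this] with w hw _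
      exact ⟨h.1, hw⟩
    · exact Filter.Eventually.of_forall fun w hw => absurd hw h
  filter_upwards [h1, eventually_fl_eq (I := I) (hv.pos j).le, self_mem_nhdsWithin]
    with w hw hfl hwj
  exact rgain_update_congr hv.pos hwj hfl fun i hi => hw i (Finset.mem_range.2 hi.1) hi

/-- While job `j` may be sped up, there is a first speed at which it may not. -/
lemma exists_raises (hv : I.InRange v) (h : I.CanRaise ρ v j) : ∃ u, I.Raises ρ v j u := by
  set A := {w | v j ≤ w ∧ ¬ I.CanRaise ρ (Function.update v j w) j} with hA
  have htop : I.sp I.k ∈ A := by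
    refine ⟨(hv j).2, not_canRaise_top ?_⟩
    rw [Function.update_self, fl_eq_top_iff (sp_pos I.k_pos le_rfl).le]
  have hbdd : BddBelow A := ⟨v j, fun w hw => hw.1⟩
  have hle : sInf A ≤ I.sp I.k := csInf_le hbdd htop
  have hge : v j ≤ sInf A := le_csInf ⟨_, htop⟩ fun w hw => hw.1
  -- The infimum belongs to `A`: if raising were permitted there, right-continuity of the gains
  -- would permit it at all nearby larger speeds, and some of them would lie in `A`.
  have hnot : ¬ I.CanRaise ρ (Function.update v j (sInf A)) j := by
    intro hc
    have hev := eventually_rgain_eq (hv.update hge hle) j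
    rw [Function.update_self] at hev
    obtain ⟨b, hb, hsub⟩ := (mem_nhdsGE_iff_exists_Ico_subset).1 hev
    obtain ⟨w, hw, hwb⟩ := exists_lt_of_csInf_lt ⟨_, htop⟩ (Set.mem_Ioi.1 hb)
    have h1 := hsub ⟨csInf_le hbdd hw, hwb⟩
    simp only [Set.mem_ofPred_eq, Function.update_idem] at h1
    refine hw.2 ⟨?_, fun j' => ?_⟩
    · rw [h1]
      exact hc.1
    · rw [h1, h1]
      exact hc.2 j'
  refine ⟨sInf A, lt_of_le_of_ne hge fun hc => hnot ?_, hle, fun w hw hwu => ?_, hnot⟩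
  · rwa [← hc, Function.update_eq_self]
  · by_contra hc
    exact absurd (csInf_le hbdd ⟨hw, hc⟩) (not_le.2 hwu)

lemma exists_iteration (hv : I.InRange v) (h : ¬ I.Halted ρ v) : ∃ v', I.Iteration ρ v v' := by
  rw [halted_iff hv] at h
  push Not at h
  obtain ⟨j₀, h₀⟩ := h
  obtain ⟨j, -, hj⟩ := Finset.exists_max_image Finset.univ (I.rgain v) ⟨j₀, Finset.mem_univ _⟩
  obtain ⟨u, hu⟩ := exists_raises hv (ρ := ρ) (j := j)
    ⟨h₀.mono (hj j₀ (Finset.mem_univ _)), fun j' => hj j' (Finset.mem_univ _)⟩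
  exact ⟨_, (iteration_iff hv _).2 ⟨j, u, hu, rfl⟩⟩

lemma Run.inRange {m : ℕ} (h : I.Run ρ m v) : I.InRange v := by
  induction h with
  | init => exact inRange_lowest
  | step _ hit ih =>
    obtain ⟨j, u, hu, rfl⟩ := (iteration_iff ih _).1 hit
    exact ih.update hu.lt.le hu.le_top

/-! ### The number of iterations -/

open Classical in
/-- The number of events that have happened: levels that were reached, and links that are lost. -/
def events (I : Inst) (v : Fin I.n → ℝ) : ℕ :=
  ∑ j, I.fl (v j) + ((Finset.range I.n).filter fun i => ¬ I.Link v i).card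

lemma events_le (v : Fin I.n → ℝ) : I.events v ≤ I.n * I.k + I.n := by
  classical
  refine add_le_add ?_ ?_
  · calc ∑ j, I.fl (v j) ≤ ∑ _j : Fin I.n, I.k := Finset.sum_le_sum fun j _ => fl_le _
      _ = I.n * I.k := by simp
  · exact (Finset.card_filter_le _ _).trans (Finset.card_range _).le

/-- Every job has at least level 1. These `n` events precede the first iteration, which improves the
bound `n k + n` to `n k`. -/
lemma le_events (hv : I.InRange v) : I.n ≤ I.events v := by
  calc I.n = ∑ _j : Fin I.n, 1 := by simp
    _ ≤ ∑ j, I.fl (v j) := Finset.sum_le_sum fun j _ => fl_pos (hv j).1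
    _ ≤ I.events v := Nat.le_add_right _ _

lemma events_lt (h0 : ∀ i, 0 < v i) (hu : v j ≤ u)
    (h : I.fl (v j) < I.fl u ∨ ∃ i, I.Link v i ∧ ¬ I.Link (Function.update v j u) i) :
    I.events v < I.events (Function.update v j u) := by
  classical
  have h1 : ∀ i ∈ Finset.univ, I.fl (v i) ≤ I.fl (Function.update v j u i) := fun i _ =>
    fl_mono (h0 i).le (update_le_of hu i)
  have h2 : ((Finset.range I.n).filter fun i => ¬ I.Link v i) ⊆
      (Finset.range I.n).filter fun i => ¬ I.Link (Function.update v j u) i := by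
    intro i hi
    rw [Finset.mem_filter] at hi ⊢
    exact ⟨hi.1, fun hc => hi.2 (hc.of_update h0 hu)⟩
  rcases h with h | ⟨i, hi, hi'⟩
  · refine add_lt_add_of_lt_of_le (Finset.sum_lt_sum h1 ⟨j, Finset.mem_univ _, ?_⟩)
      (Finset.card_le_card h2)
    rwa [Function.update_self]
  · refine add_lt_add_of_le_of_lt (Finset.sum_le_sum h1) (Finset.card_lt_card ?_)
    refine Finset.ssubset_iff_subset_ne.2 ⟨h2, fun hc => ?_⟩
    have : i ∈ (Finset.range I.n).filter fun i => ¬ I.Link (Function.update v j u) i :=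
      Finset.mem_filter.2 ⟨Finset.mem_range.2 hi.1, hi'⟩
    rw [← hc] at this
    exact (Finset.mem_filter.1 this).2 hi

/-- Without a new level or a lost link all gains would be the same as at the start, and raising
would still be permitted. -/
lemma Raises.events_lt (hv : I.InRange v) (h : I.Raises ρ v j u) :
    I.events v < I.events (Function.update v j u) := by
  refine Inst.events_lt hv.pos h.lt.le ?_
  by_contra hc
  push Not at hc
  have hfl : I.fl u = I.fl (v j) := le_antisymm hc.1 (fl_mono (hv.pos j).le h.lt.le)
  have hg := rgain_update_congr hv.pos h.lt.le hfl hc.2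
  have h1 := h.canRaise _ le_rfl h.lt
  rw [Function.update_eq_self] at h1
  refine h.not_canRaise ⟨?_, fun j' => ?_⟩
  · rw [hg]
    exact h1.1
  · rw [hg, hg]
    exact h1.2 j'

lemma Run.le_events {m : ℕ} (h : I.Run ρ m v) : m + I.n ≤ I.events v := by
  induction h with
  | init => simpa using Inst.le_events inRange_lowest
  | step hr hit ih =>
    obtain ⟨j, u, hu, rfl⟩ := (iteration_iff hr.inRange _).1 hit
    have := hu.events_lt hr.inRange
    omega

lemma Run.le_mul {m : ℕ} (h : I.Run ρ m v) : m ≤ I.n * I.k := by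
  have h1 := h.le_events
  have h2 := events_le v
  omega

/-! ### The invariant of the algorithm -/

/-- The second job is weakly affected by the first, or the first is affected by the second. -/
def Tied (I : Inst) (v : Fin I.n → ℝ) (m m' : ℕ) : Prop :=
  (m ≤ m' ∧ ∀ i, m < i → i ≤ m' → I.WLink v i) ∨ (m' < m ∧ ∀ i, m' < i → i ≤ m → I.Link v i)

/-- No job was sped up too much, compared with the jobs tied to it and with its affection. -/
structure Balanced (I : Inst) (v : Fin I.n → ℝ) : Prop where
  inRange : I.InRange v
  le_of_tied : ∀ m m' : Fin I.n, I.sp 1 < v m → I.fl (v m') < I.k → I.Tied v m m' →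
    I.del (I.low (v m)) + m ≤ I.del (I.fl (v m')) + m'
  le_wchainEnd : ∀ m : Fin I.n, I.sp 1 < v m → I.del (I.low (v m)) + m ≤ I.wchainEnd v m

lemma Tied.of_update (h0 : ∀ i, 0 < v i) (hu : v j ≤ u) {m m' : ℕ}
    (h : I.Tied (Function.update v j u) m m') : I.Tied v m m' :=
  h.imp (fun h => ⟨h.1, fun i h1 h2 => (h.2 i h1 h2).of_update h0 hu⟩)
    (fun h => ⟨h.1, fun i h1 h2 => (h.2 i h1 h2).of_update h0 hu⟩)

lemma balanced_lowest : I.Balanced I.lowest := by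
  have h1 : ∀ j, I.lowest j = I.sp 1 := by
    have := I.k_pos
    simp [lowest, sp, this]
  exact ⟨inRange_lowest, fun m _ h => absurd h (by rw [h1]; exact lt_irrefl _),
    fun m h => absurd h (by rw [h1]; exact lt_irrefl _)⟩

/-- At a speed slightly below `u` the gain of `j` is still active, hence nonnegative. By continuity
`e` is not linked there either, so the chain of `j` ends at `e` or earlier, and its length minus
`del (low u)` is the gain. -/
lemma Raises.del_low_le (hv : I.InRange v) (h : I.Raises ρ v j u) {e : ℕ} (hje : j < e)
    (he : ¬ I.WLink (Function.update v j u) e) : I.del (I.low u) + j ≤ e := by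
  have hu0 : 0 < u := (hv.pos j).trans h.lt
  have h1 : ∀ᶠ w in nhdsWithin u (Set.Iio u), ¬ I.Link (Function.update v j w) e := by
    by_cases hen : e < I.n
    · have hlt : I.done (Function.update v j u) e < I.rel e := not_le.1 fun hc => he ⟨hen, hc⟩
      have := Filter.Eventually.filter_mono (nhdsWithin_le_nhds (s := Set.Iio u))
        ((continuousAt_done_update v j hu0.ne' e).eventually (gt_mem_nhds hlt))
      filter_upwards [this] with w hw hc
      exact absurd hc.2 (not_lt.2 hw.le)
    · exact Filter.Eventually.of_forall fun w hw => hen hw.1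
  have h2 : ∀ᶠ w in nhdsWithin u (Set.Iio u), v j < w :=
    Filter.Eventually.filter_mono nhdsWithin_le_nhds (lt_mem_nhds h.lt)
  obtain ⟨w, ⟨⟨hw1, hw2⟩, hw3⟩, hw4⟩ := (((h1.and h2).and (eventually_fl_eq_low (I := I) hu0)).and
    self_mem_nhdsWithin).exists
  have hg := (h.canRaise w hw2.le hw4).1.nonneg
  rw [rgain, Function.update_self, hw3] at hg
  have h3 : I.chainEnd (Function.update v j w) j ≤ e := next_le hje hw1
  have h4 : ((I.chainEnd (Function.update v j w) j : ℕ) : ℝ) ≤ e := by exact_mod_cast h3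
  linarith

/-- For the raised job, the bounds come from its gain being maximum and nonnegative just below `u`.
For the other jobs ties only disappear and the right-hand sides of `le_of_tied` only grow; the
delicate case is a weak chain that is cut by the raise. -/
lemma Balanced.update (hv : I.Balanced v) (h : I.Raises ρ v j u) :
    I.Balanced (Function.update v j u) := by
  have hr := hv.inRange
  have h0 := hr.pos
  have hu0 : 0 < u := (h0 j).trans h.lt
  have hlowk : I.low u < I.k := low_lt hu0 h.le_top
  have hflj : I.fl (v j) ≤ I.low u := fl_le_low (h0 j).le h.lt
  have hdel : I.del (I.fl (v j)) ≤ I.del (I.low u) := del_mono (fl_pos (hr j).1) hflj hlowk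
  refine ⟨hr.update h.lt.le h.le_top, fun m m' hm hm' ht => ?_, fun m hm => ?_⟩
  · by_cases hmj : m = j
    · subst hmj
      rw [Function.update_self] at hm ⊢
      by_cases hm'j : m' = m
      · subst hm'j
        rw [Function.update_self] at hm' ⊢
        have := del_mono (low_pos hm) (low_le_fl (I := I) hu0) hm'
        linarith
      -- The gains are compared at a speed `w` just below `u`. Weak links behind `m` at the speed
      -- `u` are strict at `w`, so `m` and `m'` have the same chain end there; it cancels and leaves
      -- the comparison of `del` plus index.
      · rw [Function.update_of_ne hm'j] at hm' ⊢
        have h2 : ∀ᶠ w in nhdsWithin u (Set.Iio u), v m < w :=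
          Filter.Eventually.filter_mono nhdsWithin_le_nhds (lt_mem_nhds h.lt)
        obtain ⟨w, ⟨hw2, hw3⟩, hw4⟩ := ((h2.and (eventually_fl_eq_low (I := I) hu0)).and
          self_mem_nhdsWithin).exists
        have hw0 := (hr.update hw2.le (le_of_lt (hw4.trans_le h.le_top))).pos
        have hup : Function.update v m u = Function.update (Function.update v m w) m u := by
          rw [Function.update_idem]
        have hend : I.chainEnd (Function.update v m w) m = I.chainEnd (Function.update v m w) m' := by
          rcases ht with ⟨hle, ht⟩ | ⟨hlt, ht⟩
          · refine next_congr hle fun i hi hi' => ?_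
            rw [hup] at ht
            refine WLink.link_of_update hw0 (by simpa using hw4) hi fun i' h1 h2 => ?_
            exact ht i' h1 (h2.trans hi')
          · refine (next_congr hlt.le fun i hi hi' => ?_).symm
            rw [hup] at ht
            exact (ht i hi hi').of_update hw0 (by simpa using hw4.le)
        have hg := (h.canRaise w hw2.le hw4).2 m'
        rw [rgain, rgain, hend, Function.update_self, Function.update_of_ne hm'j, hw3] at hg
        linarith
    · rw [Function.update_of_ne hmj] at hm ⊢
      have hle := update_le_of h.lt.le m'
      have hfl : I.fl (v m') ≤ I.fl (Function.update v j u m') := fl_mono (h0 m').le hle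
      have h1 := hv.le_of_tied m m' hm (hfl.trans_lt hm') (ht.of_update h0 h.lt.le)
      have h2 := del_mono (fl_pos (hr m').1) hfl hm'
      linarith
  · set e := I.wchainEnd (Function.update v j u) m with he
    obtain ⟨hme, hne⟩ := next_mem m.isLt (not_wlink_n (v := Function.update v j u))
    change (m : ℕ) < e at hme
    change ¬ I.WLink (Function.update v j u) e at hne
    by_cases hmj : m = j
    · subst hmj
      rw [Function.update_self]
      exact h.del_low_le hr hme hne
    · rw [Function.update_of_ne hmj] at hm ⊢
      by_cases hle : I.wchainEnd v m ≤ e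
      · have h1 := hv.le_wchainEnd m hm
        have h2 : ((I.wchainEnd v m : ℕ) : ℝ) ≤ e := by exact_mod_cast hle
        linarith
      -- The raise has cut the weak chain of `m` at `e`, so `j` contributes to the completion time
      -- before `e` and is tied to `m`. The old bound for the pair `m`, `j` and the new bound of `j`
      -- by `e` are chained through `hdel`.
      · have hW : ∀ i, m.val < i → i ≤ e → I.WLink v i := fun i hi hi' =>
          of_lt_next hi (hi'.trans_lt (not_le.1 hle))
        have hWe := hW e hme le_rfl
        have hlt : I.done (Function.update v j u) e < I.rel e :=
          not_le.1 fun hc => hne ⟨hWe.1, hc⟩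
        obtain ⟨hje, hL⟩ := link_of_done_lt h0 h.lt.le hWe.1.le (hlt.trans_le hWe.2)
        have h1 := h.del_low_le hr hje hne
        have ht : I.Tied v m j := by
          rcases lt_or_gt_of_ne (fun hc => hmj (Fin.ext hc) : m.val ≠ j.val) with hlt | hlt
          · exact Or.inl ⟨hlt.le, fun i hi hi' => hW i hi (by omega)⟩
          · exact Or.inr ⟨hlt, fun i hi hi' => hL i hi (by omega)⟩
        have h2 := hv.le_of_tied m j hm (hflj.trans_lt hlowk) ht
        linarith

lemma Run.balanced {m : ℕ} (h : I.Run ρ m v) : I.Balanced v := by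
  induction h with
  | init => exact balanced_lowest
  | step _ hit ih =>
    obtain ⟨j, u, hu, rfl⟩ := (iteration_iff ih.inRange _).1 hit
    exact ih.update hu

end Inst

end SpeedScaling

end

noncomputable section

namespace SpeedScaling

namespace Inst

variable {I : Inst} {ρ : Rule} {v : Fin I.n → ℝ}

/-! ### Multipliers -/

/-- Multipliers that certify the optimality of the speeds `v`. -/
structure Certifies (I : Inst) (v : Fin I.n → ℝ) (c : ℕ → ℝ) : Prop where
  one_le : ∀ j : Fin I.n, 1 ≤ c j
  le_del : ∀ j : Fin I.n, c j ≤ I.del (I.fl (v j))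
  del_le : ∀ j : Fin I.n, I.sp 1 < v j → I.del (I.low (v j)) ≤ c j
  le_of_wlink : ∀ j : Fin I.n, I.WLink v (j + 1) → c j ≤ 1 + c (j + 1)
  ge_of_link : ∀ j : Fin I.n, I.Link v (j + 1) → 1 + c (j + 1) ≤ c j
  le_one : ∀ j : Fin I.n, ¬ I.WLink v (j + 1) → c j ≤ 1

lemma Tied.refl (m : ℕ) : I.Tied v m m := Or.inl ⟨le_rfl, fun _ h h' => absurd h' (not_le.2 h)⟩

/-- Together with `Tied.of_succ`: across a strict link both neighbours are tied to the same jobs,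
and across a weak link the later one is tied to no others than the earlier one. These inclusions
become the relations between consecutive multipliers. -/
lemma Tied.succ {m m' : ℕ} (hl : I.Link v (m + 1)) (h : I.Tied v m m') : I.Tied v (m + 1) m' := by
  rcases h with ⟨h1, h2⟩ | ⟨h1, h2⟩
  · rcases h1.eq_or_lt with rfl | h1
    · refine Or.inr ⟨Nat.lt_succ_self _, fun i hi hi' => ?_⟩
      obtain rfl : i = m + 1 := by omega
      exact hl
    · exact Or.inl ⟨h1, fun i hi hi' => h2 i (by omega) hi'⟩
  · refine Or.inr ⟨by omega, fun i hi hi' => ?_⟩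
    rcases hi'.eq_or_lt with rfl | hi'
    · exact hl
    · exact h2 i hi (by omega)

lemma Tied.of_succ {m m' : ℕ} (hl : I.WLink v (m + 1)) (h : I.Tied v (m + 1) m') :
    I.Tied v m m' := by
  rcases h with ⟨h1, h2⟩ | ⟨h1, h2⟩
  · refine Or.inl ⟨by omega, fun i hi hi' => ?_⟩
    rcases (Nat.succ_le_of_lt hi).eq_or_lt with rfl | hi
    · exact hl
    · exact h2 i (by omega) hi'
  · rcases (Nat.le_of_lt_succ h1).eq_or_lt with rfl | h1
    · exact Tied.refl _
    · exact Or.inr ⟨h1, fun i hi hi' => h2 i hi (by omega)⟩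

/-- `c j + j` is the minimum of the weak chain end and of `del` plus index over all jobs tied to
`j`, the largest value that respects these upper bounds. The lower bound by `del (low (v j))` is
`Balanced`, the lower bound 1 comes from halting, and links between neighbours relate the sets over
which minima are taken. -/
lemma Balanced.exists_certifies (hv : I.Balanced v) (hh : ∀ j, I.rgain v j ≤ 0) :
    ∃ c, I.Certifies v c := by
  classical
  set S : ℕ → Finset ℝ := fun j => insert (I.wchainEnd v j : ℝ)
    ((Finset.univ.filter fun m' : Fin I.n => I.Tied v j m').image
      fun m' => I.del (I.fl (v m')) + m') with hS
  set c : ℕ → ℝ := fun j => (S j).min' (Finset.insert_nonempty _ _) - j with hc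
  have hle_w : ∀ j, c j ≤ I.wchainEnd v j - j := fun j =>
    sub_le_sub_right (Finset.min'_le _ _ (Finset.mem_insert_self _ _)) _
  have hle_t : ∀ (j : ℕ) (m' : Fin I.n), I.Tied v j m' → c j ≤ I.del (I.fl (v m')) + m' - j :=
    fun j m' h => sub_le_sub_right (Finset.min'_le _ _ (Finset.mem_insert_of_mem
      (Finset.mem_image.2 ⟨m', Finset.mem_filter.2 ⟨Finset.mem_univ _, h⟩, rfl⟩))) _
  have hge : ∀ (j : ℕ) (a : ℝ), a + j ≤ I.wchainEnd v j →
      (∀ m' : Fin I.n, I.Tied v j m' → a + j ≤ I.del (I.fl (v m')) + m') → a ≤ c j := by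
    intro j a h1 h2
    refine le_sub_iff_add_le.2 (Finset.le_min' _ _ _ fun b hb => ?_)
    rcases Finset.mem_insert.1 hb with rfl | hb
    · exact h1
    · obtain ⟨m', hm', rfl⟩ := Finset.mem_image.1 hb
      exact h2 m' (Finset.mem_filter.1 hm').2
  have hw : ∀ j : ℕ, I.WLink v (j + 1) → I.wchainEnd v j = I.wchainEnd v (j + 1) := fun j h =>
    next_congr (Nat.le_succ j) fun i hi hi' => by
      obtain rfl : i = j + 1 := by omega
      exact h
  refine ⟨c, fun j => ?_, fun j => ?_, fun j hj => ?_, fun j hj => ?_, fun j hj => ?_,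
    fun j hj => ?_⟩
  -- The chain of a tied job `m'` reaches beyond `j`. Since the gain of `m'` is at most 0, its `del`
  -- plus index is at least its chain end, hence at least `j + 1`.
  · refine hge j 1 ?_ fun m' hm' => ?_
    · have := lt_wchainEnd (v := v) j.isLt
      have : ((j.val + 1 : ℕ) : ℝ) ≤ I.wchainEnd v j := by exact_mod_cast this
      push_cast at this
      linarith
    · have h1 := hh m'
      rw [rgain] at h1
      have h2 : (j : ℕ) + 1 ≤ I.chainEnd v m' := by
        rcases hm' with ⟨h, -⟩ | ⟨h, h'⟩
        · exact (Nat.succ_le_succ h).trans (lt_chainEnd m'.isLt)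
        · have : I.chainEnd v m' = I.chainEnd v j := next_congr h.le h'
          rw [this]
          exact lt_chainEnd j.isLt
      have h3 : (((j : ℕ) + 1 : ℕ) : ℝ) ≤ I.chainEnd v m' := by exact_mod_cast h2
      push_cast at h3
      linarith
  · have := hle_t j j (Tied.refl _)
    linarith
  · refine hge j _ (hv.le_wchainEnd j hj) fun m' hm' => ?_
    by_cases hk : I.fl (v m') < I.k
    · exact hv.le_of_tied j m' hj hk hm'
    -- `Balanced` does not cover a job `m'` at the highest speed, but there the value `n + 1`
    -- exceeds every chain end.
    · rw [del_top (not_lt.1 hk)]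
      have h1 := hv.le_wchainEnd j hj
      have h2 : ((I.wchainEnd v j : ℕ) : ℝ) ≤ I.n := by exact_mod_cast wchainEnd_le j.isLt
      have h3 : (0 : ℝ) ≤ (m' : ℕ) := by positivity
      linarith
  · have := hge ((j : ℕ) + 1) (c j - 1) ?_ fun m' hm' => ?_
    · linarith
    · rw [← hw j hj]
      have := hle_w j
      push_cast
      linarith
    · have := hle_t j m' (hm'.of_succ hj)
      push_cast
      linarith
  · refine hge j _ ?_ fun m' hm' => ?_
    · have := hle_w (j + 1)
      rw [hw j hj.wlink]
      push_cast at this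
      linarith
    · have := hle_t (j + 1) m' (hm'.succ hj)
      push_cast at this
      linarith
  · have h1 : I.wchainEnd v j ≤ j + 1 := next_le (Nat.lt_succ_self _) hj
    have h2 : ((I.wchainEnd v j : ℕ) : ℝ) ≤ ((j + 1 : ℕ) : ℝ) := by exact_mod_cast h1
    push_cast at h2
    have := hle_w j
    linarith

/-- Weak duality for the completion times `F` and processing times `y` of the jobs in order. -/
lemma Certifies.sum_le {c : ℕ → ℝ} (hc : I.Certifies v c) {F y : ℕ → ℝ} (hF0 : F 0 = 0)
    (hF : ∀ m < I.n, max (I.rel m) (F m) + y m ≤ F (m + 1)) :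
    ∑ j : Fin I.n, (I.done v (j + 1) - c j * (1 / v j)) ≤
      ∑ j : Fin I.n, (F (j + 1) - c j * y j) := by
  set x : ℕ → ℝ := fun m => if h : m < I.n then 1 / v ⟨m, h⟩ else 0 with hx
  have hd : ∀ m < I.n, I.done v (m + 1) = max (I.rel m) (I.done v m) + x m := by
    intro m hm
    have := done_succ v ⟨m, hm⟩
    rw [← rel_val] at this
    simpa [hx, hm] using this
  -- The left side is the part of the last summand that is not yet accounted for. It is passed on to
  -- the next job, where it is offset by the difference of the start times.
  have key : ∀ M, M + 1 ≤ I.n → (1 - c M) * (F (M + 1) - I.done v (M + 1)) ≤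
      ∑ m ∈ Finset.range (M + 1), ((F (m + 1) - c m * y m) - (I.done v (m + 1) - c m * x m)) := by
    intro M hM
    have h1 := hc.one_le ⟨M, hM⟩
    simp only at h1
    have hterm : (1 - c M) * (F (M + 1) - I.done v (M + 1)) +
        c M * (max (I.rel M) (F M) - max (I.rel M) (I.done v M)) ≤
        (F (M + 1) - c M * y M) - (I.done v (M + 1) - c M * x M) := by
      have := mul_le_mul_of_nonneg_left (hF M hM) (by linarith : 0 ≤ c M)
      rw [hd M hM]
      linarith
    induction M with
    | zero =>
      rw [hF0] at hterm
      simp only [done, sub_self, mul_zero, add_zero] at hterm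
      simpa [done] using hterm
    | succ M ih =>
      have h0 := hc.one_le ⟨M, by omega⟩
      simp only at h0
      have ih' := ih (by omega) h0 (by
        have := mul_le_mul_of_nonneg_left (hF M (by omega)) (by linarith : 0 ≤ c M)
        rw [hd M (by omega)]
        linarith)
      rw [Finset.sum_range_succ]
      -- With a strict link, `c M = 1 + c (M + 1)` leaves a multiple of `max r F - F`. With a tight
      -- link, the sign of `F - r` decides which of the two bounds for `c M` is used. Without a weak
      -- link, `c M = 1`.
      have hstep : 0 ≤ (1 - c M) * (F (M + 1) - I.done v (M + 1)) +
          c (M + 1) * (max (I.rel (M + 1)) (F (M + 1)) -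
            max (I.rel (M + 1)) (I.done v (M + 1))) := by
        have hmr := le_max_right (I.rel (M + 1)) (F (M + 1))
        have hml := le_max_left (I.rel (M + 1)) (F (M + 1))
        by_cases hw : I.WLink v (M + 1)
        · have e1 := hc.le_of_wlink ⟨M, by omega⟩ hw
          simp only at e1
          rw [max_eq_right hw.2]
          by_cases hl : I.Link v (M + 1)
          · have e2 := hc.ge_of_link ⟨M, by omega⟩ hl
            simp only at e2
            have e3 : c M = 1 + c (M + 1) := le_antisymm e1 e2
            rw [e3]
            have := mul_nonneg (by linarith : 0 ≤ c (M + 1)) (sub_nonneg.2 hmr)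
            linarith
          · have e3 : I.rel (M + 1) = I.done v (M + 1) :=
              le_antisymm hw.2 (not_lt.1 fun h => hl ⟨hw.1, h⟩)
            rw [← e3]
            rcases le_total (I.rel (M + 1)) (F (M + 1)) with h | h
            · rw [max_eq_right h]
              nlinarith
            · rw [max_eq_left h]
              nlinarith
        · have e1 := hc.le_one ⟨M, by omega⟩ hw
          simp only at e1
          have e2 : c M = 1 := le_antisymm e1 h0
          have e3 : I.done v (M + 1) ≤ I.rel (M + 1) :=
            (not_le.1 fun h => hw ⟨hM, h⟩).le
          rw [e2, max_eq_left e3]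
          have := mul_nonneg (by linarith : 0 ≤ c (M + 1)) (sub_nonneg.2 hml)
          linarith
      linarith
  have e1 : ∑ j : Fin I.n, (I.done v (j + 1) - c j * (1 / v j)) =
      ∑ m ∈ Finset.range I.n, (I.done v (m + 1) - c m * x m) := by
    rw [Finset.sum_range]
    exact Finset.sum_congr rfl fun j _ => by simp [hx]
  rw [e1, ← Finset.sum_range (fun m => F (m + 1) - c m * y m), ← sub_nonneg,
    ← Finset.sum_sub_distrib]
  rcases Nat.eq_zero_or_pos I.n with hn | hn
  · simp [hn]
  · obtain ⟨M, hM⟩ : ∃ M, I.n = M + 1 := ⟨I.n - 1, by omega⟩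
    have h1 := key M hM.ge
    -- There is no weak link behind the last job, so its multiplier is 1 and the remainder vanishes.
    have h2 : c M = 1 := by
      refine le_antisymm (hc.le_one ⟨M, by omega⟩ fun h => ?_) (hc.one_le ⟨M, by omega⟩)
      have := h.1
      simp only at this
      omega
    rw [h2] at h1
    rw [hM]
    linarith

/-- The price of volume for job `j`, if time costs `c`. -/
lemma Certifies.price_le {c : ℕ → ℝ} (hc : I.Certifies v c) (hv : I.InRange v) (j : Fin I.n)
    (i : Fin (I.k + 1)) (hi : 0 < i) :
    (I.P (I.floorLevel (v j)) + c j) / I.s (I.floorLevel (v j)) * I.s i ≤ I.P i + c j := by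
  have h := price_fl_le (hv j).1 (hv j).2 (hc.del_le j) (fun _ => hc.le_del j)
    (i := i) (Fin.lt_def.1 hi) (Nat.lt_succ_iff.1 i.isLt)
  rw [fl, sp_val, pw_val, sp_val, pw_val, le_div_iff₀] at h
  · exact h
  · rw [← sp_val]
    exact sp_pos (Fin.lt_def.1 hi) (Nat.lt_succ_iff.1 i.isLt)

/-- This is complementary slackness: equality in the price bound at both levels in use. If the speed
lies strictly between two given speeds, then `low` and `fl` agree, which forces `c j = del (fl (v
j))`, the time price at which the two levels cost the same. -/
lemma Certifies.price_eq {c : ℕ → ℝ} (hc : I.Certifies v c) (hv : I.InRange v) (j : Fin I.n) :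
    I.P (I.floorLevel (v j)) * I.slowTime (v j) +
        I.P (I.ceilLevel (v j)) * (1 / v j - I.slowTime (v j)) =
      (I.P (I.floorLevel (v j)) + c j) / I.s (I.floorLevel (v j)) - c j * (1 / v j) := by
  have hvol := slowTime_volume (hv j).1 (hv j).2
  have hf : 0 < I.s (I.floorLevel (v j)) := by
    rw [← sp_val]
    exact sp_pos (fl_pos (hv j).1) (fl_le _)
  have hceil : (I.P (I.floorLevel (v j)) + c j) / I.s (I.floorLevel (v j)) *
      I.s (I.ceilLevel (v j)) = I.P (I.ceilLevel (v j)) + c j := by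
    rcases (floorLevel_le_ceilLevel (hv.pos j).le (hv j).2).eq_or_lt with h | h
    · rw [← h]
      field_simp
    · have hlt : I.s (I.floorLevel (v j)) < v j := by
        refine lt_of_le_of_ne ((le_floorLevel_iff (hv.pos j).le _).1 le_rfl) fun hc => ?_
        exact absurd ((ceilLevel_le_iff (hv j).2 _).2 hc.ge) (not_le.2 h)
      have hk : I.fl (v j) < I.k := by
        have h1 := (I.ceilLevel (v j)).isLt
        have h2 := Fin.lt_def.1 h
        unfold fl
        omega
      have hlow : I.low (v j) = I.fl (v j) :=
        le_antisymm (low_le_fl (hv.pos j))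
          ((le_low_iff (hv.pos j) (fl_le _)).2 (by rw [fl, sp_val]; exact hlt))
      have hsp1 : I.sp 1 < v j := by
        refine lt_of_le_of_lt (sp_le (fl_pos (hv j).1) (fl_le _)) ?_
        rw [fl, sp_val]
        exact hlt
      have hcj : c j = I.del (I.fl (v j)) :=
        le_antisymm (hc.le_del j) (hlow ▸ hc.del_le j hsp1)
      have hceq : (I.ceilLevel (v j)).val = I.fl (v j) + 1 := by
        refine le_antisymm ?_ (Nat.succ_le_of_lt h)
        have := (ceilLevel_le_iff (hv j).2 ⟨I.fl (v j) + 1, by omega⟩).2 (by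
          rw [← sp_val]
          exact (lt_sp_fl_succ (hv.pos j).le hk).le)
        exact this
      have e1 := price_succ_le (fl_pos (hv j).1) hk hcj.ge
      have e2 := price_le_succ (fl_pos (hv j).1) hk hcj.le
      have e3 := le_antisymm e2 e1
      rw [← hceq, fl, sp_val, pw_val, sp_val, pw_val] at e3
      have : 0 < I.s (I.ceilLevel (v j)) := hf.trans (I.s_strictMono h)
      rw [e3]
      field_simp
  have hfl : (I.P (I.floorLevel (v j)) + c j) / I.s (I.floorLevel (v j)) *
      I.s (I.floorLevel (v j)) = I.P (I.floorLevel (v j)) + c j := by field_simp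
  generalize (I.P (I.floorLevel (v j)) + c j) / I.s (I.floorLevel (v j)) = a at *
  have h1 : I.P (I.floorLevel (v j)) = a * I.s (I.floorLevel (v j)) - c j := by linarith
  have h2 : I.P (I.ceilLevel (v j)) = a * I.s (I.ceilLevel (v j)) - c j := by linarith
  rw [h1, h2]
  linear_combination a * hvol

end Inst

end SpeedScaling

end

noncomputable section

namespace SpeedScaling

namespace Schedule

variable {I : Inst} {σ : Schedule I}

/-! ### A lower bound for all feasible schedules -/

/-- The times at which some job is processed. -/
def W (σ : Schedule I) : Set ℝ := ⋃ j, σ.X j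

/-- The volume that is processed up to time `t`. -/
def V (σ : Schedule I) (t : ℝ) : ℝ := ∫ τ in σ.W ∩ Set.Iic t, I.s (σ.S τ)

lemma W_subset : σ.W ⊆ Set.Ici 0 := Set.iUnion_subset fun j => X_subset_Ici j

lemma disjoint_X : Pairwise fun i j : Fin I.n => Disjoint (σ.X i) (σ.X j) := fun _ _ hij =>
  Set.disjoint_left.2 fun _ hi hj => hij (Option.some.inj (hi.2.1.symm.trans hj.2.1))

lemma S_pos_of_mem_W {t : ℝ} (h : t ∈ σ.W) : 0 < σ.S t := by
  obtain ⟨j, hj⟩ := Set.mem_iUnion.1 h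
  exact hj.2.2

lemma speed_nonneg (t : ℝ) : 0 ≤ I.s (σ.S t) := by
  rw [← I.s_zero]
  exact I.s_strictMono.monotone (Fin.zero_le _)

namespace Feasible

lemma measurableSet_W (hσ : σ.Feasible) : MeasurableSet σ.W := MeasurableSet.iUnion hσ.measurableSet_X

lemma exists_bound (hσ : σ.Feasible) : ∃ T, 0 ≤ T ∧ σ.W ⊆ Set.Icc 0 T := by
  have h : BddAbove σ.W := by
    have := (Set.finite_univ (α := Fin I.n)).bddAbove_biUnion (S := σ.X)
    rw [Set.biUnion_univ] at this
    exact this.2 fun j _ => hσ.completed j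
  obtain ⟨T, hT⟩ := h
  exact ⟨max 0 T, le_max_left _ _, fun t ht => ⟨W_subset ht, (hT ht).trans (le_max_right _ _)⟩⟩

lemma volume_ne_top (hσ : σ.Feasible) {A : Set ℝ} (hA : A ⊆ σ.W) : volume A ≠ ⊤ := by
  obtain ⟨T, -, hT⟩ := hσ.exists_bound
  refine ((measure_mono (hA.trans hT)).trans_lt ?_).ne
  simp [Real.volume_Icc]

lemma integrableOn_of_subset (hσ : σ.Feasible) (f : Fin (I.k + 1) → ℝ) {A : Set ℝ} (hA : MeasurableSet A)
    (h : A ⊆ σ.W) : IntegrableOn (fun t => f (σ.S t)) A :=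
  hσ.integrableOn_comp f hA (h.trans W_subset) (hσ.volume_ne_top h)

lemma setIntegral_W_inter (hσ : σ.Feasible) (f : Fin (I.k + 1) → ℝ) {A : Set ℝ} (hA : MeasurableSet A) :
    ∫ t in σ.W ∩ A, f (σ.S t) = ∑ j, ∫ t in σ.X j ∩ A, f (σ.S t) := by
  rw [W, Set.iUnion_inter]
  refine integral_iUnion_fintype (fun j => (hσ.measurableSet_X j).inter hA)
    (fun i j hij => ?_) fun j => ?_
  · exact (disjoint_X hij).mono Set.inter_subset_left Set.inter_subset_left
  · exact hσ.integrableOn_of_subset f ((hσ.measurableSet_X j).inter hA)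
      (Set.inter_subset_left.trans (Set.subset_iUnion σ.X j))

lemma setIntegral_W_Ioc (hσ : σ.Feasible) (f : Fin (I.k + 1) → ℝ) {a b c : ℝ} (hab : a ≤ b) (hbc : b ≤ c) :
    ∫ t in σ.W ∩ Set.Ioc a c, f (σ.S t) =
      (∫ t in σ.W ∩ Set.Ioc a b, f (σ.S t)) + ∫ t in σ.W ∩ Set.Ioc b c, f (σ.S t) := by
  rw [← Set.Ioc_union_Ioc_eq_Ioc hab hbc, Set.inter_union_distrib_left]
  refine setIntegral_union ?_ (hσ.measurableSet_W.inter measurableSet_Ioc)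
    (hσ.integrableOn_of_subset f (hσ.measurableSet_W.inter measurableSet_Ioc)
      Set.inter_subset_left)
    (hσ.integrableOn_of_subset f (hσ.measurableSet_W.inter measurableSet_Ioc)
      Set.inter_subset_left)
  exact Set.disjoint_left.2 fun t h1 h2 => absurd h1.2.2 (not_le.2 h2.2.1)

lemma V_sub (hσ : σ.Feasible) {a b : ℝ} (hab : a ≤ b) :
    σ.V b - σ.V a = ∫ t in σ.W ∩ Set.Ioc a b, I.s (σ.S t) := by
  rw [sub_eq_iff_eq_add', V, V, ← Set.Iic_union_Ioc_eq_Iic hab, Set.inter_union_distrib_left]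
  refine setIntegral_union ?_ (hσ.measurableSet_W.inter measurableSet_Ioc)
    (hσ.integrableOn_of_subset _ (hσ.measurableSet_W.inter measurableSet_Iic)
      Set.inter_subset_left)
    (hσ.integrableOn_of_subset _ (hσ.measurableSet_W.inter measurableSet_Ioc)
      Set.inter_subset_left)
  exact Set.disjoint_left.2 fun t h1 h2 => absurd h1.2 (not_le.2 h2.2.1)

lemma V_mono (hσ : σ.Feasible) : Monotone σ.V := fun a b hab => by
  rw [← sub_nonneg, hσ.V_sub hab]
  exact integral_nonneg fun t => speed_nonneg t

lemma V_continuous (hσ : σ.Feasible) : Continuous σ.V := by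
  refine (LipschitzWith.of_le_add_mul' (I.sp I.k) fun a b => ?_).continuous
  rcases le_total a b with h | h
  · have := hσ.V_mono h
    have h2 := mul_nonneg (Inst.sp_pos (I := I) I.k_pos le_rfl).le (dist_nonneg (x := a) (y := b))
    linarith
  · have h1 := hσ.V_sub h
    have hm := hσ.measurableSet_W.inter (measurableSet_Ioc (a := b) (b := a))
    have h2 : ∫ t in σ.W ∩ Set.Ioc b a, I.s (σ.S t) ≤
        ∫ _t in σ.W ∩ Set.Ioc b a, I.sp I.k := by
      refine setIntegral_mono_on (hσ.integrableOn_of_subset _ hm Set.inter_subset_left)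
        (integrableOn_const (hσ.volume_ne_top Set.inter_subset_left)) hm fun t _ => ?_
      rw [← Inst.sp_val]
      exact Inst.sp_le (Nat.lt_succ_iff.1 (σ.S t).isLt) le_rfl
    rw [setIntegral_const, smul_eq_mul] at h2
    have h3 : volume.real (σ.W ∩ Set.Ioc b a) ≤ a - b := by
      rw [← Real.volume_real_Ioc_of_le h]
      exact measureReal_mono Set.inter_subset_right (by simp)
    have h4 := mul_le_mul_of_nonneg_right h3 (Inst.sp_pos (I := I) I.k_pos le_rfl).le
    rw [Real.dist_eq, abs_of_nonneg (sub_nonneg.2 h)]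
    linarith

lemma V_zero : σ.V 0 = 0 := by
  refine setIntegral_measure_zero _ (measure_mono_null (t := {0}) ?_ (by simp))
  exact fun t ht => le_antisymm ht.2 (W_subset ht.1)

/-- The processed volume of the jobs that are completed by time `t`. -/
lemma card_le_V (hσ : σ.Feasible) (A : Finset (Fin I.n)) {t : ℝ} (h : ∀ j ∈ A, σ.C j ≤ t) : (A.card : ℝ) ≤ σ.V t := by
  rw [V, hσ.setIntegral_W_inter I.s measurableSet_Iic]
  calc (A.card : ℝ) = ∑ _j ∈ A, (1 : ℝ) := by simp
    _ = ∑ j ∈ A, ∫ τ in σ.X j ∩ Set.Iic t, I.s (σ.S τ) := by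
      refine Finset.sum_congr rfl fun j hj => ?_
      rw [← hσ.processed j, Set.inter_eq_left.2]
      exact fun τ hτ => (le_csSup (hσ.completed j) hτ).trans (h j hj)
    _ ≤ _ := Finset.sum_le_sum_of_subset_of_nonneg (Finset.subset_univ _)
      fun j _ _ => integral_nonneg fun τ => speed_nonneg τ

/-- Before the release of job `m`, only the volume of its predecessors can be processed. -/
lemma V_rel_le (hσ : σ.Feasible) (m : Fin I.n) : σ.V (I.r m) ≤ m := by
  rw [V, hσ.setIntegral_W_inter I.s measurableSet_Iic]
  have h : ∀ j : Fin I.n, ∫ τ in σ.X j ∩ Set.Iic (I.r m), I.s (σ.S τ) ≤ if j < m then 1 else 0 := by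
    intro j
    split_ifs with hj
    · rw [← hσ.processed j]
      exact setIntegral_mono_set (hσ.integrableOn_of_subset I.s (hσ.measurableSet_X j)
        (Set.subset_iUnion σ.X j)) (Filter.Eventually.of_forall fun τ => speed_nonneg τ)
        Set.inter_subset_left.eventuallyLE
    · refine (setIntegral_measure_zero _ (measure_mono_null (t := {I.r m}) ?_ (by simp))).le
      intro τ hτ
      have h1 := hσ.released j τ hτ.1.1 hτ.1.2.1
      exact le_antisymm hτ.2 ((I.r_mono (not_lt.1 hj)).trans h1)
  refine (Finset.sum_le_sum fun j _ => h j).trans ?_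
  rw [Finset.sum_ite, Finset.sum_const_zero, add_zero, Finset.sum_const, nsmul_eq_mul, mul_one]
  have : (Finset.univ.filter fun j : Fin I.n => j < m) = Finset.Iio m := by
    ext j
    simp
  rw [this, Fin.card_Iio]

lemma C_nonneg (j : Fin I.n) : 0 ≤ σ.C j := Real.sSup_nonneg fun _ ht => ht.1

/-- If the volume of a feasible schedule is assigned to the jobs in order, then they have
completion times `F` and processing times `y` that are not worse. -/
lemma exists_fifo (hσ : σ.Feasible) : ∃ F y : ℕ → ℝ, F 0 = 0 ∧
    (∀ m < I.n, max (I.rel m) (F m) + y m ≤ F (m + 1)) ∧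
    ∑ j : Fin I.n, F (j + 1) ≤ ∑ j, σ.C j ∧
    ∀ a c : ℕ → ℝ, (∀ m < I.n, ∀ i : Fin (I.k + 1), 0 < i → a m * I.s i ≤ I.P i + c m) →
      ENNReal.ofReal (∑ j : Fin I.n, (a j - c j * y j)) ≤ σ.energy := by
  -- `F m` is the first time at which the total processed volume, of whatever jobs, reaches `m`. The
  -- volume processed between `F m` and `F (m + 1)` is assigned to the job with index `m`.
  -- Continuity of `V` makes the infimum attained, with volume exactly `m`.
  set A : ℕ → Set ℝ := fun m => {t | 0 ≤ t ∧ (m : ℝ) ≤ σ.V t} with hA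
  set F : ℕ → ℝ := fun m => sInf (A m) with hF
  have hbdd : ∀ m, BddBelow (A m) := fun m => ⟨0, fun t ht => ht.1⟩
  have hne : ∀ m ≤ I.n, (A m).Nonempty := by
    intro m hm
    obtain ⟨T, hT0, hT⟩ := hσ.exists_bound
    refine ⟨T, hT0, ?_⟩
    have := hσ.card_le_V Finset.univ (t := T) fun j _ =>
      Real.sSup_le (fun t ht => (hT (Set.mem_iUnion.2 ⟨j, ht⟩)).2) hT0
    rw [Finset.card_univ, Fintype.card_fin] at this
    exact (Nat.cast_le.2 hm).trans this
  have hmem : ∀ m ≤ I.n, F m ∈ A m := fun m hm =>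
    (isClosed_Ici.inter (isClosed_Ici.preimage hσ.V_continuous)).csInf_mem (hne m hm) (hbdd m)
  have hVF : ∀ m ≤ I.n, σ.V (F m) = m := by
    intro m hm
    refine le_antisymm (not_lt.1 fun hc => ?_) (hmem m hm).2
    obtain ⟨t, ht, hVt⟩ := intermediate_value_Icc (hmem m hm).1 hσ.V_continuous.continuousOn
      (show (m : ℝ) ∈ Set.Icc (σ.V 0) (σ.V (F m)) from
        ⟨by rw [V_zero]; positivity, hc.le⟩)
    have h1 : F m ≤ t := csInf_le (hbdd m) ⟨ht.1, hVt.ge⟩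
    have h2 : t = F m := le_antisymm ht.2 h1
    rw [h2] at hVt
    exact hc.ne' hVt
  have hF0 : F 0 = 0 := by
    refine le_antisymm (csInf_le (hbdd 0) ⟨le_rfl, ?_⟩) (hmem 0 (Nat.zero_le _)).1
    rw [V_zero]
    simp
  have hmono : ∀ m < I.n, F m ≤ F (m + 1) := fun m hm =>
    csInf_le_csInf (hbdd m) (hne (m + 1) hm) fun t ht =>
      ⟨ht.1, le_trans (by push_cast; linarith) ht.2⟩
  set K : ℕ → Set ℝ := fun m => σ.W ∩ Set.Ioc (F m) (F (m + 1)) with hK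
  have hKm : ∀ m, MeasurableSet (K m) := fun m => hσ.measurableSet_W.inter measurableSet_Ioc
  refine ⟨F, fun m => volume.real (K m), hF0, fun m hm => ?_, ?_, fun a c hac => ?_⟩
  · set b := max (I.rel m) (F m) with hb
    have hVb : σ.V b ≤ m := by
      rcases max_choice (I.rel m) (F m) with h | h
      · rw [hb, h]
        have := hσ.V_rel_le ⟨m, hm⟩
        rwa [← Inst.rel_val] at this
      · rw [hb, h, hVF m hm.le]
    have hbF : b ≤ F (m + 1) := by
      by_contra hc
      have h1 := hσ.V_mono (not_le.1 hc).le
      rw [hVF (m + 1) hm] at h1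
      push_cast at h1
      linarith
    have hFb : F m ≤ b := le_max_right _ _
    -- The volume is `m` at `F m` and still at most `m` at `b`. As processing has at least the speed
    -- `sp 1`, it can take place between them only on a null set.
    have hnull : volume.real (σ.W ∩ Set.Ioc (F m) b) ≤ 0 := by
      have hms := hσ.measurableSet_W.inter (measurableSet_Ioc (a := F m) (b := b))
      have h1 : ∫ _t in σ.W ∩ Set.Ioc (F m) b, I.sp 1 ≤
          ∫ t in σ.W ∩ Set.Ioc (F m) b, I.s (σ.S t) := by
        refine setIntegral_mono_on (integrableOn_const (hσ.volume_ne_top Set.inter_subset_left))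
          (hσ.integrableOn_of_subset _ hms Set.inter_subset_left) hms fun t ht => ?_
        rw [← Inst.sp_val]
        exact Inst.sp_le (Fin.lt_def.1 (S_pos_of_mem_W ht.1)) (Nat.lt_succ_iff.1 (σ.S t).isLt)
      rw [← hσ.V_sub hFb, setIntegral_const, smul_eq_mul, hVF m hm.le] at h1
      have h2 := Inst.sp_pos (I := I) one_pos I.k_pos
      by_contra hc
      have := mul_pos (not_le.1 hc) h2
      linarith
    have hsub : K m ⊆ (σ.W ∩ Set.Ioc (F m) b) ∪ Set.Ioc b (F (m + 1)) := by
      rintro t ⟨h1, h2⟩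
      rcases le_or_gt t b with h | h
      · exact Or.inl ⟨h1, h2.1, h⟩
      · exact Or.inr ⟨h, h2.2⟩
    have h3 : volume.real (K m) ≤
        volume.real (σ.W ∩ Set.Ioc (F m) b) + volume.real (Set.Ioc b (F (m + 1))) := by
      refine (measureReal_mono hsub ?_).trans (measureReal_union_le _ _)
      exact measure_union_ne_top (hσ.volume_ne_top Set.inter_subset_left) (by simp)
    rw [Real.volume_real_Ioc_of_le hbF] at h3
    linarith
  -- Once the `m + 1` earliest completions have happened, the volume is at least `m + 1`. So `F (m +
  -- 1)` is at most the completion time in this position of the sorted order.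
  · rw [← Equiv.sum_comp (Tuple.sort σ.C) σ.C]
    refine Finset.sum_le_sum fun m _ => csInf_le (hbdd _) ⟨C_nonneg _, ?_⟩
    have := hσ.card_le_V ((Finset.Iic m).map (Tuple.sort σ.C).toEmbedding)
      (t := σ.C (Tuple.sort σ.C m)) fun j hj => by
        obtain ⟨i, hi, rfl⟩ := Finset.mem_map.1 hj
        exact Tuple.monotone_sort σ.C (Finset.mem_Iic.1 hi)
    rw [Finset.card_map, Fin.card_Iic] at this
    exact this
  -- On each unit piece the bound `a m * s - c m ≤ P` is integrated: the speed integrates to 1, the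
  -- constant to the length of the piece.
  · have key : ∀ M ≤ I.n, F 0 ≤ F M ∧ ∑ m ∈ Finset.range M, (a m - c m * volume.real (K m)) ≤
        ∫ t in σ.W ∩ Set.Ioc (F 0) (F M), I.P (σ.S t) := by
      intro M hM
      induction M with
      | zero => simp
      | succ M ih =>
        obtain ⟨h1, h2⟩ := ih (by omega)
        refine ⟨h1.trans (hmono M hM), ?_⟩
        rw [Finset.sum_range_succ, hσ.setIntegral_W_Ioc I.P h1 (hmono M hM)]
        refine add_le_add h2 ?_
        have hs : ∫ t in K M, I.s (σ.S t) = 1 := by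
          rw [← hσ.V_sub (hmono M hM), hVF (M + 1) hM, hVF M (by omega)]
          push_cast
          ring
        have hi := hσ.integrableOn_of_subset I.s (hKm M) Set.inter_subset_left
        have hconst : IntegrableOn (fun _ : ℝ => c M) (K M) :=
          integrableOn_const (hσ.volume_ne_top Set.inter_subset_left)
        have e : a M - c M * volume.real (K M) = ∫ t in K M, (a M * I.s (σ.S t) - c M) := by
          rw [integral_sub (hi.const_mul _) hconst, integral_const_mul, hs, setIntegral_const,
            smul_eq_mul]
          ring
        rw [e]
        refine setIntegral_mono_on ((hi.const_mul _).sub hconst)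
          (hσ.integrableOn_of_subset I.P (hKm M) Set.inter_subset_left) (hKm M) fun t ht => ?_
        have := hac M hM (σ.S t) (S_pos_of_mem_W ht.1)
        linarith
    have h1 := (key I.n le_rfl).2
    rw [Finset.sum_range] at h1
    refine (ENNReal.ofReal_le_ofReal h1).trans ?_
    rw [ofReal_integral_eq_lintegral_ofReal
      (hσ.integrableOn_of_subset I.P (hσ.measurableSet_W.inter measurableSet_Ioc)
        Set.inter_subset_left) (Filter.Eventually.of_forall fun t => Inst.pw_nonneg _)]
    exact lintegral_mono_set (Set.inter_subset_left.trans W_subset)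

end Feasible

end Schedule

/-! ### Optimality of speeds with certifying multipliers, and of the final speeds -/

namespace Inst

variable {I : Inst} {ρ : Rule} {v : Fin I.n → ℝ}

/-- Outside the processing intervals the schedule idles at level 0, where the power is 0. -/
lemma fifo_energy (hv : I.InRange v) : (I.fifo v).energy =
    ENNReal.ofReal (∑ j, (I.P (I.floorLevel (v j)) * I.slowTime (v j) +
        I.P (I.ceilLevel (v j)) * (1 / v j - I.slowTime (v j)))) := by
  have hσ := fifo_feasible hv
  have h1 := hσ.setIntegral_W_inter I.P MeasurableSet.univ
  simp only [Set.inter_univ, fifo_setIntegral hv] at h1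
  rw [← h1, ofReal_integral_eq_lintegral_ofReal
    (hσ.integrableOn_of_subset I.P hσ.measurableSet_W le_rfl)
    (Filter.Eventually.of_forall fun t => Inst.pw_nonneg _), Schedule.energy]
  rw [← lintegral_inter_add_sdiff _ (Set.Ici 0) hσ.measurableSet_W,
    Set.inter_eq_right.2 Schedule.W_subset]
  refine (congrArg _ (setLIntegral_eq_zero (measurableSet_Ici.diff hσ.measurableSet_W)
    fun t ht => ?_)).trans (add_zero _)
  have : I.fifoJob v t = none := by
    rw [Option.eq_none_iff_forall_ne_some]
    intro j hj
    refine ht.2 (Set.mem_iUnion.2 ⟨j, ?_⟩)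
    rw [fifo_X hv]
    exact (fifoJob_eq_some_iff hv.pos t j).1 hj
  simp only [fifo_S_of_none this, I.P_zero, ENNReal.ofReal_zero, Pi.zero_apply]

/-- Speeds with certifying multipliers give an optimal schedule. -/
lemma Certifies.optimal {c : ℕ → ℝ} (hc : I.Certifies v c) (hv : I.InRange v) :
    (I.fifo v).Optimal := by
  refine ⟨fifo_feasible hv, fun σ' hσ' => ?_⟩
  obtain ⟨F, y, hF0, hF, hC, hE⟩ := hσ'.exists_fifo
  set a : ℕ → ℝ := fun m => if h : m < I.n then
    (I.P (I.floorLevel (v ⟨m, h⟩)) + c m) / I.s (I.floorLevel (v ⟨m, h⟩)) else 0 with ha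
  have haj : ∀ j : Fin I.n, a j =
      (I.P (I.floorLevel (v j)) + c j) / I.s (I.floorLevel (v j)) := by simp [ha]
  have h1 := hE a c fun m hm i hi => by
    have := hc.price_le hv ⟨m, hm⟩ i hi
    rwa [← haj] at this
  have h2 := hc.sum_le hF0 hF
  have he : (I.fifo v).energy = ENNReal.ofReal (∑ j : Fin I.n, (a j - c j * (1 / v j))) := by
    rw [fifo_energy hv]
    congr 1
    exact Finset.sum_congr rfl fun j _ => by rw [hc.price_eq hv, haj]
  -- Nonnegativity undoes the truncation in `ENNReal.ofReal`. For the competing schedule, truncation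
  -- works in the right direction.
  have he0 : 0 ≤ ∑ j : Fin I.n, (a j - c j * (1 / v j)) := by
    refine Finset.sum_nonneg fun j _ => ?_
    rw [haj, ← hc.price_eq hv]
    exact add_nonneg (mul_nonneg (Inst.pw_nonneg _) (slowTime_nonneg (hv j).1 (hv j).2))
      (mul_nonneg (Inst.pw_nonneg _) (sub_nonneg.2 (slowTime_le (hv j).1 (hv j).2)))
  have hflow : (I.fifo v).flow + ∑ j : Fin I.n, (a j - c j * (1 / v j)) ≤
      σ'.flow + ∑ j : Fin I.n, (a j - c j * y j) := by
    simp only [Schedule.flow, fifo_C hv, Finset.sum_sub_distrib] at h2 hC ⊢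
    linarith
  unfold Schedule.objective
  calc ((I.fifo v).flow : EReal) + (I.fifo v).energy
      = (((I.fifo v).flow + ∑ j : Fin I.n, (a j - c j * (1 / v j)) : ℝ) : EReal) := by
        rw [he, EReal.coe_ennreal_ofReal, max_eq_left he0, EReal.coe_add]
    _ ≤ ((σ'.flow + ∑ j : Fin I.n, (a j - c j * y j) : ℝ) : EReal) :=
        EReal.coe_le_coe_iff.2 hflow
    _ = (σ'.flow : EReal) + ((∑ j : Fin I.n, (a j - c j * y j) : ℝ) : EReal) := EReal.coe_add _ _
    _ ≤ (σ'.flow : EReal) + (σ'.energy : EReal) := by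
        refine add_le_add le_rfl (le_trans ?_ (EReal.coe_ennreal_le_coe_ennreal_iff.2 h1))
        rw [EReal.coe_ennreal_ofReal]
        exact EReal.coe_le_coe_iff.2 (le_max_left _ _)

lemma Run.optimal {m : ℕ} (h : I.Run ρ m v) (hh : I.Halted ρ v) : (I.fifo v).Optimal := by
  have hb := h.balanced
  obtain ⟨c, hc⟩ := hb.exists_certifies fun j => by
    have := (halted_iff hb.inRange).1 hh j
    cases ρ
    · exact not_lt.1 this
    · exact (not_le.1 this).le
  exact hc.optimal hb.inRange

end Inst

end SpeedScaling

end

noncomputable section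

namespace SpeedScaling

namespace Inst

variable {I : Inst} {ρ : Rule} {v : Fin I.n → ℝ} {j : Fin I.n}

/-! ### Raising a speed up to the next event -/

/-- `c` is the processing time of job `j` at the first event that is met when `j` is sped up:
a given speed is reached, or a link is lost. -/
structure IsNextEvent (I : Inst) (v : Fin I.n → ℝ) (j : Fin I.n) (c : ℝ) : Prop where
  level_le : 1 / I.sp (I.fl (v j) + 1) ≤ c
  link_le : ∀ i, j.val < i → i < I.chainEnd v j → 1 / v j - (I.done v i - I.rel i) ≤ c
  eq : c = 1 / I.sp (I.fl (v j) + 1) ∨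
    ∃ i, j.val < i ∧ i < I.chainEnd v j ∧ c = 1 / v j - (I.done v i - I.rel i)

section

variable {c : ℝ}

lemma IsNextEvent.pos (hc : I.IsNextEvent v j c) (hk : I.fl (v j) < I.k) : 0 < c :=
  lt_of_lt_of_le (one_div_pos.2 (sp_pos (Nat.succ_pos _) hk)) hc.level_le

lemma IsNextEvent.lt (hc : I.IsNextEvent v j c) (hv : I.InRange v) (hk : I.fl (v j) < I.k) :
    c < 1 / v j := by
  rcases hc.eq with h | ⟨i, hi, hi', h⟩
  · rw [h]
    exact one_div_lt_one_div_of_lt (hv.pos j) (lt_sp_fl_succ (hv.pos j).le hk)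
  · have : I.Link v i := of_lt_next hi hi'
    rw [h]
    linarith [this.2]

lemma IsNextEvent.lt_inv (hc : I.IsNextEvent v j c) (hv : I.InRange v) (hk : I.fl (v j) < I.k) :
    v j < 1 / c := by
  rw [lt_one_div (hv.pos j) (hc.pos hk)]
  exact hc.lt hv hk

lemma IsNextEvent.inv_le (hc : I.IsNextEvent v j c) (hk : I.fl (v j) < I.k) :
    1 / c ≤ I.sp (I.fl (v j) + 1) := by
  rw [one_div_le (hc.pos hk) (sp_pos (Nat.succ_pos _) hk)]
  exact hc.level_le

/-- Up to the next event, all links become at most tight. -/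
lemma IsNextEvent.wlink (hc : I.IsNextEvent v j c) (hv : I.InRange v) (hk : I.fl (v j) < I.k)
    {w : ℝ} (hw : v j ≤ w) (hwc : w ≤ 1 / c) {i : ℕ} (hi : j.val < i)
    (hi' : i < I.chainEnd v j) : I.WLink (Function.update v j w) i ∧
      I.done (Function.update v j w) i = I.done v i - (1 / v j - 1 / w) := by
  induction i using Nat.strong_induction_on with
  | _ i ih =>
    have hl : I.Link v i := of_lt_next hi hi'
    have h1 : I.done (Function.update v j w) i = I.done v i - (1 / v j - 1 / w) :=
      done_update_of_wlink hv.pos hw hi hl.1.le fun i' h1 h2 => (ih i' h2 h1 (by omega)).1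
    refine ⟨⟨hl.1, ?_⟩, h1⟩
    have h2 := hc.link_le i hi hi'
    have h3 : c ≤ 1 / w := by
      rw [le_one_div (hc.pos hk) ((hv.pos j).trans_le hw)]
      exact hwc
    rw [h1]
    linarith

/-- Below the speed `1 / c` no event occurs, so all gains stay the same. Jobs behind the chain of
`j` do not notice the raise at all. -/
lemma IsNextEvent.canRaise (hc : I.IsNextEvent v j c) (hv : I.InRange v) (hk : I.fl (v j) < I.k)
    (h : I.CanRaise ρ v j) {w : ℝ} (hw : v j ≤ w) (hwc : w < 1 / c) :
    I.CanRaise ρ (Function.update v j w) j := by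
  have hfl : I.fl w = I.fl (v j) :=
    fl_eq hk ((sp_fl_le (hv.pos j).le).trans hw) (hwc.trans_le (hc.inv_le hk))
  have hg := rgain_update_congr hv.pos hw hfl (fun i hi => by
    refine ⟨hi.1, ?_⟩
    rcases le_or_gt i j with hij | hij
    · rw [done_update_of_le hij]
      exact hi.2
    · obtain ⟨h1, h2⟩ := next_mem j.isLt (not_link_n (v := v))
      change j.val < I.chainEnd v j at h1
      change ¬ I.Link v (I.chainEnd v j) at h2
      rcases lt_trichotomy i (I.chainEnd v j) with h3 | h3 | h3
      · rw [(hc.wlink hv hk hw hwc.le hij h3).2]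
        have h4 := hc.link_le i hij h3
        have h5 : c < 1 / w := by
          rw [lt_one_div (hc.pos hk) ((hv.pos j).trans_le hw)]
          exact hwc
        linarith
      · rw [← h3] at h2
        exact absurd hi h2
      · rw [done_update_of_not_link hv.pos hw h1 (h3.trans hi.1) h2 h3]
        exact hi.2)
  refine ⟨?_, fun j' => ?_⟩
  · rw [hg]
    exact h.1
  · rw [hg, hg]
    exact h.2 j'

/-- At the speed `1 / c` itself the event counts: the new level is attained, or a link becomes tight
and is no longer strict. This is the termination measure of the main loop, whose passes may be finer
than iterations. -/
lemma IsNextEvent.events_lt (hc : I.IsNextEvent v j c) (hv : I.InRange v) (hk : I.fl (v j) < I.k) :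
    I.events v < I.events (Function.update v j (1 / c)) := by
  have hlt := hc.lt_inv hv hk
  refine Inst.events_lt hv.pos hlt.le ?_
  rcases hc.eq with h | ⟨i, hi, hi', h⟩
  · left
    rw [h, one_div_one_div]
    exact (le_fl_iff (sp_pos (Nat.succ_pos _) hk).le hk).2 le_rfl
  · right
    refine ⟨i, of_lt_next hi hi', fun hl => ?_⟩
    have h1 := hl.2
    rw [(hc.wlink hv hk hlt.le le_rfl hi hi').2, one_div_one_div, h] at h1
    linarith

end

/-- The speeds `v` may occur while an iteration with job `j` is being carried out. -/
def Midway (I : Inst) (ρ : Rule) (v : Fin I.n → ℝ) (j : Fin I.n) : Prop :=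
  I.InRange v ∧ ∃ m v₀, I.Run ρ m v₀ ∧ v₀ j ≤ v j ∧ v = Function.update v₀ j (v j) ∧
    ∀ w, v₀ j ≤ w → w < v j → I.CanRaise ρ (Function.update v₀ j w) j

lemma Run.midway {m : ℕ} (h : I.Run ρ m v) (j : Fin I.n) : I.Midway ρ v j :=
  ⟨h.inRange, m, v, h, le_rfl, (Function.update_eq_self _ _).symm,
    fun _ h1 h2 => absurd h2 (not_lt.2 h1)⟩

/-- If raising is not permitted, then either the iteration in progress has just ended, or it has not
changed anything yet. -/
lemma Midway.run (h : I.Midway ρ v j) (hn : ¬ I.CanRaise ρ v j) : ∃ m, I.Run ρ m v := by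
  obtain ⟨hr, m, v₀, hm, hle, hv, hw⟩ := h
  rcases hle.eq_or_lt with he | hlt
  · rw [← he, Function.update_eq_self] at hv
    exact ⟨m, hv ▸ hm⟩
  · refine ⟨m + 1, hm.step ((iteration_iff hm.inRange _).2 ⟨j, v j, ⟨hlt, (hr j).2, hw, ?_⟩, hv⟩)⟩
    rwa [← hv]

/-- Another job is selected only if its gain is larger. -/
lemma Midway.select {j' : Fin I.n} (h : I.Midway ρ v j)
    (hj : j' = j ∨ I.rgain v j < I.rgain v j') : I.Midway ρ v j' := by
  rcases hj with rfl | hj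
  · exact h
  · obtain ⟨m, hm⟩ := h.run fun hc => absurd (hc.2 j') (not_le.2 hj)
    exact hm.midway j'

/-- A raise to the next event extends the interval of speeds at which raising was permitted. Whether
the iteration is over is left open, since the gain may still be active and maximum there. -/
lemma Midway.raise (h : I.Midway ρ v j) (hcan : I.CanRaise ρ v j) {c : ℝ}
    (hc : I.IsNextEvent v j c) : I.Midway ρ (Function.update v j (1 / c)) j := by
  have hv := h.1
  have hk := fl_lt_of_rgain_nonneg hcan.1.nonneg
  have hlt := hc.lt_inv hv hk
  obtain ⟨m, v₀, hm, hle, hv₀, hw⟩ := h.2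
  refine ⟨hv.update hlt.le ((hc.inv_le hk).trans (sp_le hk le_rfl)), m, v₀, hm, ?_, ?_, ?_⟩
  · rw [Function.update_self]
    exact hle.trans hlt.le
  · rw [Function.update_self]
    conv_lhs => rw [hv₀]
    rw [Function.update_idem]
  · rw [Function.update_self]
    intro w h1 h2
    rcases lt_or_ge w (v j) with h3 | h3
    · exact hw w h1 h3
    · have := hc.canRaise hv hk hcan h3 h2
      rw [hv₀, Function.update_idem] at this
      exact this

end Inst

/-! ### Program logic -/

/-- All numbers in the store belong to `G`. -/
def Store.InG (G : Set ℝ) (m : Store) : Prop := ∀ a i, m.num a i ∈ G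

/-- Started on `m`, the program `p` halts after at most `t` steps with a store that satisfies `Q`,
and it writes only numbers that belong to `G`. -/
def Tri (G : Set ℝ) (p : Cmd) (m : Store) (t : ℕ) (Q : Store → Prop) : Prop :=
  ∃ m', Q m' ∧ m'.InG G ∧
    ∀ (ω : ℝ → ℕ) (B : ℕ), (∀ z ∈ G, ω z ≤ B) → ∃ t' ≤ (1 + 3 * B) * t, Exec ω p m m' t'

section logic

variable {G : Set ℝ} {p q : Cmd} {m : Store} {t t' : ℕ} {Q R : Store → Prop}

lemma Store.InG.setIdx (h : m.InG G) (x i : ℕ) : (m.setIdx x i).InG G := h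

lemma Store.InG.set (h : m.InG G) (a x : ℕ) {z : ℝ} (hz : z ∈ G) : (m.set a x z).InG G := by
  intro b i
  simp only [Store.set, Function.update_apply]
  split_ifs with h1
  · rw [Function.update_apply]
    split_ifs
    · exact hz
    · exact h a i
  · exact h b i

lemma Tri.mono (h : Tri G p m t Q) (ht : t ≤ t') (hQ : ∀ m', m'.InG G → Q m' → R m') :
    Tri G p m t' R := by
  obtain ⟨m', h1, h2, h3⟩ := h
  refine ⟨m', hQ m' h2 h1, h2, fun ω B hB => ?_⟩
  obtain ⟨s, hs, he⟩ := h3 ω B hB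
  exact ⟨s, hs.trans (Nat.mul_le_mul_left _ ht), he⟩

lemma Tri.skip (hm : m.InG G) (h : Q m) : Tri G .skip m 1 Q :=
  ⟨m, h, hm, fun _ _ _ => ⟨1, by omega, .skip m⟩⟩

lemma Tri.seq (h : Tri G p m t R) (h' : ∀ m', m'.InG G → R m' → Tri G q m' t' Q) :
    Tri G (.seq p q) m (t + t') Q := by
  obtain ⟨m', h1, h2, h3⟩ := h
  obtain ⟨m'', h4, h5, h6⟩ := h' m' h2 h1
  refine ⟨m'', h4, h5, fun ω B hB => ?_⟩
  obtain ⟨s, hs, he⟩ := h3 ω B hB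
  obtain ⟨s', hs', he'⟩ := h6 ω B hB
  exact ⟨s + s', by rw [Nat.mul_add]; exact Nat.add_le_add hs hs', .seq he he'⟩

lemma Tri.zero (hm : m.InG G) {x : ℕ} (h : Q (m.setIdx x 0)) : Tri G (.zero x) m 1 Q :=
  ⟨_, h, hm.setIdx _ _, fun _ _ _ => ⟨1, by omega, .zero m x⟩⟩

lemma Tri.copy (hm : m.InG G) {x y : ℕ} (h : Q (m.setIdx x (m.idx y))) : Tri G (.copy x y) m 1 Q :=
  ⟨_, h, hm.setIdx _ _, fun _ _ _ => ⟨1, by omega, .copy m x y⟩⟩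

lemma Tri.inc (hm : m.InG G) {x : ℕ} (h : Q (m.setIdx x (m.idx x + 1))) : Tri G (.inc x) m 1 Q :=
  ⟨_, h, hm.setIdx _ _, fun _ _ _ => ⟨1, by omega, .inc m x⟩⟩

lemma Tri.dec (hm : m.InG G) {x : ℕ} (h : Q (m.setIdx x (m.idx x - 1))) : Tri G (.dec x) m 1 Q :=
  ⟨_, h, hm.setIdx _ _, fun _ _ _ => ⟨1, by omega, .dec m x⟩⟩

lemma Tri.const (hm : m.InG G) {a x c : ℕ} (hc : (c : ℝ) ∈ G) (h : Q (m.set a x c)) :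
    Tri G (.const a x c) m 1 Q := by
  refine ⟨_, h, hm.set _ _ hc, fun ω B hB => ⟨_, ?_, .const m a x c⟩⟩
  have := hB _ hc
  omega

lemma Tri.arith (hm : m.InG G) {o : Arith} {a x b y c z : ℕ}
    (hc : o.eval (m.get b y) (m.get c z) ∈ G) (h : Q (m.set a x (o.eval (m.get b y) (m.get c z)))) :
    Tri G (.arith o a x b y c z) m 1 Q := by
  refine ⟨_, h, hm.set _ _ hc, fun ω B hB => ⟨_, ?_, .arith m o a x b y c z⟩⟩
  have h1 := hB _ hc
  have h2 := hB _ (hm b (m.idx y))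
  have h3 := hB _ (hm c (m.idx z))
  unfold Store.get at *
  omega

lemma Test.cost_le (hm : m.InG G) {ω : ℝ → ℕ} {B : ℕ} (hB : ∀ z ∈ G, ω z ≤ B) (b : Test) :
    b.cost ω m ≤ 1 + 3 * B := by
  cases b with
  | idxLt x y => simp [Test.cost]
  | numLt a x b y =>
    have h2 := hB _ (hm a (m.idx x))
    have h3 := hB _ (hm b (m.idx y))
    simp only [Test.cost, Store.get]
    omega

lemma Tri.cond (hm : m.InG G) {b : Test} (hp : b.Holds m → Tri G p m t Q)
    (hq : ¬ b.Holds m → Tri G q m t Q) : Tri G (.cond b p q) m (t + 1) Q := by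
  by_cases h : b.Holds m
  · obtain ⟨m', h1, h2, h3⟩ := hp h
    refine ⟨m', h1, h2, fun ω B hB => ?_⟩
    obtain ⟨s, hs, he⟩ := h3 ω B hB
    refine ⟨_, ?_, .cond_true h he⟩
    have := Test.cost_le hm hB b
    rw [Nat.mul_add, Nat.mul_one]
    omega
  · obtain ⟨m', h1, h2, h3⟩ := hq h
    refine ⟨m', h1, h2, fun ω B hB => ?_⟩
    obtain ⟨s, hs, he⟩ := h3 ω B hB
    refine ⟨_, ?_, .cond_false h he⟩
    have := Test.cost_le hm hB b
    rw [Nat.mul_add, Nat.mul_one]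
    omega

/-- A loop with the invariant `J N`, where `N` bounds the number of remaining iterations. -/
lemma Tri.loop {b : Test} (J : ℕ → Store → Prop)
    (hstep : ∀ N m, m.InG G → J N m → b.Holds m → ∃ N', N = N' + 1 ∧ Tri G p m t (J N'))
    (hend : ∀ N m, m.InG G → J N m → ¬ b.Holds m → Q m)
    (N : ℕ) (hm : m.InG G) (h : J N m) : Tri G (.loop b p) m (N * (t + 1) + 1) Q := by
  induction N using Nat.strong_induction_on generalizing m with
  | _ N ih =>
    by_cases hb : b.Holds m
    · obtain ⟨N', rfl, m', h1, h2, h3⟩ := hstep N m hm h hb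
      obtain ⟨m'', h4, h5, h6⟩ := ih N' (Nat.lt_succ_self _) h2 h1
      refine ⟨m'', h4, h5, fun ω B hB => ?_⟩
      obtain ⟨s, hs, he⟩ := h3 ω B hB
      obtain ⟨s', hs', he'⟩ := h6 ω B hB
      refine ⟨_, ?_, .loop_true hb he he'⟩
      have := Test.cost_le hm hB b
      calc b.cost ω m + s + s' ≤ (1 + 3 * B) + (1 + 3 * B) * t +
            (1 + 3 * B) * (N' * (t + 1) + 1) := by omega
        _ = (1 + 3 * B) * ((N' + 1) * (t + 1) + 1) := by ring
    · refine ⟨m, hend N m hm h hb, hm, fun ω B hB => ⟨_, ?_, .loop_false hb⟩⟩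
      have := Test.cost_le hm hB b
      calc b.cost ω m ≤ (1 + 3 * B) * 1 := by omega
        _ ≤ _ := Nat.mul_le_mul_left _ (by omega)

/-- The counters that a program may change. -/
def Cmd.idxWrites : Cmd → List ℕ
  | .zero x | .copy x _ | .inc x | .dec x => [x]
  | .seq p q | .cond _ p q => p.idxWrites ++ q.idxWrites
  | .loop _ p => p.idxWrites
  | _ => []

/-- The arrays that a program may change. -/
def Cmd.numWrites : Cmd → List ℕ
  | .const a _ _ | .arith _ a _ _ _ _ _ => [a]
  | .seq p q | .cond _ p q => p.numWrites ++ q.numWrites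
  | .loop _ p => p.numWrites
  | _ => []

/-- The stores differ at most in the counters and arrays that `p` may change. -/
def Cmd.Frame (p : Cmd) (m m' : Store) : Prop :=
  (∀ x, x ∉ p.idxWrites → m'.idx x = m.idx x) ∧ ∀ a, a ∉ p.numWrites → m'.num a = m.num a

lemma Exec.frame {ω : ℝ → ℕ} {m' : Store} (h : Exec ω p m m' t) : p.Frame m m' := by
  induction h with
  | skip m => exact ⟨fun _ _ => rfl, fun _ _ => rfl⟩
  | zero m x | copy m x | inc m x | dec m x =>
    refine ⟨fun y hy => ?_, fun _ _ => rfl⟩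
    simp only [Cmd.idxWrites, List.mem_singleton] at hy
    simp [Store.setIdx, hy]
  | const m a x c | arith m o a =>
    refine ⟨fun _ _ => rfl, fun b hb => ?_⟩
    simp only [Cmd.numWrites, List.mem_singleton] at hb
    simp [Store.set, hb]
  | seq _ _ ih1 ih2 =>
    refine ⟨fun y hy => ?_, fun b hb => ?_⟩
    · simp only [Cmd.idxWrites, List.mem_append, not_or] at hy
      rw [ih2.1 y hy.2, ih1.1 y hy.1]
    · simp only [Cmd.numWrites, List.mem_append, not_or] at hb
      rw [ih2.2 b hb.2, ih1.2 b hb.1]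
  | cond_true _ _ ih =>
    refine ⟨fun y hy => ?_, fun b hb => ?_⟩
    · simp only [Cmd.idxWrites, List.mem_append, not_or] at hy
      exact ih.1 y hy.1
    · simp only [Cmd.numWrites, List.mem_append, not_or] at hb
      exact ih.2 b hb.1
  | cond_false _ _ ih =>
    refine ⟨fun y hy => ?_, fun b hb => ?_⟩
    · simp only [Cmd.idxWrites, List.mem_append, not_or] at hy
      exact ih.1 y hy.2
    · simp only [Cmd.numWrites, List.mem_append, not_or] at hb
      exact ih.2 b hb.2
  | loop_true _ _ _ ih1 ih2 =>
    exact ⟨fun y hy => (ih2.1 y hy).trans (ih1.1 y hy), fun b hb => (ih2.2 b hb).trans (ih1.2 b hb)⟩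
  | loop_false _ => exact ⟨fun _ _ => rfl, fun _ _ => rfl⟩

/-- `Tri` contains an actual execution, here taken with unit costs, from which the unchanged
counters and arrays are read off. -/
lemma Tri.frame (h : Tri G p m t Q) : Tri G p m t fun m' => Q m' ∧ p.Frame m m' := by
  obtain ⟨m', h1, h2, h3⟩ := h
  obtain ⟨s, -, he⟩ := h3 unitCost 0 fun _ _ => le_rfl
  exact ⟨m', ⟨h1, he.frame⟩, h2, h3⟩

end logic

end SpeedScaling

end

/-! ### Rules for straight-line code, the numbers that occur, and the program itself -/

noncomputable section

namespace SpeedScaling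

section logic

variable {G : Set ℝ} {p q : Cmd} {m : Store} {t t' : ℕ} {Q R : Store → Prop}

lemma Tri.of_le (h : Tri G p m t Q) (ht : t ≤ t') : Tri G p m t' Q := h.mono ht fun _ _ h => h

/-- This rule and its analogues for the other instructions substitute the exact resulting store into
the continuation, so straight-line code needs no intermediate assertions. -/
lemma Tri.zero_seq (hm : m.InG G) {x : ℕ} (h : Tri G q (m.setIdx x 0) t Q) :
    Tri G (.seq (.zero x) q) m (t + 1) Q :=
  Tri.of_le (Tri.seq (R := (· = m.setIdx x 0)) (Tri.zero hm rfl) fun _ _ e => e ▸ h)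
    (Nat.add_comm _ _).le

lemma Tri.copy_seq (hm : m.InG G) {x y : ℕ} (h : Tri G q (m.setIdx x (m.idx y)) t Q) :
    Tri G (.seq (.copy x y) q) m (t + 1) Q :=
  Tri.of_le (Tri.seq (R := (· = m.setIdx x (m.idx y))) (Tri.copy hm rfl) fun _ _ e => e ▸ h)
    (Nat.add_comm _ _).le

lemma Tri.inc_seq (hm : m.InG G) {x : ℕ} (h : Tri G q (m.setIdx x (m.idx x + 1)) t Q) :
    Tri G (.seq (.inc x) q) m (t + 1) Q :=
  Tri.of_le (Tri.seq (R := (· = m.setIdx x (m.idx x + 1))) (Tri.inc hm rfl) fun _ _ e => e ▸ h)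
    (Nat.add_comm _ _).le

lemma Tri.const_seq (hm : m.InG G) {a x c : ℕ} (hc : (c : ℝ) ∈ G)
    (h : (m.set a x c).InG G → Tri G q (m.set a x c) t Q) :
    Tri G (.seq (.const a x c) q) m (t + 1) Q :=
  Tri.of_le (Tri.seq (R := (· = m.set a x c)) (Tri.const hm hc rfl) fun _ hm' e => e ▸ h (e ▸ hm'))
    (Nat.add_comm _ _).le

/-- The value `z` of the result is given explicitly, which keeps the stores readable. -/
lemma Tri.arith_seq (hm : m.InG G) {o : Arith} {a x b y c d : ℕ} (z : ℝ)
    (hz : o.eval (m.get b y) (m.get c d) = z) (hG : z ∈ G)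
    (h : (m.set a x z).InG G → Tri G q (m.set a x z) t Q) :
    Tri G (.seq (.arith o a x b y c d) q) m (t + 1) Q := by
  subst hz
  exact Tri.of_le (Tri.seq (R := (· = m.set a x _)) (Tri.arith hm hG rfl)
    fun _ hm' e => e ▸ h (e ▸ hm')) (Nat.add_comm _ _).le

lemma Tri.arith_val (hm : m.InG G) {o : Arith} {a x b y c d : ℕ} (z : ℝ)
    (hz : o.eval (m.get b y) (m.get c d) = z) (hG : z ∈ G) (h : Q (m.set a x z)) :
    Tri G (.arith o a x b y c d) m 1 Q := by
  subst hz
  exact Tri.arith hm hG h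

lemma Cmd.Frame.refl (p : Cmd) (m : Store) : p.Frame m m := ⟨fun _ _ => rfl, fun _ _ => rfl⟩

/-- A loop with the invariant `J N`, which need not mention what the loop does not change. -/
lemma Tri.loop_frame {b : Test} (J : ℕ → Store → Prop)
    (hstep : ∀ N m', m'.InG G → J N m' → p.Frame m m' → b.Holds m' →
      ∃ N', N = N' + 1 ∧ Tri G p m' t (J N'))
    (hend : ∀ N m', m'.InG G → J N m' → p.Frame m m' → ¬ b.Holds m' → Q m')
    (N : ℕ) (hm : m.InG G) (h : J N m) : Tri G (.loop b p) m (N * (t + 1) + 1) Q := by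
  refine Tri.loop (fun N m' => J N m' ∧ p.Frame m m') (fun N m' hm' hJ hb => ?_)
    (fun N m' hm' hJ hb => hend N m' hm' hJ.1 hJ.2 hb) N hm ⟨h, Cmd.Frame.refl p m⟩
  obtain ⟨N', rfl, hT⟩ := hstep N m' hm' hJ.1 hJ.2 hb
  refine ⟨N', rfl, hT.frame.mono le_rfl fun m'' _ h => ⟨h.1, ?_⟩⟩
  exact ⟨fun x hx => (h.2.1 x hx).trans (hJ.2.1 x hx),
    fun a ha => (h.2.2 a ha).trans (hJ.2.2 a ha)⟩

end logic

namespace Inst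

/-! ### The numbers that occur -/

/-- The integer combinations of release times and of processing times at the given speeds. -/
def lattice (I : Inst) : AddSubgroup ℝ :=
  AddSubgroup.closure (Set.range I.r ∪ {z | ∃ i, 0 < i ∧ i ≤ I.k ∧ z = 1 / I.sp i})

/-- A bound for all times. -/
def horizon (I : Inst) : ℝ := ∑ j, I.r j + (I.n + 1) * (1 / I.sp 1)

/-- `G` contains all numbers that occur in the computation. -/
structure Covers (I : Inst) (G : Set ℝ) : Prop where
  input : ∀ a i, I.input.num a i ∈ G
  nat : ∀ c : ℕ, c ≤ I.n + 1 → (c : ℝ) ∈ G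
  mul : ∀ i i', I.pw i * I.sp i' ∈ G
  mul_sub : ∀ i, I.pw (i + 1) * I.sp i - I.pw i * I.sp (i + 1) ∈ G
  sub : ∀ i, I.sp (i + 1) - I.sp i ∈ G
  del : ∀ i, I.del i ∈ G
  gain : ∀ (i c : ℕ), c ≤ I.n → (c : ℝ) - I.del i ∈ G
  time : ∀ z ∈ I.lattice, |z| ≤ I.horizon → z ∈ G
  inv : ∀ z ∈ I.lattice, 1 / I.sp I.k ≤ z → z ≤ 1 / I.sp 1 → 1 / z ∈ G

/-- All processing times belong to the lattice. -/
def InLattice (I : Inst) (v : Fin I.n → ℝ) : Prop := ∀ j, 1 / v j ∈ I.lattice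

variable {I : Inst} {v : Fin I.n → ℝ} {G : Set ℝ}

lemma inv_sp_mem {i : ℕ} (h0 : 0 < i) (hi : i ≤ I.k) : 1 / I.sp i ∈ I.lattice :=
  AddSubgroup.subset_closure (Or.inr ⟨i, h0, hi, rfl⟩)

lemma rel_mem {i : ℕ} : I.rel i ∈ I.lattice := by
  unfold rel
  split_ifs with h
  · exact AddSubgroup.subset_closure (Or.inl ⟨_, rfl⟩)
  · exact I.lattice.zero_mem

/-- Completion times arise by sums and maxima, and a maximum is one of its two arguments. -/
lemma done_mem (hL : I.InLattice v) (m : ℕ) : I.done v m ∈ I.lattice := by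
  induction m with
  | zero => exact I.lattice.zero_mem
  | succ m ih =>
    unfold done
    split_ifs with h
    · refine I.lattice.add_mem ?_ (hL _)
      rcases max_choice (I.r ⟨m, h⟩) (I.done v m) with e | e
      · rw [e]
        exact AddSubgroup.subset_closure (Or.inl ⟨_, rfl⟩)
      · rwa [e]
    · exact ih

lemma rel_le_sum (i : ℕ) : I.rel i ≤ ∑ j, I.r j := by
  unfold rel
  split_ifs with h
  · exact Finset.single_le_sum (f := I.r) (fun j _ => I.r_nonneg j) (Finset.mem_univ _)
  · exact Finset.sum_nonneg fun j _ => I.r_nonneg j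

lemma InRange.inv_le (hv : I.InRange v) (j : Fin I.n) : 1 / v j ≤ 1 / I.sp 1 :=
  one_div_le_one_div_of_le (sp_pos one_pos I.k_pos) (hv j).1

lemma InRange.le_inv (hv : I.InRange v) (j : Fin I.n) : 1 / I.sp I.k ≤ 1 / v j :=
  one_div_le_one_div_of_le (hv.pos j) (hv j).2

lemma inv_sp_one_pos : 0 < 1 / I.sp 1 := one_div_pos.2 (sp_pos one_pos I.k_pos)

lemma done_le_sum (hv : I.InRange v) {m : ℕ} : I.done v m ≤ ∑ j, I.r j + m * (1 / I.sp 1) := by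
  induction m with
  | zero => simpa [done] using Finset.sum_nonneg fun j _ => I.r_nonneg j
  | succ m ih =>
    have h1 := inv_sp_one_pos (I := I)
    unfold done
    push_cast
    split_ifs with h
    · have h2 := rel_le_sum (I := I) m
      have h3 := hv.inv_le ⟨m, h⟩
      have h4 : max (I.r ⟨m, h⟩) (I.done v m) ≤ ∑ j, I.r j + m * (1 / I.sp 1) := by
        refine max_le ?_ ih
        rw [← rel_val]
        exact h2.trans (le_add_of_nonneg_right (by positivity))
      linarith
    · linarith

lemma InRange.horizon_bound (hv : I.InRange v) {m i : ℕ} (hm : m ≤ I.n) (j : Fin I.n) :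
    I.done v m ≤ I.horizon ∧ I.rel i ≤ I.horizon ∧ 1 / I.sp 1 ≤ I.horizon ∧
      |I.done v m - I.rel i| ≤ I.horizon ∧ |1 / v j - (I.done v m - I.rel i)| ≤ I.horizon := by
  have h1 := inv_sp_one_pos (I := I)
  have h2 := done_le_sum hv (m := m)
  have h3 := rel_le_sum (I := I) i
  have h4 := hv.inv_le j
  have h5 : (m : ℝ) * (1 / I.sp 1) ≤ I.n * (1 / I.sp 1) :=
    mul_le_mul_of_nonneg_right (Nat.cast_le.2 hm) h1.le
  have h6 := done_nonneg hv.pos m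
  have h7 := rel_nonneg (I := I) i
  have h8 : 0 ≤ ∑ j, I.r j := Finset.sum_nonneg fun j _ => I.r_nonneg j
  have h9 := one_div_pos.2 (hv.pos j)
  have h10 : (0 : ℝ) ≤ I.n * (1 / I.sp 1) := by positivity
  unfold horizon
  refine ⟨by linarith, by linarith, by linarith, abs_le.2 ⟨by linarith, by linarith⟩,
    abs_le.2 ⟨by linarith, by linarith⟩⟩

/-- This is what keeps numbers short: every raise replaces a processing time by another element of
the same group. -/
lemma IsNextEvent.mem_lattice {j : Fin I.n} {c : ℝ} (hc : I.IsNextEvent v j c)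
    (hL : I.InLattice v) (hk : I.fl (v j) < I.k) : c ∈ I.lattice := by
  rcases hc.eq with h | ⟨i, -, -, h⟩
  · rw [h]
    exact inv_sp_mem (Nat.succ_pos _) hk
  · rw [h]
    exact I.lattice.sub_mem (hL j) (I.lattice.sub_mem (done_mem hL i) rel_mem)

/-! ### The program

Counters: `0` and `1` hold `n` and `k`, `2` holds zero, `3` and `4` range over levels, `5` over
jobs, `6` is the selected job, `7` ranges over the jobs affected by a job, `8` is zero as soon as
the algorithm has halted. Arrays: `3` processing times (finally speeds), `4` completion times,
`5` inverse speeds, `6` shrinking energies, `7` zero, `8` one, `9` and `10` gain and next event of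
a job, `12` and `13` those of the selected job, `11` and `14` auxiliary numbers. -/

/-- Puts the level of the job `5` into `3`. -/
def findLevel : Cmd := .seq (.copy 3 1) (.loop (.numLt 5 3 3 5) (.dec 3))

/-- Visits one job that is affected by the job `5`. -/
def visit : Cmd :=
  .seq (.arith .add 9 2 9 2 8 2) <| .seq (.arith .sub 11 2 4 7 0 7) <|
  .seq (.arith .sub 11 2 3 5 11 2) <|
  .seq (.cond (.numLt 10 2 11 2) (.arith .add 10 2 11 2 7 2) .skip) (.inc 7)

/-- Computes the gain and the next event of the job `5`. -/
def evalJob : Cmd :=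
  .seq findLevel <| .seq (.copy 4 3) <| .seq (.inc 4) <| .seq (.arith .sub 9 2 8 2 6 3) <|
  .seq (.arith .add 10 2 5 4 7 2) <| .seq (.copy 7 5) <| .seq (.inc 7) <|
  .loop (.numLt 0 7 4 7) visit

/-- Computes the completion times, and puts a sentinel behind the release times. -/
def computeDone : Cmd :=
  .seq (.zero 5) <| .seq (.loop (.idxLt 5 0) <| .seq (.copy 4 5) <| .seq (.inc 4) <|
    .seq (.cond (.numLt 4 5 0 5) (.arith .add 4 4 0 5 3 5) (.arith .add 4 4 4 5 3 5)) (.inc 5)) <|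
  .arith .add 0 5 4 5 7 2

/-- Compares the job `5` with the selected job. -/
def compareJob : Cmd :=
  .seq evalJob <| .seq (.cond (.numLt 12 2 9 2)
    (.seq (.copy 6 5) <| .seq (.arith .add 12 2 9 2 7 2) (.arith .add 13 2 10 2 7 2)) .skip)
    (.inc 5)

/-- Selects a job of maximum gain; another one than before only if it has a larger gain. -/
def select : Cmd :=
  .seq computeDone <| .seq (.copy 5 6) <| .seq evalJob <| .seq (.arith .add 12 2 9 2 7 2) <|
  .seq (.arith .add 13 2 10 2 7 2) <| .seq (.zero 5) <| .loop (.idxLt 5 0) compareJob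

/-- Speeds up the selected job, or halts. -/
def decideStep : Rule → Cmd
  | .positive => .cond (.numLt 7 2 12 2) (.arith .add 3 6 13 2 7 2) (.zero 8)
  | .nonneg => .cond (.numLt 12 2 7 2) (.zero 8) (.arith .add 3 6 13 2 7 2)

/-- Computes inverse speed and shrinking energy for one level. -/
def setupLevel : Cmd :=
  .seq (.copy 4 3) <| .seq (.inc 4) <| .seq (.arith .div 5 3 8 2 1 3) <|
  .seq (.arith .mul 11 2 2 4 1 3) <| .seq (.arith .mul 14 2 2 3 1 4) <|
  .seq (.arith .sub 11 2 11 2 14 2) <| .seq (.arith .sub 14 2 1 4 1 3) <|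
  .seq (.arith .div 6 3 11 2 14 2) (.inc 3)

/-- Computes inverse speeds and shrinking energies, and starts with the lowest speed. -/
def setup : Cmd :=
  .seq (.const 8 2 1) <| .seq (.zero 3) <| .seq (.inc 3) <| .seq (.loop (.idxLt 3 1) setupLevel) <|
  .seq (.arith .div 5 3 8 2 1 3) <| .seq (.const 6 3 1) <| .seq (.zero 4) <|
  .seq (.loop (.idxLt 4 0) (.seq (.arith .add 6 3 6 3 8 2) (.inc 4))) <|
  .seq (.zero 9) <| .seq (.inc 9) <| .seq (.zero 5) <|
  .loop (.idxLt 5 0) (.seq (.arith .add 3 5 5 9 7 2) (.inc 5))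

/-- Replaces the processing times by the speeds. -/
def output : Cmd :=
  .seq (.zero 5) (.loop (.idxLt 5 0) (.seq (.arith .div 3 5 8 2 3 5) (.inc 5)))

/-- The whole program. -/
def program (ρ : Rule) : Cmd :=
  .cond (.idxLt 2 0) (.seq setup <| .seq (.zero 8) <| .seq (.inc 8) <| .seq (.zero 6) <|
    .seq (.loop (.idxLt 2 8) (.seq select (decideStep ρ))) output) .skip

/-- The store holds the instance, the derived constants and the processing times for `v`. -/
structure Base (I : Inst) (v : Fin I.n → ℝ) (m : Store) : Prop where
  idx0 : m.idx 0 = I.n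
  idx1 : m.idx 1 = I.k
  idx2 : m.idx 2 = 0
  rel : ∀ i < I.n, m.num 0 i = I.rel i
  x : ∀ j : Fin I.n, m.num 3 j = 1 / v j
  done0 : m.num 4 0 = 0
  inv : ∀ i ≤ I.k + 1, m.num 5 i = 1 / I.sp i
  del : ∀ i, 0 < i → i ≤ I.k → m.num 6 i = I.del i
  zero : m.num 7 0 = 0
  one : m.num 8 0 = 1

/-- The store also holds the completion times and the sentinel. -/
structure Loaded (I : Inst) (v : Fin I.n → ℝ) (m : Store) : Prop extends I.Base v m where
  done : ∀ i ≤ I.n, m.num 4 i = I.done v i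
  sentinel : m.num 0 I.n = I.done v I.n

lemma Base.congr {m m' : Store} (h : I.Base v m) (hi : ∀ x < 3, m'.idx x = m.idx x)
    (hn : ∀ a < 9, m'.num a = m.num a) : I.Base v m' := by
  constructor <;>
    simp only [hi 0 (by norm_num), hi 1 (by norm_num), hi 2 (by norm_num), hn 0 (by norm_num),
      hn 3 (by norm_num), hn 4 (by norm_num), hn 5 (by norm_num), hn 6 (by norm_num),
      hn 7 (by norm_num), hn 8 (by norm_num)]
  exacts [h.idx0, h.idx1, h.idx2, h.rel, h.x, h.done0, h.inv, h.del, h.zero, h.one]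

lemma Loaded.congr {m m' : Store} (h : I.Loaded v m) (hi : ∀ x < 3, m'.idx x = m.idx x)
    (hn : ∀ a < 9, m'.num a = m.num a) : I.Loaded v m' := by
  refine ⟨h.toBase.congr hi hn, ?_, ?_⟩
  · rw [hn 4 (by norm_num)]
    exact h.done
  · rw [hn 0 (by norm_num)]
    exact h.sentinel

lemma Loaded.link_iff {m : Store} (h : I.Loaded v m) {e : ℕ} (he : e ≤ I.n) :
    m.num 0 e < m.num 4 e ↔ I.Link v e := by
  rw [h.done e he]
  rcases he.eq_or_lt with rfl | he'
  · rw [h.sentinel]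
    exact iff_of_false (lt_irrefl _) not_link_n
  · rw [h.rel e he']
    exact ⟨fun hlt => ⟨he', hlt⟩, fun hl => hl.2⟩

section spec

variable {m : Store}

/-- The store holds processing times, so levels are compared by inverse speeds. Starting from `k`,
the counter cannot fall below `fl (v j)`, where the test fails. -/
lemma findLevel_tri (hm : m.InG G) (hb : I.Base v m) (hv : I.InRange v) {j : Fin I.n}
    (hj : m.idx 5 = j) :
    Tri G findLevel m (2 * I.k + 2) (fun m' => m' = m.setIdx 3 (I.fl (v j))) := by
  refine Tri.of_le (Tri.copy_seq hm ?_) (show I.k * (1 + 1) + 1 + 1 ≤ _ by omega)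
  refine Tri.loop (fun N m' => m' = m.setIdx 3 N ∧ I.fl (v j) ≤ N ∧ N ≤ I.k) ?_ ?_ I.k
    (hm.setIdx _ _) ⟨by rw [hb.idx1], fl_le _, le_rfl⟩
  · rintro N _ hm' ⟨rfl, h1, h2⟩ hlt
    have hlt' : m.num 5 N < m.num 3 j := by
      simpa [Test.Holds, Store.get, Store.setIdx, hj] using hlt
    rw [hb.inv N (by omega), hb.x] at hlt'
    have h0 : 0 < I.fl (v j) := fl_pos (hv j).1
    have h3 : I.fl (v j) ≠ N := by
      rintro rfl
      have := one_div_le_one_div_of_le (sp_pos h0 (fl_le _)) (sp_fl_le (I := I) (hv.pos j).le)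
      linarith
    obtain ⟨N', rfl⟩ : ∃ N', N = N' + 1 := ⟨N - 1, by omega⟩
    refine ⟨N', rfl, Tri.dec hm' ⟨?_, by omega, by omega⟩⟩
    simp [Store.setIdx]
  · rintro N _ hm' ⟨rfl, h1, h2⟩ hlt
    have hlt' : ¬ m.num 5 N < m.num 3 j := by
      simpa [Test.Holds, Store.get, Store.setIdx, hj] using hlt
    rw [hb.inv N (by omega), hb.x] at hlt'
    have h0 : 0 < I.fl (v j) := fl_pos (hv j).1
    have h3 : N ≤ I.fl (v j) := by
      rw [le_fl_iff (hv.pos j).le h2]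
      exact (one_div_le_one_div (hv.pos j) (sp_pos (by omega) h2)).1 (not_lt.1 hlt')
    rw [le_antisymm h3 h1]

end spec

end Inst

end SpeedScaling

end

/-! ### Correctness of the evaluation of a job and of the completion times -/

noncomputable section

namespace SpeedScaling

namespace Inst

variable {I : Inst} {v : Fin I.n → ℝ} {G : Set ℝ} {m : Store}

lemma evalJob_tri (hG : I.Covers G) (hm : m.InG G) (hb : I.Loaded v m) (hv : I.InRange v)
    (hL : I.InLattice v) {j : Fin I.n} (hj : m.idx 5 = j) :
    Tri G evalJob m (7 * I.n + 2 * I.k + 9) (fun m' => I.Loaded v m' ∧ m'.idx 5 = m.idx 5 ∧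
      m'.idx 6 = m.idx 6 ∧ m'.num 12 = m.num 12 ∧ m'.num 13 = m.num 13 ∧
      m'.num 9 0 = I.rgain v j ∧ I.IsNextEvent v j (m'.num 10 0)) := by
  have hjn := j.isLt
  have hflk := fl_le (I := I) (v j)
  have hfl0 : 0 < I.fl (v j) := fl_pos (hv j).1
  suffices h : Tri G evalJob m (7 * I.n + 2 * I.k + 9)
      (fun m' => m'.num 9 0 = I.rgain v j ∧ I.IsNextEvent v j (m'.num 10 0)) by
    refine h.frame.mono le_rfl fun m' _ h => ⟨hb.congr (fun x hx => h.2.1 x ?_)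
      (fun a ha => h.2.2 a ?_), h.2.1 5 (by decide), h.2.1 6 (by decide), h.2.2 12 (by decide),
      h.2.2 13 (by decide), h.1⟩
    · revert x
      decide
    · revert a
      decide
  have hend := chainEnd_le (v := v) hjn
  have hjend := lt_chainEnd (v := v) hjn
  refine Tri.of_le (Tri.seq (findLevel_tri hm hb.toBase hv hj) ?_)
    (show 2 * I.k + 2 + ((I.chainEnd v j - (j + 1)) * (6 + 1) + 1 + 6) ≤ _ by omega)
  rintro _ hm' rfl
  refine Tri.copy_seq hm' (Tri.inc_seq (hm'.setIdx _ _) ?_)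
  refine Tri.arith_seq ((hm'.setIdx _ _).setIdx _ _) (1 - I.del (I.fl (v j))) ?_ ?_ fun hm1 => ?_
  · simp [Arith.eval, Store.get, Store.setIdx, hb.idx2, hb.one, hb.del _ hfl0 hflk]
  · exact_mod_cast hG.gain (I.fl (v j)) 1 (by omega)
  -- At the highest speed this reads the entry `k + 1`, which is 0, in agreement with `1 / 0` for
  -- the dummy value of `sp`.
  refine Tri.arith_seq hm1 (1 / I.sp (I.fl (v j) + 1)) ?_ ?_ fun hm2 => ?_
  · simp [Arith.eval, Store.get, Store.setIdx, Store.set, hb.idx2, hb.zero,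
      hb.inv (I.fl (v j) + 1) (by omega)]
  · rw [← hb.inv (I.fl (v j) + 1) (by omega)]
    exact hm 5 _
  refine Tri.copy_seq hm2 (Tri.inc_seq (hm2.setIdx _ _) ?_)
  set m₀ := ((((((m.setIdx 3 (I.fl (v j))).setIdx 4 ((m.setIdx 3 (I.fl (v j))).idx 3)).setIdx 4
    (((m.setIdx 3 (I.fl (v j))).setIdx 4 ((m.setIdx 3 (I.fl (v j))).idx 3)).idx 4 + 1)).set 9 2
    (1 - I.del (I.fl (v j)))).set 10 2 (1 / I.sp (I.fl (v j) + 1))).setIdx 7 _).setIdx 7 _ with hm₀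
  have hb₀ : I.Loaded v m₀ := by
    refine hb.congr (fun x hx => ?_) fun a ha => ?_
    · have : x ≠ 3 ∧ x ≠ 4 ∧ x ≠ 7 := by omega
      simp [hm₀, Store.setIdx, Store.set, this]
    · have : a ≠ 9 ∧ a ≠ 10 := by omega
      simp [hm₀, Store.setIdx, Store.set, this]
  have h5 : m₀.idx 5 = j := by simp [hm₀, Store.setIdx, Store.set, hj]
  have h7 : m₀.idx 7 = j + 1 := by simp [hm₀, Store.setIdx, Store.set, hj]
  have h9 : m₀.num 9 0 = 1 - I.del (I.fl (v j)) := by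
    simp [hm₀, Store.setIdx, Store.set, hb.idx2]
  have h10 : m₀.num 10 0 = 1 / I.sp (I.fl (v j) + 1) := by
    simp [hm₀, Store.setIdx, Store.set, hb.idx2]
  have hmG : m₀.InG G := hm2
  clear_value m₀
  -- Gain and next event are kept as if the chain ended at the counter `7`. The loop test is exactly
  -- the link condition, and the sentinel makes it fail at `n`.
  refine Tri.loop_frame (fun N m' => j + 1 ≤ m'.idx 7 ∧ m'.idx 7 + N = I.chainEnd v j ∧
    m'.num 9 0 = (m'.idx 7 : ℝ) - j - I.del (I.fl (v j)) ∧
    1 / I.sp (I.fl (v j) + 1) ≤ m'.num 10 0 ∧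
    (∀ i, j.val < i → i < m'.idx 7 → 1 / v j - (I.done v i - I.rel i) ≤ m'.num 10 0) ∧
    (m'.num 10 0 = 1 / I.sp (I.fl (v j) + 1) ∨ ∃ i, j.val < i ∧ i < m'.idx 7 ∧
      m'.num 10 0 = 1 / v j - (I.done v i - I.rel i))) ?_ ?_ _ hmG ?_
  · rintro N m' hm' ⟨c1, c2, c3, c4, c5, c6⟩ fr hlt
    have hb' : I.Loaded v m' := hb₀.congr
      (fun x hx => fr.1 x (by revert x; decide)) fun a ha => fr.2 a (by revert a; decide)
    have h5' : m'.idx 5 = j := (fr.1 5 (by decide)).trans h5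
    have hl : I.Link v (m'.idx 7) := (hb'.link_iff (by omega)).1 hlt
    have hne : m'.idx 7 ≠ I.chainEnd v j := fun hc =>
      (next_mem hjn (not_link_n (v := v))).2 (by rw [hc] at hl; exact hl)
    obtain ⟨N', rfl⟩ : ∃ N', N = N' + 1 := ⟨N - 1, by omega⟩
    refine ⟨N', rfl, ?_⟩
    obtain ⟨-, -, -, b4, b5⟩ := hv.horizon_bound (m := m'.idx 7) (i := m'.idx 7) hl.1.le j
    have hlat := I.lattice.sub_mem (done_mem hL (m'.idx 7)) (rel_mem (I := I) (i := m'.idx 7))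
    refine Tri.arith_seq hm' ((m'.idx 7 : ℝ) + 1 - j - I.del (I.fl (v j))) ?_ ?_ fun hm1 => ?_
    · simp only [Arith.eval, Store.get, hb'.idx2, hb'.one, c3]
      ring
    · have := hG.gain (I.fl (v j)) (m'.idx 7 + 1 - j) (by omega)
      rw [Nat.cast_sub (by omega)] at this
      push_cast at this
      exact this
    refine Tri.arith_seq hm1 (I.done v (m'.idx 7) - I.rel (m'.idx 7)) ?_ (hG.time _ hlat b4)
      fun hm2 => ?_
    · simp [Arith.eval, Store.get, Store.set, hb'.done _ hl.1.le, hb'.rel _ hl.1]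
    refine Tri.arith_seq hm2 (1 / v j - (I.done v (m'.idx 7) - I.rel (m'.idx 7))) ?_
      (hG.time _ (I.lattice.sub_mem (hL j) hlat) b5) fun hm3 => ?_
    · have := hb'.x j
      simp [Arith.eval, Store.get, Store.set, hb'.idx2, h5', this]
    refine Tri.seq (t := 2) (t' := 1) (R := fun m'' => m''.idx 7 = m'.idx 7 ∧
      m''.num 9 0 = (m'.idx 7 : ℝ) + 1 - j - I.del (I.fl (v j)) ∧
      m''.num 10 0 = max (m'.num 10 0) (1 / v j - (I.done v (m'.idx 7) - I.rel (m'.idx 7)))) ?_ ?_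
    · refine Tri.cond (t := 1) hm3 (fun hlt => ?_) fun hlt => ?_
      · refine Tri.arith_val hm3 (1 / v j - (I.done v (m'.idx 7) - I.rel (m'.idx 7))) ?_
          (hG.time _ (I.lattice.sub_mem (hL j) hlat) b5) ?_
        · simp [Arith.eval, Store.get, Store.set, hb'.idx2, hb'.zero]
        · simp only [Test.Holds, Store.get, Store.set, hb'.idx2] at hlt
          refine ⟨by simp [Store.set], by simp [Store.set, hb'.idx2], ?_⟩
          rw [max_eq_right (by simpa using hlt.le)]
          simp [Store.set, hb'.idx2]
      · refine Tri.skip hm3 ⟨by simp [Store.set], by simp [Store.set, hb'.idx2], ?_⟩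
        simp only [Test.Holds, Store.get, Store.set, hb'.idx2] at hlt
        rw [max_eq_left (by simpa using hlt)]
        simp [Store.set]
    · rintro m'' hm'' ⟨d1, d2, d3⟩
      refine Tri.inc hm'' ?_
      have e7 : (m''.setIdx 7 (m''.idx 7 + 1)).idx 7 = m'.idx 7 + 1 := by simp [Store.setIdx, d1]
      have e9 : (m''.setIdx 7 (m''.idx 7 + 1)).num = m''.num := rfl
      rw [e7, e9, d2, d3]
      refine ⟨by omega, by omega, by push_cast; ring, c4.trans (le_max_left _ _), fun i hi hi' => ?_,
        ?_⟩
      · rcases (Nat.le_of_lt_succ hi').eq_or_lt with rfl | hi'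
        · exact le_max_right _ _
        · exact (c5 i hi hi').trans (le_max_left _ _)
      · rcases max_choice (m'.num 10 0)
          (1 / v j - (I.done v (m'.idx 7) - I.rel (m'.idx 7))) with e | e
        · rw [e]
          exact c6.imp id fun ⟨i, h1, h2, h3⟩ => ⟨i, h1, by omega, h3⟩
        · rw [e]
          exact Or.inr ⟨m'.idx 7, by omega, by omega, rfl⟩
  · rintro N m' hm' ⟨c1, c2, c3, c4, c5, c6⟩ fr hlt
    have hb' : I.Loaded v m' := hb₀.congr
      (fun x hx => fr.1 x (by revert x; decide)) fun a ha => fr.2 a (by revert a; decide)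
    have hl : ¬ I.Link v (m'.idx 7) := fun hc => hlt ((hb'.link_iff (by omega)).2 hc)
    have he : m'.idx 7 = I.chainEnd v j := by
      by_contra hne
      exact hl (of_lt_next (by omega) (show m'.idx 7 < I.chainEnd v j by omega))
    rw [he] at c3 c5 c6
    exact ⟨c3, c4, c5, c6⟩
  · rw [h7, h9, h10]
    refine ⟨le_rfl, by omega, by push_cast; ring, le_rfl, fun i h1 h2 => by omega, Or.inl rfl⟩

lemma computeDone_tri (hG : I.Covers G) (hm : m.InG G) (hb : I.Base v m) (hv : I.InRange v)
    (hL : I.InLattice v) (hn : 0 < I.n) :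
    Tri G computeDone m (6 * I.n + 3) (fun m' => I.Loaded v m' ∧ m'.idx 6 = m.idx 6) := by
  suffices h : Tri G computeDone m (6 * I.n + 3) (fun m' => (∀ i < I.n, m'.num 0 i = I.rel i) ∧
      (∀ i ≤ I.n, m'.num 4 i = I.done v i) ∧ m'.num 0 I.n = I.done v I.n) by
    refine h.frame.mono le_rfl fun m' _ h => ⟨⟨?_, h.1.2.1, h.1.2.2⟩, h.2.1 6 (by decide)⟩
    have hi : ∀ x < 3, m'.idx x = m.idx x := fun x hx => h.2.1 x (by revert x; decide)
    have hn : ∀ a, a = 3 ∨ a = 5 ∨ a = 6 ∨ a = 7 ∨ a = 8 → m'.num a = m.num a := fun a ha =>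
      h.2.2 a (by rcases ha with rfl | rfl | rfl | rfl | rfl <;> decide)
    -- The array of release times has been changed, but only at the sentinel position `n`, about
    -- which `Base` says nothing.
    constructor
    · rw [hi 0 (by norm_num), hb.idx0]
    · rw [hi 1 (by norm_num), hb.idx1]
    · rw [hi 2 (by norm_num), hb.idx2]
    · exact h.1.1
    · rw [hn 3 (by simp)]
      exact hb.x
    · rw [h.1.2.1 0 (Nat.zero_le _)]
      rfl
    · rw [hn 5 (by simp)]
      exact hb.inv
    · rw [hn 6 (by simp)]
      exact hb.del
    · rw [hn 7 (by simp)]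
      exact hb.zero
    · rw [hn 8 (by simp)]
      exact hb.one
  have hdoneG : ∀ i ≤ I.n, I.done v i ∈ G := fun i hi => hG.time _ (done_mem hL i) (by
    rw [abs_of_nonneg (done_nonneg hv.pos i)]
    exact (hv.horizon_bound (i := 0) hi ⟨0, hn⟩).1)
  refine Tri.of_le (Tri.zero_seq hm (Tri.seq (t := I.n * (5 + 1) + 1) (t' := 1)
    (R := fun m' => m'.idx 5 = I.n ∧ (∀ i ≤ I.n, m'.num 4 i = I.done v i) ∧
      m'.num 0 = m.num 0 ∧ m'.num 7 = m.num 7 ∧ m'.idx 2 = m.idx 2) ?_ ?_)) (by omega)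
  · refine Tri.loop_frame (fun N m' => m'.idx 5 + N = I.n ∧
      ∀ i ≤ m'.idx 5, m'.num 4 i = I.done v i) ?_ ?_ _ (hm.setIdx _ _) ?_
    · rintro N m' hm' ⟨c1, c2⟩ fr hlt
      have h0 : m'.idx 0 = I.n := (fr.1 0 (by decide)).trans (by simp [Store.setIdx, hb.idx0])
      have n0 : m'.num 0 = m.num 0 := fr.2 0 (by decide)
      have n3 : m'.num 3 = m.num 3 := fr.2 3 (by decide)
      have hlt' : m'.idx 5 < I.n := by
        have : m'.idx 5 < m'.idx 0 := hlt
        omega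
      obtain ⟨N', rfl⟩ : ∃ N', N = N' + 1 := ⟨N - 1, by omega⟩
      refine ⟨N', rfl, ?_⟩
      have hd := done_succ v ⟨m'.idx 5, hlt'⟩
      rw [← rel_val] at hd
      simp only at hd
      have hx := hb.x ⟨m'.idx 5, hlt'⟩
      simp only at hx
      have hr := hb.rel _ hlt'
      refine Tri.copy_seq hm' (Tri.inc_seq (hm'.setIdx _ _) (Tri.seq (t := 2) (t' := 1)
        (R := fun m'' => m''.idx 5 = m'.idx 5 ∧ m''.num 4 (m'.idx 5 + 1) = I.done v (m'.idx 5 + 1) ∧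
          ∀ i ≤ m'.idx 5, m''.num 4 i = I.done v i) ?_ ?_))
      · have hR : ∀ z, z = I.done v (m'.idx 5 + 1) →
            (fun m'' : Store => m''.idx 5 = m'.idx 5 ∧
              m''.num 4 (m'.idx 5 + 1) = I.done v (m'.idx 5 + 1) ∧
              ∀ i ≤ m'.idx 5, m''.num 4 i = I.done v i)
              ((((m'.setIdx 4 (m'.idx 5)).setIdx 4 ((m'.setIdx 4 (m'.idx 5)).idx 4 + 1))).set 4 4
                z) := by
          rintro z rfl
          refine ⟨by simp [Store.set, Store.setIdx], by simp [Store.set, Store.setIdx],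
            fun i hi => ?_⟩
          have : i ≠ m'.idx 5 + 1 := by omega
          simp [Store.set, Store.setIdx, this, c2 i hi]
        refine Tri.cond (t := 1) ((hm'.setIdx _ _).setIdx _ _) (fun hlt => ?_) fun hlt => ?_
        · have hlt2 : I.done v (m'.idx 5) < I.rel (m'.idx 5) := by
            simpa [Test.Holds, Store.get, Store.setIdx, n0, hr, c2 _ le_rfl] using hlt
          refine Tri.arith_val ((hm'.setIdx _ _).setIdx _ _) (I.done v (m'.idx 5 + 1)) ?_ (hdoneG _ hlt')
            (hR _ rfl)
          rw [hd, max_eq_left hlt2.le]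
          simp [Arith.eval, Store.get, Store.setIdx, n0, n3, hr, hx]
        · have hlt2 : ¬ I.done v (m'.idx 5) < I.rel (m'.idx 5) := by
            simpa [Test.Holds, Store.get, Store.setIdx, n0, hr, c2 _ le_rfl] using hlt
          refine Tri.arith_val ((hm'.setIdx _ _).setIdx _ _) (I.done v (m'.idx 5 + 1)) ?_ (hdoneG _ hlt')
            (hR _ rfl)
          rw [hd, max_eq_right (not_lt.1 hlt2)]
          simp [Arith.eval, Store.get, Store.setIdx, n3, c2 _ le_rfl, hx]
      · rintro m'' hm'' ⟨d1, d2, d3⟩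
        refine Tri.inc hm'' ⟨by simp [Store.setIdx, d1]; omega, fun i hi => ?_⟩
        simp only [Store.setIdx, Function.update_self, d1] at hi ⊢
        rcases hi.eq_or_lt with rfl | hi
        · exact d2
        · exact d3 i (by omega)
    · rintro N m' hm' ⟨c1, c2⟩ fr hlt
      have h0 : m'.idx 0 = I.n := (fr.1 0 (by decide)).trans (by simp [Store.setIdx, hb.idx0])
      have hlt' : ¬ m'.idx 5 < m'.idx 0 := hlt
      have h5 : m'.idx 5 = I.n := by omega
      rw [h5] at c2
      exact ⟨h5, c2, fr.2 0 (by decide), fr.2 7 (by decide), fr.1 2 (by decide)⟩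
    · refine ⟨by simp [Store.setIdx], fun i hi => ?_⟩
      simp only [Store.setIdx, Function.update_self, Nat.le_zero] at hi
      subst hi
      exact hb.done0
  · rintro m' hm' ⟨c1, c2, c3, c4, c5⟩
    refine Tri.arith_val hm' (I.done v I.n) ?_ (hdoneG _ le_rfl) ⟨fun i hi => ?_, fun i hi => ?_, ?_⟩
    · simp [Arith.eval, Store.get, c1, c2 _ le_rfl, c4, c5, hb.idx2, hb.zero]
    · simp [Store.set, c1, hi.ne, c3, hb.rel i hi]
    · simpa [Store.set] using c2 i hi
    · simp [Store.set, c1]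

end Inst

end SpeedScaling

end

/-! ### Correctness of selection, main loop, output and setup -/

noncomputable section

namespace SpeedScaling

namespace Inst

variable {I : Inst} {ρ : Rule} {v : Fin I.n → ℝ} {G : Set ℝ} {m : Store}

/-- The job `b` is selected: `12` and `13` hold its gain and its next event. -/
def Selected (I : Inst) (v : Fin I.n → ℝ) (b : Fin I.n) (m : Store) : Prop :=
  m.idx 6 = b ∧ m.num 12 0 = I.rgain v b ∧ I.IsNextEvent v b (m.num 13 0)

/-- The steps of `evalJob`. -/
def evalCost (I : Inst) : ℕ := 7 * I.n + 2 * I.k + 9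

/-- The strict test matters: the selection moves only to a job of larger gain, and then the former
job may not be raised further. -/
lemma compareJob_tri (hG : I.Covers G) (hm : m.InG G) (hb : I.Loaded v m) (hv : I.InRange v)
    (hL : I.InLattice v) {j b : Fin I.n} (hj : m.idx 5 = j) (hs : I.Selected v b m) :
    Tri G compareJob m (I.evalCost + 5) (fun m' => I.Loaded v m' ∧ m'.idx 5 = m.idx 5 + 1 ∧
      ∃ b', I.Selected v b' m' ∧ (b' = b ∨ I.rgain v b < I.rgain v b') ∧
        I.rgain v j ≤ I.rgain v b') := by
  refine Tri.seq (t' := 4 + 1) (evalJob_tri hG hm hb hv hL hj) ?_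
  rintro m₁ hm₁ ⟨hb₁, h5, h6, h12, h13, h9, h10⟩
  refine Tri.seq (t := 3 + 1) (R := fun m' => I.Loaded v m' ∧ m'.idx 5 = m.idx 5 ∧
      ∃ b', I.Selected v b' m' ∧ (b' = b ∨ I.rgain v b < I.rgain v b') ∧
        I.rgain v j ≤ I.rgain v b') ?_ ?_
  · refine Tri.cond hm₁ (fun hlt => ?_) fun hlt => ?_
    · have hlt' : I.rgain v b < I.rgain v j := by
        simpa [Test.Holds, Store.get, hb₁.idx2, h12, hs.2.1, h9] using hlt
      refine Tri.copy_seq hm₁ (Tri.arith_seq (hm₁.setIdx _ _) (m₁.num 9 0) ?_ (hm₁ 9 0)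
        fun hm₂ => Tri.arith_val hm₂ (m₁.num 10 0) ?_ (hm₁ 10 0) ?_)
      · simp [Arith.eval, Store.get, Store.setIdx, hb₁.idx2, hb₁.zero]
      · simp [Arith.eval, Store.get, Store.setIdx, Store.set, hb₁.idx2, hb₁.zero]
      · refine ⟨hb₁.congr (fun x hx => ?_) (fun a ha => ?_), by simp [Store.setIdx, Store.set, h5],
          j, ⟨?_, ?_, ?_⟩, Or.inr hlt', le_rfl⟩
        · have : x ≠ 6 := by omega
          simp [Store.setIdx, Store.set, this]
        · have : a ≠ 12 ∧ a ≠ 13 := by omega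
          simp [Store.setIdx, Store.set, this]
        · simp [Store.setIdx, Store.set, h5, hj]
        · simp [Store.setIdx, Store.set, hb₁.idx2, h9]
        · simpa [Store.setIdx, Store.set, hb₁.idx2] using h10
    · have hlt' : ¬ I.rgain v b < I.rgain v j := by
        simpa [Test.Holds, Store.get, hb₁.idx2, h12, hs.2.1, h9] using hlt
      refine Tri.of_le (Tri.skip hm₁ ⟨hb₁, h5, b, ⟨?_, ?_, ?_⟩, Or.inl rfl, not_lt.1 hlt'⟩)
        (by omega)
      · rw [h6, hs.1]
      · rw [h12, hs.2.1]
      · rw [h13]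
        exact hs.2.2
  · rintro m₂ hm₂ ⟨hb₂, h5', b', hsel, hb', hj'⟩
    refine Tri.inc hm₂ ⟨hb₂.congr (fun x hx => ?_) (fun a ha => rfl), ?_, b', ?_, hb', hj'⟩
    · have : x ≠ 5 := by omega
      simp [Store.setIdx, this]
    · simp [Store.setIdx, h5']
    · simpa [Selected, Store.setIdx] using hsel

/-- The steps of `select`. -/
def selectCost (I : Inst) : ℕ :=
  6 * I.n + 3 + (I.evalCost + (I.n * (I.evalCost + 5 + 1) + 1 + 3) + 1)

/-- The scan starts from the job selected last, so that among ties an unfinished iteration is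
continued. `Midway.select` relies on this. -/
lemma select_tri (hG : I.Covers G) (hm : m.InG G) (hb : I.Base v m) (hv : I.InRange v)
    (hL : I.InLattice v) {b : Fin I.n} (hsel : m.idx 6 = b) :
    Tri G select m I.selectCost (fun m' => (I.Base v m' ∧ ∃ b', I.Selected v b' m' ∧
      (b' = b ∨ I.rgain v b < I.rgain v b') ∧ ∀ j, I.rgain v j ≤ I.rgain v b') ∧
      m'.idx 8 = m.idx 8) := by
  suffices h : Tri G select m I.selectCost (fun m' => I.Base v m' ∧ ∃ b', I.Selected v b' m' ∧
      (b' = b ∨ I.rgain v b < I.rgain v b') ∧ ∀ j, I.rgain v j ≤ I.rgain v b') by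
    exact h.frame.mono le_rfl fun m' _ h => ⟨h.1, h.2.1 8 (by decide)⟩
  refine Tri.seq (computeDone_tri hG hm hb hv hL b.pos) ?_
  rintro m₁ hm₁ ⟨hb₁, h6⟩
  refine Tri.copy_seq hm₁ (Tri.seq (evalJob_tri hG (hm₁.setIdx _ _) (hb₁.congr (fun x hx => ?_)
    fun a ha => rfl) hv hL (j := b) (by simp [Store.setIdx, h6, hsel])) ?_)
  · have : x ≠ 5 := by omega
    simp [Store.setIdx, this]
  rintro m₂ hm₂ ⟨hb₂, -, h6', -, -, h9, h10⟩
  refine Tri.arith_seq hm₂ (m₂.num 9 0) ?_ (hm₂ 9 0) fun hm₃ =>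
    Tri.arith_seq hm₃ (m₂.num 10 0) ?_ (hm₂ 10 0) fun hm₄ => Tri.zero_seq hm₄ ?_
  · simp [Arith.eval, Store.get, hb₂.idx2, hb₂.zero]
  · simp [Arith.eval, Store.get, Store.set, hb₂.idx2, hb₂.zero]
  refine Tri.loop (fun N m' => I.Loaded v m' ∧ m'.idx 5 + N = I.n ∧ ∃ b', I.Selected v b' m' ∧
    (b' = b ∨ I.rgain v b < I.rgain v b') ∧ ∀ j : Fin I.n, j.val < m'.idx 5 →
      I.rgain v j ≤ I.rgain v b') ?_ ?_ I.n (hm₄.setIdx _ _) ?_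
  · rintro N m' hm' ⟨hb', c1, b', hs', c2, c3⟩ hlt
    have hlt' : m'.idx 5 < I.n := by
      have : m'.idx 5 < m'.idx 0 := hlt
      rwa [hb'.idx0] at this
    obtain ⟨N', rfl⟩ : ∃ N', N = N' + 1 := ⟨N - 1, by omega⟩
    refine ⟨N', rfl, (compareJob_tri hG hm' hb' hv hL (j := ⟨m'.idx 5, hlt'⟩) rfl hs').mono le_rfl ?_⟩
    rintro m'' - ⟨hb'', h5, b'', hs'', d1, d2⟩
    have hle : I.rgain v b' ≤ I.rgain v b'' := by
      rcases d1 with rfl | d1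
      · exact le_rfl
      · exact d1.le
    refine ⟨hb'', by omega, b'', hs'', ?_, fun j hj => ?_⟩
    · rcases d1 with rfl | d1
      · exact c2
      · rcases c2 with rfl | c2
        · exact Or.inr d1
        · exact Or.inr (c2.trans d1)
    · rw [h5] at hj
      rcases (Nat.le_of_lt_succ hj).eq_or_lt with hj | hj
      · have : j = ⟨m'.idx 5, hlt'⟩ := Fin.ext hj
        rw [this]
        exact d2
      · exact (c3 j hj).trans hle
  · rintro N m' hm' ⟨hb', c1, b', hs', c2, c3⟩ hlt
    have hlt' : ¬ m'.idx 5 < I.n := by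
      have : ¬ m'.idx 5 < m'.idx 0 := hlt
      rwa [hb'.idx0] at this
    exact ⟨hb'.toBase, b', hs', c2, fun j => c3 j (by have := j.isLt; omega)⟩
  · refine ⟨hb₂.congr (fun x hx => ?_) (fun a ha => ?_), by simp [Store.setIdx], b, ⟨?_, ?_, ?_⟩,
      Or.inl rfl, fun j hj => ?_⟩
    · have : x ≠ 5 := by omega
      simp [Store.setIdx, Store.set, this]
    · have : a ≠ 12 ∧ a ≠ 13 := by omega
      simp [Store.setIdx, Store.set, this]
    · simp only [Store.setIdx, Store.set] at h6' ⊢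
      simpa [h6, hsel] using h6'
    · simp [Store.setIdx, Store.set, hb₂.idx2, h9]
    · simpa [Store.setIdx, Store.set, hb₂.idx2] using h10
    · simp [Store.setIdx] at hj

/-- The invariant of the main loop. -/
def MainInv (I : Inst) (ρ : Rule) (N : ℕ) (m : Store) : Prop :=
  ∃ v : Fin I.n → ℝ, I.Base v m ∧ I.InRange v ∧ I.InLattice v ∧
    ((m.idx 8 = 1 ∧ I.n * I.k + I.n + 1 ≤ N + I.events v ∧
        ∃ b : Fin I.n, m.idx 6 = b ∧ I.Midway ρ v b) ∨
      (m.idx 8 = 0 ∧ (∃ M, I.Run ρ M v) ∧ I.Halted ρ v))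

lemma Base.set_x (hb : I.Base v m) {b : Fin I.n} (h6 : m.idx 6 = b) {c : ℝ} :
    I.Base (Function.update v b (1 / c)) (m.set 3 6 c) := by
  refine ⟨hb.idx0, hb.idx1, hb.idx2, ?_, fun j => ?_, ?_, ?_, ?_, ?_, ?_⟩
  · simpa [Store.set] using hb.rel
  · by_cases h : j = b
    · subst h
      simp [Store.set, h6]
    · have h' : (j : ℕ) ≠ b := fun hc => h (Fin.ext hc)
      have := hb.x j
      simp [Store.set, h6, h, h', this]
  · simpa [Store.set] using hb.done0
  · simpa [Store.set] using hb.inv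
  · simpa [Store.set] using hb.del
  · simpa [Store.set] using hb.zero
  · simpa [Store.set] using hb.one

/-- The selected gain is maximum, so its activity decides between a raise and halting. In the weak
variant the branches are exchanged because only strict comparisons are available. -/
lemma decideStep_tri (hm : m.InG G) (hb : I.Base v m) (hv : I.InRange v)
    (hL : I.InLattice v) {b : Fin I.n} (hs : I.Selected v b m) (hmax : ∀ j, I.rgain v j ≤ I.rgain v b)
    (hmid : I.Midway ρ v b) (h8 : m.idx 8 = 1) {N : ℕ}
    (hN : I.n * I.k + I.n + 1 ≤ N + 1 + I.events v) :
    Tri G (decideStep ρ) m 2 (I.MainInv ρ N) := by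
  have hact : ρ.RActive (I.rgain v b) →
      Tri G (.arith .add 3 6 13 2 7 2) m 1 (I.MainInv ρ N) := by
    intro ha
    have hcan : I.CanRaise ρ v b := ⟨ha, hmax⟩
    have hk := fl_lt_of_rgain_nonneg ha.nonneg
    have hmid' := hmid.raise hcan hs.2.2
    have hc := hs.2.2.mem_lattice hL hk
    have hev := hs.2.2.events_lt hv hk
    refine Tri.arith_val hm (m.num 13 0) ?_ (hm 13 0)
      ⟨_, hb.set_x hs.1, hmid'.1, fun j => ?_, Or.inl ⟨h8, by omega, b, hs.1, hmid'⟩⟩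
    · simp [Arith.eval, Store.get, hb.idx2, hb.zero]
    · by_cases h : j = b
      · subst h
        rwa [Function.update_self, one_div_one_div]
      · rw [Function.update_of_ne h]
        exact hL j
  have hinact : ¬ ρ.RActive (I.rgain v b) → Tri G (.zero 8) m 1 (I.MainInv ρ N) := by
    intro ha
    refine Tri.zero hm ⟨v, hb.congr (fun x hx => ?_) (fun a _ => rfl), hv, hL, Or.inr ⟨?_, ?_, ?_⟩⟩
    · have : x ≠ 8 := by omega
      simp [Store.setIdx, this]
    · simp [Store.setIdx]
    · exact hmid.run fun hc => ha hc.1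
    · exact (halted_iff hv).2 fun j hj => ha (hj.mono (hmax j))
  cases ρ with
  | positive =>
    refine Tri.cond (t := 1) hm (fun h => hact ?_) fun h => hinact ?_
    all_goals
      simpa [Test.Holds, Store.get, hb.idx2, hb.zero, hs.2.1, Rule.RActive] using h
  | nonneg =>
    refine Tri.cond (t := 1) hm (fun h => hinact ?_) fun h => hact ?_
    all_goals
      simpa [Test.Holds, Store.get, hb.idx2, hb.zero, hs.2.1, Rule.RActive] using h

lemma main_loop_tri (hG : I.Covers G) (hm : m.InG G) {N : ℕ} (h : I.MainInv ρ N m) :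
    Tri G (.loop (.idxLt 2 8) (.seq select (decideStep ρ))) m (N * (I.selectCost + 2 + 1) + 1)
      (fun m' => ∃ v : Fin I.n → ℝ, I.Base v m' ∧ I.InRange v ∧ I.InLattice v ∧
        (∃ M, I.Run ρ M v) ∧ I.Halted ρ v) := by
  refine Tri.loop (I.MainInv ρ) ?_ ?_ N hm h
  · rintro N m' hm' ⟨v, hb, hv, hL, h⟩ hlt
    have hlt' : m'.idx 2 < m'.idx 8 := hlt
    rw [hb.idx2] at hlt'
    rcases h with ⟨h8, hN, b, h6, hmid⟩ | ⟨h8, -⟩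
    -- There are at most `n k + n` events, so the budget is still positive. The extra 1 in it pays
    -- for the last pass, which only halts.
    · have := events_le v
      obtain ⟨N', rfl⟩ : ∃ N', N = N' + 1 := ⟨N - 1, by omega⟩
      refine ⟨N', rfl, Tri.seq (select_tri hG hm' hb hv hL h6) ?_⟩
      rintro m'' hm'' ⟨⟨hb'', b', hs, hsel, hmax⟩, h8'⟩
      exact decideStep_tri hm'' hb'' hv hL hs hmax (hmid.select hsel) (h8'.trans h8) hN
    · omega
  · rintro N m' hm' ⟨v, hb, hv, hL, h⟩ hlt
    have hlt' : ¬ m'.idx 2 < m'.idx 8 := hlt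
    rw [hb.idx2] at hlt'
    rcases h with ⟨h8, -⟩ | ⟨-, h1, h2⟩
    · omega
    · exact ⟨v, hb, hv, hL, h1, h2⟩

lemma output_tri (hG : I.Covers G) (hm : m.InG G) (hb : I.Base v m) (hv : I.InRange v)
    (hL : I.InLattice v) :
    Tri G output m (I.n * (2 + 1) + 1 + 1) (fun m' => ∀ j : Fin I.n, m'.num 3 j = v j) := by
  refine Tri.zero_seq hm (Tri.loop_frame (fun N m' => m'.idx 5 + N = I.n ∧
    ∀ j : Fin I.n, m'.num 3 j = if j.val < m'.idx 5 then v j else 1 / v j) ?_ ?_ _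
    (hm.setIdx _ _) ?_)
  · rintro N m' hm' ⟨c1, c2⟩ fr hlt
    have h0 : m'.idx 0 = I.n := (fr.1 0 (by decide)).trans (by simp [Store.setIdx, hb.idx0])
    have h2 : m'.idx 2 = 0 := (fr.1 2 (by decide)).trans (by simp [Store.setIdx, hb.idx2])
    have h8 : m'.num 8 0 = 1 := by
      rw [fr.2 8 (by decide)]
      exact hb.one
    have hlt' : m'.idx 5 < I.n := by
      have : m'.idx 5 < m'.idx 0 := hlt
      omega
    obtain ⟨N', rfl⟩ : ∃ N', N = N' + 1 := ⟨N - 1, by omega⟩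
    have hx := c2 ⟨m'.idx 5, hlt'⟩
    simp only [lt_irrefl, if_false] at hx
    refine ⟨N', rfl, Tri.arith_seq hm' (v ⟨m'.idx 5, hlt'⟩) ?_ ?_ fun hm1 => Tri.inc hm1
      ⟨by simp [Store.setIdx, Store.set]; omega, fun j => ?_⟩⟩
    · simp [Arith.eval, Store.get, h2, h8, hx]
    · have := hG.inv _ (hL ⟨m'.idx 5, hlt'⟩) (hv.le_inv _) (hv.inv_le _)
      rwa [one_div_one_div] at this
    · by_cases h : j.val = m'.idx 5
      · have : j = ⟨m'.idx 5, hlt'⟩ := Fin.ext h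
        subst this
        simp [Store.setIdx, Store.set]
      · have := c2 j
        have h3 : (j.val < m'.idx 5 + 1) = (j.val < m'.idx 5) := propext (by omega)
        simp only [Store.setIdx, Store.set, Function.update_self, Function.update_of_ne h, h3]
        exact this
  · rintro N m' hm' ⟨c1, c2⟩ fr hlt j
    have h0 : m'.idx 0 = I.n := (fr.1 0 (by decide)).trans (by simp [Store.setIdx, hb.idx0])
    have hlt' : ¬ m'.idx 5 < m'.idx 0 := hlt
    rw [c2 j, if_pos (by have := j.isLt; omega)]
  · refine ⟨by simp [Store.setIdx], fun j => ?_⟩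
    have := hb.x j
    simpa [Store.setIdx] using this

lemma input_num_zero (i : ℕ) : I.input.num 0 i = I.rel i := rfl

lemma input_num_one (i : ℕ) : I.input.num 1 i = I.sp i := rfl

lemma input_num_two (i : ℕ) : I.input.num 2 i = I.pw i := rfl

lemma input_num_of_le {a : ℕ} (ha : 3 ≤ a) (i : ℕ) : I.input.num a i = 0 := by
  have : a ≠ 0 ∧ a ≠ 1 ∧ a ≠ 2 := by omega
  simp [Inst.input, this]

lemma horizon_ge : 1 / I.sp 1 ≤ I.horizon := by
  have h1 := inv_sp_one_pos (I := I)
  have h8 : 0 ≤ ∑ j, I.r j := Finset.sum_nonneg fun j _ => I.r_nonneg j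
  have h10 : (0 : ℝ) ≤ I.n * (1 / I.sp 1) := by positivity
  unfold horizon
  linarith

lemma Covers.inv_sp (hG : I.Covers G) {i : ℕ} (h0 : 0 < i) (hi : i ≤ I.k) : 1 / I.sp i ∈ G := by
  refine hG.time _ (inv_sp_mem h0 hi) ?_
  rw [abs_of_pos (one_div_pos.2 (sp_pos h0 hi))]
  exact (one_div_le_one_div_of_le (sp_pos one_pos I.k_pos) (sp_le h0 hi)).trans horizon_ge

/-- The constants of the levels below `i` are computed. -/
def LevelsReady (I : Inst) (i : ℕ) (m : Store) : Prop :=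
  (∀ i' < i, m.num 5 i' = 1 / I.sp i') ∧ (∀ i', i ≤ i' → m.num 5 i' = 0) ∧
    ∀ i', 0 < i' → i' < i → m.num 6 i' = I.del i'

lemma setupLevel_tri (hG : I.Covers G) (hm : m.InG G) (h2 : m.idx 2 = 0)
    (n1 : m.num 1 = I.input.num 1) (n2 : m.num 2 = I.input.num 2) (h8 : m.num 8 0 = 1)
    (h30 : 0 < m.idx 3) (h3 : m.idx 3 < I.k) (hr : I.LevelsReady (m.idx 3) m) :
    Tri G setupLevel m 9 (fun m' => m'.idx 3 = m.idx 3 + 1 ∧ I.LevelsReady (m.idx 3 + 1) m') := by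
  set i := m.idx 3 with hi
  refine Tri.copy_seq hm (Tri.inc_seq (hm.setIdx _ _) ?_)
  refine Tri.arith_seq ((hm.setIdx _ _).setIdx _ _) (1 / I.sp i) ?_ (hG.inv_sp h30 h3.le)
    fun hm1 => ?_
  · simp [Arith.eval, Store.get, Store.setIdx, h2, h8, n1, ← hi, input_num_one]
  refine Tri.arith_seq hm1 (I.pw (i + 1) * I.sp i) ?_ (hG.mul _ _) fun hm2 => ?_
  · simp [Arith.eval, Store.get, Store.setIdx, Store.set, n1, n2, ← hi, input_num_one,
      input_num_two]
  refine Tri.arith_seq hm2 (I.pw i * I.sp (i + 1)) ?_ (hG.mul _ _) fun hm3 => ?_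
  · simp [Arith.eval, Store.get, Store.setIdx, Store.set, n1, n2, ← hi, input_num_one,
      input_num_two]
  refine Tri.arith_seq hm3 (I.pw (i + 1) * I.sp i - I.pw i * I.sp (i + 1)) ?_ (hG.mul_sub _)
    fun hm4 => ?_
  · simp [Arith.eval, Store.get, Store.setIdx, Store.set, h2]
  refine Tri.arith_seq hm4 (I.sp (i + 1) - I.sp i) ?_ (hG.sub _) fun hm5 => ?_
  · simp [Arith.eval, Store.get, Store.setIdx, Store.set, n1, ← hi, input_num_one]
  refine Tri.arith_seq hm5 (I.del i) ?_ (hG.del _) fun hm6 => Tri.inc hm6 ⟨?_, ?_, ?_, ?_⟩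
  · simp [Arith.eval, Store.get, Store.setIdx, Store.set, h2, Inst.del, h3]
  · simp [Store.setIdx, Store.set, ← hi]
  · intro i' hi'
    by_cases h : i' = i
    · simp [Store.setIdx, Store.set, ← hi, h]
    · simpa [Store.setIdx, Store.set, ← hi, h] using hr.1 i' (by omega)
  · intro i' hi'
    have h : i' ≠ i := by omega
    simpa [Store.setIdx, Store.set, ← hi, h] using hr.2.1 i' (by omega)
  · intro i' h0 hi'
    by_cases h : i' = i
    · simp [Store.setIdx, Store.set, ← hi, h]
    · simpa [Store.setIdx, Store.set, ← hi, h] using hr.2.2 i' h0 (by omega)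

/-- The steps of `setup`. -/
def setupCost (I : Inst) : ℕ :=
  (I.k - 1) * (9 + 1) + 1 +
    (I.n * (2 + 1) + 1 + (I.n * (2 + 1) + 1 + 3) + 3) + 3

lemma setup_tri (hG : I.Covers G) :
    Tri G setup I.input I.setupCost (I.Base I.lowest) := by
  have hk := I.k_pos
  have hm : I.input.InG G := hG.input
  have hone : ((1 : ℕ) : ℝ) ∈ G := hG.nat 1 (by omega)
  refine Tri.const_seq hm hone fun hm1 => Tri.zero_seq hm1 (Tri.inc_seq (hm1.setIdx _ _) ?_)
  set m₀ := (((I.input.set 8 2 ((1 : ℕ) : ℝ)).setIdx 3 0).setIdx 3 _) with hm₀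
  have hmG : m₀.InG G := hm1
  have h3 : m₀.idx 3 = 1 := by simp [hm₀, Store.setIdx]
  have hidx : m₀.idx 0 = I.n ∧ m₀.idx 1 = I.k ∧ m₀.idx 2 = 0 := by
    simp [hm₀, Store.setIdx, Store.set, Inst.input]
  have h8 : m₀.num 8 0 = 1 := by
    simp [hm₀, Store.setIdx, Store.set, Inst.input]
  have hnum : ∀ a, a ≠ 8 → m₀.num a = I.input.num a := by
    intro a ha
    simp [hm₀, Store.setIdx, Store.set, ha]
  clear_value m₀
  refine Tri.seq (R := fun m' => m'.idx 3 = I.k ∧ I.LevelsReady I.k m' ∧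
    m'.idx 0 = I.n ∧ m'.idx 2 = 0 ∧ m'.idx 1 = I.k ∧ m'.num 8 0 = 1 ∧
    ∀ a, a < 5 ∨ a = 7 → m'.num a = I.input.num a) ?_ ?_
  · refine Tri.loop_frame (fun N m' => 0 < m'.idx 3 ∧ m'.idx 3 + N = I.k ∧
      I.LevelsReady (m'.idx 3) m') ?_ ?_ _ hmG ?_
    · rintro N m' hm' ⟨c1, c2, c3⟩ fr hlt
      have hlt' : m'.idx 3 < I.k := by
        have : m'.idx 3 < m'.idx 1 := hlt
        rwa [fr.1 1 (by decide), hidx.2.1] at this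
      obtain ⟨N', rfl⟩ : ∃ N', N = N' + 1 := ⟨N - 1, by omega⟩
      refine ⟨N', rfl, (setupLevel_tri hG hm' ((fr.1 2 (by decide)).trans hidx.2.2)
        ((fr.2 1 (by decide)).trans (hnum 1 (by norm_num)))
        ((fr.2 2 (by decide)).trans (hnum 2 (by norm_num)))
        (by rw [fr.2 8 (by decide)]; exact h8) c1 hlt' c3).mono le_rfl ?_⟩
      rintro m'' - ⟨d1, d2⟩
      rw [d1]
      exact ⟨by omega, by omega, d2⟩
    · rintro N m' hm' ⟨c1, c2, c3⟩ fr hlt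
      have hlt' : ¬ m'.idx 3 < I.k := by
        have : ¬ m'.idx 3 < m'.idx 1 := hlt
        rwa [fr.1 1 (by decide), hidx.2.1] at this
      have h3 : m'.idx 3 = I.k := by omega
      rw [h3] at c3
      refine ⟨h3, c3, (fr.1 0 (by decide)).trans hidx.1, (fr.1 2 (by decide)).trans hidx.2.2,
        (fr.1 1 (by decide)).trans hidx.2.1, by rw [fr.2 8 (by decide)]; exact h8, fun a ha => ?_⟩
      rw [fr.2 a, hnum a (by omega)]
      simp only [setupLevel, Cmd.numWrites, List.nil_append, List.append_nil, List.cons_append,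
        List.mem_cons, List.not_mem_nil, or_false]
      omega
    · rw [h3]
      refine ⟨one_pos, by omega, fun i' hi' => ?_, fun i' _ => ?_, fun i' h0 hi' => by omega⟩
      -- The entry for level 0 is never written; its initial value 0 equals `1 / sp 0`.
      · obtain rfl : i' = 0 := by omega
        rw [hnum 5 (by norm_num), input_num_of_le (by norm_num), sp_zero, div_zero]
      · rw [hnum 5 (by norm_num), input_num_of_le (by norm_num)]
  rintro m₁ hm₁ ⟨c3, cr, c0, c2, c1, c8, cn⟩
  refine Tri.arith_seq hm₁ (1 / I.sp I.k) ?_ (hG.inv_sp hk le_rfl) fun hm₂ =>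
    Tri.const_seq hm₂ hone fun hm₃ => Tri.zero_seq hm₃ ?_
  · simp [Arith.eval, Store.get, c2, c8, cn 1 (by norm_num), input_num_one, c3]
  set m₂ := (((m₁.set 5 3 (1 / I.sp I.k)).set 6 3 ((1 : ℕ) : ℝ)).setIdx 4 0) with hm₂'
  have hmG₂ : m₂.InG G := hm₃
  have d4 : m₂.idx 4 = 0 := by simp [hm₂', Store.setIdx]
  have d3 : m₂.idx 3 = I.k := by simp [hm₂', Store.setIdx, Store.set, c3]
  have d0 : m₂.idx 0 = I.n := by simp [hm₂', Store.setIdx, Store.set, c0]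
  have d1 : m₂.idx 1 = I.k := by simp [hm₂', Store.setIdx, Store.set, c1]
  have d2 : m₂.idx 2 = 0 := by simp [hm₂', Store.setIdx, Store.set, c2]
  have d8 : m₂.num 8 0 = 1 := by simp [hm₂', Store.setIdx, Store.set, c8]
  have dn : ∀ a, a < 5 ∨ a = 7 → m₂.num a = I.input.num a := by
    intro a ha
    have : a ≠ 5 ∧ a ≠ 6 := by omega
    simp [hm₂', Store.setIdx, Store.set, this, cn a ha]
  have d5 : ∀ i ≤ I.k + 1, m₂.num 5 i = 1 / I.sp i := by
    intro i hi
    rcases lt_trichotomy i I.k with h | h | h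
    · simpa [hm₂', Store.setIdx, Store.set, c3, h.ne] using cr.1 i h
    · simp [hm₂', Store.setIdx, Store.set, c3, h]
    · have hsp : I.sp i = 0 := by
        have : ¬ i < I.k + 1 := by omega
        simp [sp, this]
      simpa [hm₂', Store.setIdx, Store.set, c3, h.ne', hsp] using cr.2.1 i h.le
  have d6 : ∀ i, 0 < i → i < I.k → m₂.num 6 i = I.del i := by
    intro i h0 hi
    simpa [hm₂', Store.setIdx, Store.set, c3, hi.ne] using cr.2.2 i h0 hi
  have d6k : m₂.num 6 I.k = 1 := by simp [hm₂', Store.setIdx, Store.set, c3]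
  clear_value m₂
  -- The value `n + 1` at the highest level is built by `n` additions of one, because a counter
  -- cannot be turned into a number.
  refine Tri.seq (R := fun m' => (∀ i, 0 < i → i ≤ I.k → m'.num 6 i = I.del i) ∧
    (∀ x < 3, m'.idx x = m₂.idx x) ∧ ∀ a, a ≠ 6 → m'.num a = m₂.num a) ?_ ?_
  · refine Tri.loop_frame (fun N m' => m'.idx 4 + N = I.n ∧
      m'.num 6 I.k = ((m'.idx 4 + 1 : ℕ) : ℝ) ∧
      ∀ i, 0 < i → i < I.k → m'.num 6 i = I.del i) ?_ ?_ _ hmG₂ ?_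
    · rintro N m' hm' ⟨e1, e2, e3⟩ fr hlt
      have hlt' : m'.idx 4 < I.n := by
        have : m'.idx 4 < m'.idx 0 := hlt
        rwa [fr.1 0 (by decide), d0] at this
      have f3 : m'.idx 3 = I.k := (fr.1 3 (by decide)).trans d3
      have f2 : m'.idx 2 = 0 := (fr.1 2 (by decide)).trans d2
      have f8 : m'.num 8 0 = 1 := by
        rw [fr.2 8 (by decide)]
        exact d8
      obtain ⟨N', rfl⟩ : ∃ N', N = N' + 1 := ⟨N - 1, by omega⟩
      refine ⟨N', rfl, Tri.arith_seq hm' ((m'.idx 4 + 1 + 1 : ℕ) : ℝ) ?_ (hG.nat _ (by omega))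
        fun hm1 => Tri.inc hm1 ⟨?_, ?_, fun i h0 hi => ?_⟩⟩
      · simp [Arith.eval, Store.get, f3, e2, f2, f8]
      · simp [Store.setIdx, Store.set]
        omega
      · simp [Store.setIdx, Store.set, f3]
      · simpa [Store.setIdx, Store.set, f3, hi.ne] using e3 i h0 hi
    · rintro N m' hm' ⟨e1, e2, e3⟩ fr hlt
      have hlt' : ¬ m'.idx 4 < I.n := by
        have : ¬ m'.idx 4 < m'.idx 0 := hlt
        rwa [fr.1 0 (by decide), d0] at this
      have e4 : m'.idx 4 = I.n := by omega
      refine ⟨fun i h0 hi => ?_, fun x hx => fr.1 x (by revert x; decide), fun a ha => fr.2 a ?_⟩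
      · rcases hi.eq_or_lt with rfl | hi
        · rw [e2, e4, del_top le_rfl]
          push_cast
          rfl
        · exact e3 i h0 hi
      · simpa [Cmd.numWrites] using ha
    · rw [d4, d6k]
      exact ⟨by omega, by simp, d6⟩
  rintro m₃ hm₃ ⟨e6, ei, en⟩
  refine Tri.zero_seq hm₃ (Tri.inc_seq (hm₃.setIdx _ _) (Tri.zero_seq
    ((hm₃.setIdx _ _).setIdx _ _) ?_))
  set m₄ := (((m₃.setIdx 9 0).setIdx 9 _).setIdx 5 0) with hm₄
  have g9 : m₄.idx 9 = 1 := by simp [hm₄, Store.setIdx]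
  have g5 : m₄.idx 5 = 0 := by simp [hm₄, Store.setIdx]
  have gi : ∀ x < 3, m₄.idx x = m₂.idx x := by
    intro x hx
    have : x ≠ 9 ∧ x ≠ 5 := by omega
    simp [hm₄, Store.setIdx, this, ei x hx]
  have gn : ∀ a, a ≠ 6 → m₄.num a = m₂.num a := en
  have g6 : ∀ i, 0 < i → i ≤ I.k → m₄.num 6 i = I.del i := e6
  have hmG₄ : m₄.InG G := hm₃
  clear_value m₄
  have hlow : ∀ j, I.lowest j = I.sp 1 := by simp [lowest, sp, hk]
  refine Tri.loop_frame (fun N m' => m'.idx 5 + N = I.n ∧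
    ∀ j < m'.idx 5, m'.num 3 j = 1 / I.sp 1) ?_ ?_ _ hmG₄ ?_
  · rintro N m' hm' ⟨f1, f2⟩ fr hlt
    have hlt' : m'.idx 5 < I.n := by
      have : m'.idx 5 < m'.idx 0 := hlt
      rwa [fr.1 0 (by decide), gi 0 (by norm_num), d0] at this
    have f9 : m'.idx 9 = 1 := (fr.1 9 (by decide)).trans g9
    have fi2 : m'.idx 2 = 0 := ((fr.1 2 (by decide)).trans (gi 2 (by norm_num))).trans d2
    have fn5 : m'.num 5 = m₂.num 5 := (fr.2 5 (by decide)).trans (gn 5 (by norm_num))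
    have fn7 : m'.num 7 = m₂.num 7 := (fr.2 7 (by decide)).trans (gn 7 (by norm_num))
    obtain ⟨N', rfl⟩ : ∃ N', N = N' + 1 := ⟨N - 1, by omega⟩
    refine ⟨N', rfl, Tri.arith_seq hm' (1 / I.sp 1) ?_ (hG.inv_sp one_pos hk)
      fun hm1 => Tri.inc hm1 ⟨?_, fun j hj => ?_⟩⟩
    · simp [Arith.eval, Store.get, f9, fi2, fn5, fn7, d5 1 (by omega), dn 7 (by norm_num),
        input_num_of_le (show 3 ≤ 7 by norm_num)]
    · simp [Store.setIdx, Store.set]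
      omega
    · simp only [Store.setIdx, Store.set, Function.update_self] at hj ⊢
      by_cases h : j = m'.idx 5
      · simp [h]
      · rw [Function.update_of_ne h]
        exact f2 j (by omega)
  · rintro N m' hm' ⟨f1, f2⟩ fr hlt
    have h0 : m'.idx 0 = I.n := ((fr.1 0 (by decide)).trans (gi 0 (by norm_num))).trans d0
    have hlt' : ¬ m'.idx 5 < m'.idx 0 := hlt
    refine ⟨h0, ((fr.1 1 (by decide)).trans (gi 1 (by norm_num))).trans d1,
      ((fr.1 2 (by decide)).trans (gi 2 (by norm_num))).trans d2, fun i _ => ?_, fun j => ?_, ?_,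
      ?_, ?_, ?_, ?_⟩
    · rw [fr.2 0 (by decide), gn 0 (by norm_num), dn 0 (by norm_num), input_num_zero]
    · rw [f2 j (by have := j.isLt; omega), hlow]
    · rw [fr.2 4 (by decide), gn 4 (by norm_num), dn 4 (by norm_num),
        input_num_of_le (by norm_num)]
    · rw [fr.2 5 (by decide), gn 5 (by norm_num)]
      exact d5
    · rw [fr.2 6 (by decide)]
      exact g6
    · rw [fr.2 7 (by decide), gn 7 (by norm_num), dn 7 (by norm_num),
        input_num_of_le (by norm_num)]
    · rw [fr.2 8 (by decide), gn 8 (by norm_num)]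
      exact d8
  · rw [g5]
    exact ⟨by omega, fun j hj => by omega⟩

/-- The steps of the whole program. -/
def programCost (I : Inst) : ℕ :=
  I.setupCost + ((I.n * I.k + I.n + 1) * (I.selectCost + 2 + 1) + 1 + (I.n * (2 + 1) + 1 + 1) + 3)
    + 1

lemma program_tri (hG : I.Covers G) : Tri G (program ρ) I.input I.programCost
    (fun m' => ∃ M v, I.Run ρ M v ∧ I.Halted ρ v ∧ ∀ j : Fin I.n, m'.num 3 j = v j) := by
  refine Tri.cond hG.input (fun hn => ?_) fun hn => ?_
  · have hn' : 0 < I.n := by simpa [Test.Holds, Inst.input] using hn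
    have hlow : ∀ j, I.lowest j = I.sp 1 := by
      have := I.k_pos
      simp [lowest, sp, this]
    refine Tri.seq (setup_tri hG) fun m₁ hm₁ hb => Tri.zero_seq hm₁ (Tri.inc_seq (hm₁.setIdx _ _)
      (Tri.zero_seq ((hm₁.setIdx _ _).setIdx _ _) ?_))
    refine Tri.seq (main_loop_tri (ρ := ρ) hG (((hm₁.setIdx _ _).setIdx _ _).setIdx _ _)
      ⟨I.lowest, hb.congr (fun x hx => ?_) (fun a _ => rfl), inRange_lowest, fun j => ?_,
      Or.inl ⟨?_, Nat.le_add_right _ _, ⟨0, hn'⟩, ?_, Run.init.midway _⟩⟩) ?_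
    · have : x ≠ 8 ∧ x ≠ 6 := by omega
      simp [Store.setIdx, this]
    · rw [hlow]
      exact inv_sp_mem one_pos I.k_pos
    · simp [Store.setIdx]
    · simp [Store.setIdx]
    · rintro m₂ hm₂ ⟨v, hb, hv, hL, ⟨M, hM⟩, hh⟩
      exact (output_tri hG hm₂ hb hv hL).mono le_rfl fun m' _ h => ⟨M, v, hM, hh, h⟩
  -- Without jobs there is nothing to select, and the empty vector of lowest speeds has already
  -- halted.
  · have hn' : I.n = 0 := by simpa [Test.Holds, Inst.input] using hn
    have hno : ∀ j : Fin I.n, False := fun j => by have := j.isLt; omega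
    exact Tri.of_le (Tri.skip hG.input ⟨0, I.lowest, Run.init, fun j => (hno j).elim,
      fun j => (hno j).elim⟩) (by omega)

end Inst

end SpeedScaling

end

noncomputable section

namespace SpeedScaling

/-! ### The length of the numbers -/

/-- `z` is a fraction whose numerator and denominator have at most `p` binary digits. -/
def Rep (p : ℕ) (z : ℝ) : Prop :=
  ∃ (a : ℤ) (d : ℕ), 0 < d ∧ z = a / d ∧ a.natAbs < 2 ^ p ∧ d < 2 ^ p

section Rep

variable {p q : ℕ} {x y z : ℝ}

lemma bitSize_coe (q : ℚ) : bitSize q = 1 + Nat.size q.num.natAbs + Nat.size q.den := by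
  have h : ∃ q' : ℚ, (q' : ℝ) = (q : ℝ) := ⟨q, rfl⟩
  have e : h.choose = q := Rat.cast_injective (α := ℝ) h.choose_spec
  rw [bitSize, dif_pos h, e]

lemma Rep.mono (h : Rep p z) (hpq : p ≤ q) : Rep q z := by
  obtain ⟨a, d, hd, hz, ha, hd'⟩ := h
  have := Nat.pow_le_pow_right two_pos hpq
  exact ⟨a, d, hd, hz, ha.trans_le this, hd'.trans_le this⟩

/-- `Rep` allows unreduced fractions; reduction replaces numerator and denominator by divisors. -/
lemma Rep.bitSize_le (h : Rep p z) : bitSize z ≤ 1 + 2 * p := by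
  obtain ⟨a, d, hd, rfl, ha, hd'⟩ := h
  have e : ((a : ℝ) / d) = ((a / d : ℚ) : ℝ) := by push_cast; rfl
  rw [e, bitSize_coe]
  have h1 : ((a / d : ℚ)).num.natAbs < 2 ^ p := by
    rcases eq_or_ne a 0 with rfl | h0
    · simp
    · refine lt_of_le_of_lt (Nat.le_of_dvd (Int.natAbs_pos.2 h0) ?_) ha
      have := Rat.num_dvd a (b := (d : ℤ)) (by exact_mod_cast hd.ne')
      rw [Rat.divInt_eq_div] at this
      exact Int.natAbs_dvd_natAbs.2 (by exact_mod_cast this)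
  have h2 : ((a / d : ℚ)).den < 2 ^ p := by
    refine lt_of_le_of_lt (Nat.le_of_dvd hd ?_) hd'
    have := Rat.den_dvd a (d : ℤ)
    rw [Rat.divInt_eq_div] at this
    exact_mod_cast this
  have := Nat.size_le.2 h1
  have := Nat.size_le.2 h2
  omega

lemma Rep.of_bitSize (hz : ∃ q : ℚ, (q : ℝ) = z) (h : bitSize z ≤ p) : Rep p z := by
  obtain ⟨q, rfl⟩ := hz
  rw [bitSize_coe] at h
  refine ⟨q.num, q.den, q.pos, ?_, Nat.size_le.1 (by omega), Nat.size_le.1 (by omega)⟩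
  exact_mod_cast (Rat.num_div_den q).symm

lemma Rep.natCast {c : ℕ} (hp : 0 < p) (h : c < 2 ^ p) : Rep p c :=
  ⟨c, 1, one_pos, by simp, by simpa using h, Nat.one_lt_two_pow hp.ne'⟩

lemma Rep.mul (hx : Rep p x) (hy : Rep q y) : Rep (p + q) (x * y) := by
  obtain ⟨a, d, hd, rfl, ha, hd'⟩ := hx
  obtain ⟨b, e, he, rfl, hb, he'⟩ := hy
  refine ⟨a * b, d * e, Nat.mul_pos hd he, ?_, ?_, ?_⟩
  · push_cast
    rw [div_mul_div_comm]
  · rw [Int.natAbs_mul, pow_add]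
    exact Nat.mul_lt_mul'' ha hb
  · rw [pow_add]
    exact Nat.mul_lt_mul'' hd' he'

lemma Rep.neg (hx : Rep p x) : Rep p (-x) := by
  obtain ⟨a, d, hd, rfl, ha, hd'⟩ := hx
  exact ⟨-a, d, hd, by push_cast; ring, by simpa using ha, hd'⟩

lemma Rep.add (hx : Rep p x) (hy : Rep q y) : Rep (p + q + 1) (x + y) := by
  obtain ⟨a, d, hd, rfl, ha, hd'⟩ := hx
  obtain ⟨b, e, he, rfl, hb, he'⟩ := hy
  have h1 : (a * e).natAbs < 2 ^ (p + q) := by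
    rw [Int.natAbs_mul, pow_add]
    exact Nat.mul_lt_mul'' ha (by simpa using he')
  have h2 : (d * b).natAbs < 2 ^ (p + q) := by
    rw [Int.natAbs_mul, pow_add]
    exact Nat.mul_lt_mul'' (by simpa using hd') hb
  have h3 : d * e < 2 ^ (p + q) := by
    rw [pow_add]
    exact Nat.mul_lt_mul'' hd' he'
  have h4 := Int.natAbs_add_le (a * e) (d * b)
  refine ⟨a * e + d * b, d * e, Nat.mul_pos hd he, ?_, ?_, ?_⟩
  · have hd0 : (d : ℝ) ≠ 0 := by exact_mod_cast hd.ne'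
    have he0 : (e : ℝ) ≠ 0 := by exact_mod_cast he.ne'
    push_cast
    rw [div_add_div _ _ hd0 he0]
  · rw [pow_succ]
    omega
  · rw [pow_succ]
    omega

lemma Rep.sub (hx : Rep p x) (hy : Rep q y) : Rep (p + q + 1) (x - y) := by
  rw [sub_eq_add_neg]
  exact hx.add hy.neg

lemma Rep.one_div (hx : Rep p x) : Rep p (1 / x) := by
  obtain ⟨a, d, hd, rfl, ha, hd'⟩ := hx
  rcases eq_or_ne a 0 with rfl | h0
  · exact ⟨0, 1, one_pos, by simp, by simp, lt_of_le_of_lt hd hd'⟩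
  · refine ⟨a.sign * d, a.natAbs, Int.natAbs_pos.2 h0, ?_, ?_, ha⟩
    · have h1 : (a.natAbs : ℝ) = |(a : ℝ)| := by rw [Nat.cast_natAbs, Int.cast_abs]
      have h2 : (a : ℝ) ≠ 0 := by exact_mod_cast h0
      rw [h1]
      rcases lt_or_gt_of_ne h0 with h | h
      · have h3 : (a : ℝ) < 0 := by exact_mod_cast h
        rw [abs_of_neg h3, Int.sign_eq_neg_one_of_neg h]
        push_cast
        rw [one_div_div, neg_one_mul, neg_div_neg_eq]
      · have h3 : (0 : ℝ) < a := by exact_mod_cast h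
        rw [abs_of_pos h3, Int.sign_eq_one_of_pos h]
        push_cast
        rw [one_div_div, one_mul]
    · rw [Int.natAbs_mul, Int.natAbs_sign_of_ne_zero h0]
      simpa using hd'

lemma Rep.div (hx : Rep p x) (hy : Rep q y) : Rep (p + q) (x / y) := by
  rw [div_eq_mul_one_div]
  exact hx.mul hy.one_div

lemma Rep.abs_lt (hx : Rep p x) : |x| < 2 ^ p := by
  obtain ⟨a, d, hd, rfl, ha, -⟩ := hx
  have h1 : (1 : ℝ) ≤ d := by exact_mod_cast hd
  have h2 : |(a : ℝ)| < 2 ^ p := by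
    have h3 : ((a.natAbs : ℕ) : ℝ) < ((2 ^ p : ℕ) : ℝ) := Nat.cast_lt.2 ha
    rwa [Nat.cast_natAbs, Int.cast_abs, Nat.cast_pow, Nat.cast_ofNat] at h3
  rw [abs_div, abs_of_pos (by linarith : (0 : ℝ) < d)]
  exact (div_le_self (abs_nonneg _) h1).trans_lt h2

end Rep

/-! ### Length of the numbers of a rational instance, and the polynomial bound for the steps -/

namespace Inst

variable {I : Inst}

lemma bitSize_r_le (j : Fin I.n) : bitSize (I.r j) ≤ I.size := by
  have := Finset.single_le_sum (f := fun j => bitSize (I.r j)) (fun _ _ => Nat.zero_le _)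
    (Finset.mem_univ j)
  unfold size
  omega

lemma bitSize_s_le (i : Fin (I.k + 1)) : bitSize (I.s i) ≤ I.size := by
  have := Finset.single_le_sum (f := fun i => bitSize (I.s i)) (fun _ _ => Nat.zero_le _)
    (Finset.mem_univ i)
  unfold size
  omega

lemma bitSize_P_le (i : Fin (I.k + 1)) : bitSize (I.P i) ≤ I.size := by
  have := Finset.single_le_sum (f := fun i => bitSize (I.P i)) (fun _ _ => Nat.zero_le _)
    (Finset.mem_univ i)
  unfold size
  omega

lemma n_add_k_le_size : I.n + I.k ≤ I.size := by
  unfold size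
  omega

lemma size_pos : 0 < I.size := by
  have := n_add_k_le_size (I := I)
  have := I.k_pos
  omega

lemma n_lt_two_pow : I.n < 2 ^ I.size := by
  have := n_add_k_le_size (I := I)
  exact lt_of_le_of_lt (by omega : I.n ≤ I.size) Nat.lt_two_pow_self

lemma rep_zero : Rep I.size 0 := by
  exact_mod_cast Rep.natCast (c := 0) size_pos (Nat.two_pow_pos _)

lemma rep_rel (hI : I.IsRational) (i : ℕ) : Rep I.size (I.rel i) := by
  unfold rel
  split_ifs
  · exact Rep.of_bitSize (hI.1 _) (bitSize_r_le _)
  · exact rep_zero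

lemma rep_sp (hI : I.IsRational) (i : ℕ) : Rep I.size (I.sp i) := by
  unfold sp
  split_ifs
  · exact Rep.of_bitSize (hI.2.1 _) (bitSize_s_le _)
  · exact rep_zero

lemma rep_pw (hI : I.IsRational) (i : ℕ) : Rep I.size (I.pw i) := by
  unfold pw
  split_ifs
  · exact Rep.of_bitSize (hI.2.2 _) (bitSize_P_le _)
  · exact rep_zero

lemma rep_del (hI : I.IsRational) (i : ℕ) : Rep (6 * I.size + 2) (I.del i) := by
  unfold del
  split_ifs
  · exact ((((rep_pw hI _).mul (rep_sp hI _)).sub ((rep_pw hI _).mul (rep_sp hI _))).div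
      ((rep_sp hI _).sub (rep_sp hI _))).mono (by omega)
  · have h1 := n_lt_two_pow (I := I)
    have : Rep (I.size + 1) ((I.n + 1 : ℕ) : ℝ) := Rep.natCast (by omega) (by rw [pow_succ]; omega)
    push_cast at this
    exact this.mono (by omega)

/-- The numbers of the lattice have a common denominator. -/
lemma exists_denominator (hI : I.IsRational) : ∃ D : ℕ, 0 < D ∧ D ≤ 2 ^ I.size ∧
    ∀ z ∈ I.lattice, ∃ a : ℤ, z = a / D := by
  choose qr hqr using hI.1
  choose qs hqs using hI.2.1
  -- An inverse speed has the numerator of the speed as its denominator, so the common denominator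
  -- multiplies denominators of release times and numerators of positive speeds. Each factor has at
  -- most as many bits as its input number, so the product has at most `size` bits up to rounding.
  set f : Fin I.n → ℕ := fun j => (qr j).den with hf
  set g : Fin (I.k + 1) → ℕ := fun i => if i = 0 then 1 else (qs i).num.natAbs with hg
  have hqs0 : ∀ i, i ≠ 0 → 0 < (qs i).num := by
    intro i hi
    have h1 : 0 < I.s i := by
      rw [← sp_val]
      exact sp_pos (Nat.pos_of_ne_zero fun hc => hi (Fin.ext hc)) (Nat.lt_succ_iff.1 i.isLt)
    rw [← hqs] at h1
    exact Rat.num_pos.2 (by exact_mod_cast h1)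
  have hg0 : ∀ i, 0 < g i := by
    intro i
    by_cases h : i = 0
    · simp [hg, h]
    · simpa [hg, h] using (hqs0 i h).ne'
  have hf2 : ∀ j, f j ≤ 2 ^ bitSize (I.r j) := by
    intro j
    simp only [hf]
    rw [← hqr j, bitSize_coe]
    exact (Nat.lt_size_self _).le.trans (Nat.pow_le_pow_right two_pos (by omega))
  have hg2 : ∀ i, g i ≤ 2 ^ bitSize (I.s i) := by
    intro i
    by_cases h : i = 0
    · simp only [hg, h, if_true]
      exact Nat.one_le_two_pow
    · simp only [hg, h, if_false]
      rw [← hqs i, bitSize_coe]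
      exact (Nat.lt_size_self _).le.trans (Nat.pow_le_pow_right two_pos (by omega))
  set D := (∏ j, f j) * ∏ i, g i with hD
  have hD0 : 0 < D := Nat.mul_pos (Finset.prod_pos fun j _ => (qr j).pos)
    (Finset.prod_pos fun i _ => hg0 i)
  have hDR : (D : ℝ) ≠ 0 := by exact_mod_cast hD0.ne'
  have hdiv : ∀ (a : ℤ) (d : ℕ), 0 < d → d ∣ D → ∃ b : ℤ, (a : ℝ) / d = b / D := by
    rintro a d hd ⟨e, he⟩
    refine ⟨a * e, ?_⟩
    have h1 : (d : ℝ) ≠ 0 := by exact_mod_cast hd.ne'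
    have h2 : (e : ℝ) ≠ 0 := fun hc => hDR (by rw [he]; push_cast; rw [hc, mul_zero])
    rw [he]
    push_cast
    field_simp
  refine ⟨D, hD0, ?_, fun z hz => ?_⟩
  · calc D ≤ (∏ j, 2 ^ bitSize (I.r j)) * ∏ i, 2 ^ bitSize (I.s i) :=
        Nat.mul_le_mul (Finset.prod_le_prod' fun j _ => hf2 j)
          (Finset.prod_le_prod' fun i _ => hg2 i)
      _ = 2 ^ (∑ j, bitSize (I.r j) + ∑ i, bitSize (I.s i)) := by
        rw [Finset.prod_pow_eq_pow_sum, Finset.prod_pow_eq_pow_sum, pow_add]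
      _ ≤ 2 ^ I.size := Nat.pow_le_pow_right two_pos (by unfold size; omega)
  · induction hz using AddSubgroup.closure_induction with
    | mem z hz =>
      rcases hz with ⟨j, rfl⟩ | ⟨i, h0, hi, rfl⟩
      · obtain ⟨b, hb⟩ := hdiv (qr j).num (f j) (qr j).pos
          ((Finset.dvd_prod_of_mem f (Finset.mem_univ j)).mul_right _)
        refine ⟨b, ?_⟩
        rw [← hb, ← hqr j]
        exact_mod_cast (Rat.num_div_den (qr j)).symm
      · set i' : Fin (I.k + 1) := ⟨i, by omega⟩ with hi'
        have hne : i' ≠ 0 := fun hc => h0.ne' (congrArg Fin.val hc)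
        obtain ⟨b, hb⟩ := hdiv (qs i').den (g i') (hg0 i')
          ((Finset.dvd_prod_of_mem g (Finset.mem_univ i')).mul_left _)
        refine ⟨b, ?_⟩
        rw [← hb, show I.sp i = I.s i' from sp_val i', ← hqs i']
        have h1 : ((qs i' : ℚ) : ℝ) = ((qs i').num : ℝ) / ((qs i').den : ℝ) := by
          exact_mod_cast (Rat.num_div_den (qs i')).symm
        have h2 : ((g i' : ℕ) : ℝ) = ((qs i').num : ℝ) := by
          simp only [hg, hne, if_false]
          rw [Nat.cast_natAbs, abs_of_pos (hqs0 i' hne)]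
        rw [h1, h2, one_div_div]
        push_cast
        rfl
    | zero => exact ⟨0, by simp⟩
    | add x y _ _ hx hy =>
      obtain ⟨a, rfl⟩ := hx
      obtain ⟨b, rfl⟩ := hy
      exact ⟨a + b, by push_cast; ring⟩
    | neg x _ hx =>
      obtain ⟨a, rfl⟩ := hx
      exact ⟨-a, by push_cast; ring⟩

lemma horizon_lt (hI : I.IsRational) : I.horizon < 2 ^ (2 * I.size + 1) := by
  have h1 : ∑ j, I.r j ≤ I.n * 2 ^ I.size := by
    calc ∑ j, I.r j ≤ ∑ _j : Fin I.n, (2 : ℝ) ^ I.size := Finset.sum_le_sum fun j _ => by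
          have := (rep_rel hI j).abs_lt
          rw [rel_val] at this
          exact (le_abs_self _).trans this.le
      _ = I.n * 2 ^ I.size := by simp
  have h2 : 1 / I.sp 1 < 2 ^ I.size := (le_abs_self _).trans_lt (rep_sp hI 1).one_div.abs_lt
  have h3 : (I.n : ℝ) + 1 ≤ 2 ^ I.size := by exact_mod_cast n_lt_two_pow (I := I)
  have h4 : (2 : ℝ) ^ (2 * I.size + 1) = 2 ^ I.size * 2 ^ I.size * 2 := by
    rw [pow_succ, two_mul, pow_add]
  have h5 : (0 : ℝ) < 2 ^ I.size := by positivity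
  unfold horizon
  rw [h4]
  nlinarith

/-- A common denominator together with a bound on the absolute value bounds the numerator, no matter
how many operations produced the number. -/
lemma rep_of_mem_lattice (hI : I.IsRational) {z : ℝ} (hz : z ∈ I.lattice)
    (h : |z| ≤ I.horizon) : Rep (3 * I.size + 1) z := by
  obtain ⟨D, hD, hD2, hL⟩ := exists_denominator hI
  obtain ⟨a, rfl⟩ := hL z hz
  have hDR : (0 : ℝ) < D := by exact_mod_cast hD
  refine ⟨a, D, hD, rfl, ?_, ?_⟩
  · rw [abs_div, abs_of_pos hDR, div_le_iff₀ hDR] at h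
    have h1 : (D : ℝ) ≤ 2 ^ I.size := by exact_mod_cast hD2
    have h2 := horizon_lt hI
    have h3 : |(a : ℝ)| < 2 ^ (3 * I.size + 1) := by
      calc |(a : ℝ)| ≤ I.horizon * D := h
        _ < 2 ^ (2 * I.size + 1) * D := mul_lt_mul_of_pos_right h2 hDR
        _ ≤ 2 ^ (2 * I.size + 1) * 2 ^ I.size := by gcongr
        _ = 2 ^ (3 * I.size + 1) := by rw [← pow_add]; congr 1; omega
    have h4 : ((a.natAbs : ℕ) : ℝ) < ((2 ^ (3 * I.size + 1) : ℕ) : ℝ) := by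
      rwa [Nat.cast_natAbs, Int.cast_abs, Nat.cast_pow, Nat.cast_ofNat]
    exact Nat.cast_lt.1 h4
  · exact hD2.trans_lt (Nat.pow_lt_pow_right one_lt_two (by omega))

/-- For rational instances, all numbers that occur have polynomial length. -/
lemma covers_rep (hI : I.IsRational) : I.Covers {z | Rep (7 * I.size + 4) z} where
  input a i := by
    rcases lt_or_ge a 3 with h | h
    · interval_cases a
      · exact (rep_rel hI i).mono (by omega)
      · exact (rep_sp hI i).mono (by omega)
      · exact (rep_pw hI i).mono (by omega)
    · rw [input_num_of_le h]
      exact (rep_zero (I := I)).mono (by omega)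
  nat c hc := by
    have h1 := n_lt_two_pow (I := I)
    exact (Rep.natCast (p := I.size + 1) (by omega) (by rw [pow_succ]; omega)).mono (by omega)
  mul i i' := ((rep_pw hI i).mul (rep_sp hI i')).mono (by omega)
  mul_sub i := (((rep_pw hI _).mul (rep_sp hI _)).sub ((rep_pw hI _).mul (rep_sp hI _))).mono
    (by omega)
  sub i := ((rep_sp hI _).sub (rep_sp hI _)).mono (by omega)
  del i := (rep_del hI i).mono (by omega)
  gain i c hc := by
    have h1 := n_lt_two_pow (I := I)
    exact ((Rep.natCast (p := I.size) (c := c) size_pos (by omega)).sub (rep_del hI i)).mono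
      (by omega)
  time z hz h := (rep_of_mem_lattice hI hz h).mono (by omega)
  inv z hz h0 h1 := by
    have hpos : 0 < z := (one_div_pos.2 (sp_pos I.k_pos le_rfl)).trans_le h0
    exact (rep_of_mem_lattice hI hz (by
      rw [abs_of_pos hpos]
      exact h1.trans horizon_ge)).one_div.mono (by omega)

/-- Unit costs need no restriction on the numbers, so arbitrary real inputs are covered. -/
lemma covers_univ : I.Covers Set.univ := by
  constructor <;> intros <;> exact Set.mem_univ _

open Polynomial in
/-- A bound for the number of steps, if `n` and `k` are at most the variable. -/
def costBound : ℕ[X] :=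
  X * 10 + 1 + (X * 3 + 1 + (X * 3 + 1 + 3) + 3) + 3 +
    ((X * X + X + 1) * ((6 * X + 3 + ((7 * X + 2 * X + 9) +
      (X * ((7 * X + 2 * X + 9) + 5 + 1) + 1 + 3) + 1)) + 2 + 1) + 1 + (X * 3 + 1 + 1) + 3) + 1

lemma programCost_le {N : ℕ} (hn : I.n ≤ N) (hk : I.k ≤ N) : I.programCost ≤ costBound.eval N := by
  have hk' : I.k - 1 ≤ N := by omega
  simp only [costBound, Polynomial.eval_add, Polynomial.eval_mul, Polynomial.eval_X,
    Polynomial.eval_one, Polynomial.eval_ofNat]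
  unfold programCost setupCost selectCost evalCost
  gcongr <;> norm_num

end Inst

end SpeedScaling

end

/-! ### The theorem -/

open SpeedScaling in
theorem mainTheorem10 (ρ : Rule) :
    -- every run, with ties broken arbitrarily, ends after at most `n² k` iterations, and it ends
    -- with an optimal schedule
    (∀ (I : Inst) (m : ℕ) (v : Fin I.n → ℝ), I.Run ρ m v →
      m ≤ I.n ^ 2 * I.k ∧
      (I.Halted ρ v ∨ ∃ v', I.Iteration ρ v v') ∧
      (I.Halted ρ v → (I.fifo v).Optimal)) ∧
    -- one program carries out the algorithm on all instances, in a number of steps that is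
    -- polynomial in `n + k`, and in polynomial bit cost if the instance is rational
    ∃ (prog : Cmd) (p q : Polynomial ℕ), ∀ I : Inst,
      (∃ (out : Store) (t m : ℕ) (v : Fin I.n → ℝ),
        Exec unitCost prog I.input out t ∧ t ≤ p.eval (I.n + I.k) ∧
        I.Run ρ m v ∧ I.Halted ρ v ∧ ∀ j : Fin I.n, out.num 3 j = v j) ∧
      (I.IsRational → ∃ (out : Store) (t : ℕ),
        Exec bitSize prog I.input out t ∧ t ≤ q.eval I.size) := by
  -- In the bit cost bound, every step handles at most three numbers, each of length at most `1 + 2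
  -- * (7 * size + 4)` by `covers_rep` and `Rep.bitSize_le`.
  refine ⟨fun I m v h => ⟨h.le_mul.trans ?_, ?_, h.optimal⟩, Inst.program ρ, Inst.costBound,
    (1 + 3 * (1 + 2 * (7 * Polynomial.X + 4))) * Inst.costBound, fun I => ⟨?_, fun hI => ?_⟩⟩
  -- The proof gives `n k` iterations, which is weakened to `n ^ 2 * k`.
  · exact Nat.mul_le_mul_right _ (Nat.le_self_pow two_ne_zero _)
  · by_cases hh : I.Halted ρ v
    · exact Or.inl hh
    · exact Or.inr (Inst.exists_iteration h.inRange hh)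
  · obtain ⟨out, ⟨M, v, hM, hh, hout⟩, -, hexec⟩ := Inst.program_tri (ρ := ρ) (I := I) Inst.covers_univ
    obtain ⟨t, ht, he⟩ := hexec unitCost 0 fun _ _ => le_rfl
    refine ⟨out, t, M, v, he, ?_, hM, hh, hout⟩
    rw [mul_zero, add_zero, one_mul] at ht
    exact ht.trans (Inst.programCost_le (Nat.le_add_right _ _) (Nat.le_add_left _ _))
  · obtain ⟨out, -, -, hexec⟩ := Inst.program_tri (ρ := ρ) (Inst.covers_rep hI)
    obtain ⟨t, ht, he⟩ := hexec bitSize (1 + 2 * (7 * I.size + 4)) fun z hz => Rep.bitSize_le hz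
    refine ⟨out, t, he, ht.trans ?_⟩
    have h1 := Inst.n_add_k_le_size (I := I)
    have h2 := Inst.programCost_le (I := I) (N := I.size) (by omega) (by omega)
    simp only [Polynomial.eval_mul, Polynomial.eval_add, Polynomial.eval_X, Polynomial.eval_one,
      Polynomial.eval_ofNat]
    exact Nat.mul_le_mul_left _ h2
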